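/- **Setting.** Let $K=K_1\cup\dots\cup K_m\subset\mathbf R^n$ ($m\ge 1$) be a union of finitely many pairwise disjoint simple closed curves of class $C^3$ (in particular, smooth ones are allowed), where $K_i$ has length $L_i$ and an $L_i$-periodic unit speed parametrization $\gamma_i:\mathbf R\to K_i$ with curvature $\kappa=\|\gamma_i''\|$. Let $\mu:K\to(0,\infty)$ be of class $C^2$, write $\mu(s)=\mu(\gamma_i(s))$, and let $\operatorname{grad}\mu(\gamma_i(s))=\mu'(s)\gamma_i'(s)$. Let $NK$ be the normal bundle of $K$, let $D(r)=\{(q,w)\in NK:\|w\|<r\}$ and $W=\{(q,w)\in NK:\|w\|\le 1/\|\operatorname{grad}\mu(q)\|\text{ if }\operatorname{grad}\mu(q)\ne0\}$, and define $\exp^\mu:W\to\mathbf R^n$ by $$\exp^\mu(q,w)=q-\mu(q)\|w\|^2\operatorname{grad}\mu(q)+\mu(q)\sqrt{1-\|\operatorname{grad}\mu(q)\|^2\|w\|^2}\;w .$$ * $DIR(K,\mu)$ is the supremum of all $r$ such that $D(r)\subset W$ and $\exp^\mu|_{D(r)}$ is a ($C^1$) diffeomorphism onto its image. * $TIR(K,\mu)$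 is the supremum of all $r$ such that $D(r)\subset W$ and $\exp^\mu|_{D(r)}$ is a homeomorphism onto its image. * $AIR(K,\mu)$ is the supremum of all $r$ such that, for some open and dense subset $U\subset W$ of $D(r)$, $\exp^\mu|_U$ is a homeomorphism onto an open subset of $\mathbf R^n$. * A pair $(q_1,q_2)\in K\times K$ with $q_1\ne q_2$ is double critical if it is a critical point of $\Sigma(x,y)=\|x-y\|^2(\mu(x)+\mu(y))^{-2}$ on $K\times K$, and $\frac12DCSD(K,\mu)$ is the minimum of $\frac{\|q_1-q_2\|}{\mu(q_1)+\mu(q_2)}$ over all double critical pairs. * Let $\Lambda=\frac12(\mu^2)''+\frac12\kappa^2\mu^2+\kappa\mu\sqrt{\mu\left(\mu''+\frac14\kappa^2\mu\right)}$. Define $$FocRad^0(K_i,\mu)=\Bigl(\max\bigl[\max\{\Lambda(s):(\mu''+\tfrac14\kappa^2\mu)(s)\ge0\},\ \max_s|\mu'(s)|^2\bigr]\Bigr)^{-1/2},$$ $$FocRad^-(K_i,\mu)=\Bigl(\max\bigl[\sup\{\Lambda(s):(\mu''+\tfrac14\kappa^2\mu)(s)>0\},\ \max_s|\mu'(s)|^2\bigr]\Bigr)^{-1/2},$$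 where $s$ runs over the parameters of $K_i$; $FocRad^0(K,\mu)$ and $FocRad^-(K,\mu)$ are the minima of these numbers over the components. * $LR(K,\mu)=\min\left(\frac12DCSD(K,\mu),FocRad^0(K,\mu)\right)$ and $UR(K,\mu)=\min\left(\frac12DCSD(K,\mu),FocRad^-(K,\mu)\right)$. **Theorem.** (i) For all such $(K,\mu)$, $LR(K,\mu)=DIR(K,\mu)\le TIR(K,\mu)\le AIR(K,\mu)=UR(K,\mu)$. (ii) For every fixed $K\subset\mathbf R^n$ as above, $LR(K,\mu)=UR(K,\mu)$ holds for all $\mu$ in some open and dense subset of $C^3(K,(0,\infty))$ in the $C^3$ topology. (iii) Let $(K^{(k)},\mu^{(k)})$, $k=1,2,\dots$, and $(K^{(0)},\mu^{(0)})$ be as above (with $C^2$ weights), and suppose that $(K^{(k)},\mu^{(k)})\to(K^{(0)},\mu^{(0)})$ in the $C^2$ topology, that is, for all large $k$ there are $C^2$ diffeomorphisms $\varphi_k:K^{(0)}\to K^{(k)}$ such that on $K^{(0)}$, uniformly with all arclength derivatives up to order two, $\varphi_k$ converges to the inclusion $K^{(0)}\subset\mathbf R^n$ and $\mu^{(k)}\circ\varphi_k$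 converges to $\mu^{(0)}$. Then $$\limsup_{k\to\infty}AIR(K^{(k)},\mu^{(k)})\le AIR(K^{(0)},\mu^{(0)}).$$ -/

import Mathlib

open Filter Topology

noncomputable section

/-- A union of finitely many (at least one) disjoint simple closed curves in `ℝⁿ`. The component
`i` has length `len i` and the `C³` unit speed parametrization `γ i : ℝ → ℝⁿ`, which is periodic
with period `len i`. The field `simple` says that each component is a simple closed curve
and that distinct components are disjoint. -/
structure ClosedCurves (n : ℕ) where
  m : ℕ
  m_pos : 0 < m
  len : Fin m → ℝ
  len_pos : ∀ i, 0 < len i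
  γ : Fin m → ℝ → EuclideanSpace ℝ (Fin n)
  contDiff : ∀ i, ContDiff ℝ 3 (γ i)
  unit_speed : ∀ i s, ‖deriv (γ i) s‖ = 1
  periodic : ∀ i, Function.Periodic (γ i) (len i)
  simple : ∀ i j s t, γ i s = γ j t → i = j ∧ ∃ k : ℤ, t = s + k * len i

namespace ClosedCurves

variable {n : ℕ}

/-- The underlying subset `K` of `ℝⁿ`. -/
def carrier (K : ClosedCurves n) : Set (EuclideanSpace ℝ (Fin n)) :=
  Set.range fun p : Fin K.m × ℝ => K.γ p.1 p.2

/-- The point `γ i s` of `K`. -/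
def point (K : ClosedCurves n) (i : Fin K.m) (s : ℝ) : K.carrier :=
  ⟨K.γ i s, (i, s), rfl⟩

/-- A parameter `(i, s)` of a point of `K`; it is unique up to adding multiples of the period
`len i` to `s`, so nothing below depends on the choice. -/
def param (K : ClosedCurves n) (q : K.carrier) : Fin K.m × ℝ :=
  q.2.choose

/-- `μ : K → (0, ∞)` is a weight function of class `C^k`. -/
def IsWeight (K : ClosedCurves n) (k : ℕ) (μ : K.carrier → ℝ) : Prop :=
  (∀ q, 0 < μ q) ∧ ∀ i, ContDiff ℝ k fun s => μ (K.point i s)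

/-- The unit tangent vector `γ'` at a point of `K`. -/
def tangent (K : ClosedCurves n) (q : K.carrier) : EuclideanSpace ℝ (Fin n) :=
  deriv (K.γ (K.param q).1) (K.param q).2

/-- The intrinsic gradient `μ'(s) γ'(s)` of `μ` at a point of `K`. -/
def grad (K : ClosedCurves n) (μ : K.carrier → ℝ) (q : K.carrier) : EuclideanSpace ℝ (Fin n) :=
  deriv (fun s => μ (K.point (K.param q).1 s)) (K.param q).2 • K.tangent q

/-- The normal bundle `NK`. -/
def normalBundle (K : ClosedCurves n) : Set (K.carrier × EuclideanSpace ℝ (Fin n)) :=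
  {x | inner ℝ (K.tangent x.1) x.2 = 0}

/-- The domain `W` of the exponential map. -/
def expDomain (K : ClosedCurves n) (μ : K.carrier → ℝ) :
    Set (K.carrier × EuclideanSpace ℝ (Fin n)) :=
  {x | x ∈ K.normalBundle ∧ (‖K.grad μ x.1‖ ≠ 0 → ‖x.2‖ ≤ 1 / ‖K.grad μ x.1‖)}

/-- The map `exp^μ`; only its values on `W = K.expDomain μ` are meaningful. -/
def expMap (K : ClosedCurves n) (μ : K.carrier → ℝ) (x : K.carrier × EuclideanSpace ℝ (Fin n)) :
    EuclideanSpace ℝ (Fin n) :=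
  (x.1 : EuclideanSpace ℝ (Fin n)) - (μ x.1 * ‖x.2‖ ^ 2) • K.grad μ x.1
    + (μ x.1 * √(1 - ‖K.grad μ x.1‖ ^ 2 * ‖x.2‖ ^ 2)) • x.2

/-- The set `D(r)` of normal vectors of length less than `r`. -/
def normalDisc (K : ClosedCurves n) (r : ℝ) : Set (K.carrier × EuclideanSpace ℝ (Fin n)) :=
  {x | x ∈ K.normalBundle ∧ ‖x.2‖ < r}

/-- `F` restricted to `D` is a `C¹` diffeomorphism onto its image. Here `D` is viewed as a subset
of `ℝⁿ × ℝⁿ`, and both `F` (as the function `f` on that subset) and the inverse map `g` on the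
image of `D` are of class `C¹`. -/
def IsDiffeoOntoImage (K : ClosedCurves n) (D : Set (K.carrier × EuclideanSpace ℝ (Fin n)))
    (F : K.carrier × EuclideanSpace ℝ (Fin n) → EuclideanSpace ℝ (Fin n)) : Prop :=
  ∃ (f : EuclideanSpace ℝ (Fin n) × EuclideanSpace ℝ (Fin n) → EuclideanSpace ℝ (Fin n))
    (g : EuclideanSpace ℝ (Fin n) → EuclideanSpace ℝ (Fin n) × EuclideanSpace ℝ (Fin n)),
    ContDiffOn ℝ 1 f
      ((fun x : K.carrier × EuclideanSpace ℝ (Fin n) =>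
        ((x.1 : EuclideanSpace ℝ (Fin n)), x.2)) '' D) ∧
    ContDiffOn ℝ 1 g (F '' D) ∧
    ∀ x ∈ D, f ((x.1 : EuclideanSpace ℝ (Fin n)), x.2) = F x ∧
      g (F x) = ((x.1 : EuclideanSpace ℝ (Fin n)), x.2)

/-- The differentiable injectivity radius. -/
def DIR (K : ClosedCurves n) (μ : K.carrier → ℝ) : EReal :=
  sSup (((↑) : ℝ → EReal) '' {r | K.normalDisc r ⊆ K.expDomain μ ∧
    K.IsDiffeoOntoImage (K.normalDisc r) (K.expMap μ)})

/-- The topological injectivity radius. -/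
def TIR (K : ClosedCurves n) (μ : K.carrier → ℝ) : EReal :=
  sSup (((↑) : ℝ → EReal) '' {r | K.normalDisc r ⊆ K.expDomain μ ∧
    IsEmbedding ((K.normalDisc r).domRestrict (K.expMap μ))})

/-- The almost injectivity radius: `exp^μ` is a homeomorphism from a (relatively) open and dense
subset `U` of `D(r)` onto an open subset of `ℝⁿ`. -/
def AIR (K : ClosedCurves n) (μ : K.carrier → ℝ) : EReal :=
  sSup (((↑) : ℝ → EReal) '' {r | ∃ U : Set (K.carrier × EuclideanSpace ℝ (Fin n)),
    U ⊆ K.expDomain μ ∧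
    (∃ V, IsOpen V ∧ U = K.normalDisc r ∩ V) ∧ K.normalDisc r ⊆ closure U ∧
    IsOpen (K.expMap μ '' U) ∧ IsEmbedding (U.domRestrict (K.expMap μ))})

/-- `(q₁, q₂)` is a double critical pair: `q₁ ≠ q₂` and the gradient of
`σ(s, t) = ‖γ i s - γ j t‖² (μ(γ i s) + μ(γ j t))⁻²` vanishes at the parameters of `q₁, q₂`. -/
def IsDoubleCriticalPair (K : ClosedCurves n) (μ : K.carrier → ℝ) (q₁ q₂ : K.carrier) : Prop :=
  q₁ ≠ q₂ ∧ ∃ i s j t, K.point i s = q₁ ∧ K.point j t = q₂ ∧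
    HasFDerivAt (fun p : ℝ × ℝ =>
        ‖K.γ i p.1 - K.γ j p.2‖ ^ 2 / (μ (K.point i p.1) + μ (K.point j p.2)) ^ 2)
      (0 : ℝ × ℝ →L[ℝ] ℝ) (s, t)

/-- Half of the double critical self `μ`-distance, `½ DCSD(K, μ)`. -/
def halfDCSD (K : ClosedCurves n) (μ : K.carrier → ℝ) : EReal :=
  sInf {d | ∃ q₁ q₂ : K.carrier, K.IsDoubleCriticalPair μ q₁ q₂ ∧
    d = ((‖(q₁ : EuclideanSpace ℝ (Fin n)) - q₂‖ / (μ q₁ + μ q₂) : ℝ) : EReal)}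

/-- The curvature `κ` of the component `i` at parameter `s`. -/
def curvature (K : ClosedCurves n) (i : Fin K.m) (s : ℝ) : ℝ :=
  ‖iteratedDeriv 2 (K.γ i) s‖

/-- The function `μ'' + ¼ κ² μ` along the component `i`. -/
def focalSign (K : ClosedCurves n) (μ : K.carrier → ℝ) (i : Fin K.m) (s : ℝ) : ℝ :=
  iteratedDeriv 2 (fun t => μ (K.point i t)) s + 1 / 4 * K.curvature i s ^ 2 * μ (K.point i s)

/-- The function `½ (μ²)'' + ½ κ² μ² + κ μ √(μ (μ'' + ¼ κ² μ))` along the component `i`. -/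
def focalValue (K : ClosedCurves n) (μ : K.carrier → ℝ) (i : Fin K.m) (s : ℝ) : ℝ :=
  1 / 2 * iteratedDeriv 2 (fun t => μ (K.point i t) ^ 2) s
    + 1 / 2 * K.curvature i s ^ 2 * μ (K.point i s) ^ 2
    + K.curvature i s * μ (K.point i s) * √(μ (K.point i s) * K.focalSign μ i s)

/-- `FocRad⁰` of the component `i`. -/
def focRadZeroComponent (K : ClosedCurves n) (μ : K.carrier → ℝ) (i : Fin K.m) : ℝ :=
  (max (sSup (K.focalValue μ i '' {s | 0 ≤ K.focalSign μ i s}))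
    (sSup (Set.range fun s => |deriv (fun t => μ (K.point i t)) s| ^ 2))) ^ (-(1 / 2) : ℝ)

/-- `FocRad⁻` of the component `i`. -/
def focRadMinusComponent (K : ClosedCurves n) (μ : K.carrier → ℝ) (i : Fin K.m) : ℝ :=
  (max (sSup (K.focalValue μ i '' {s | 0 < K.focalSign μ i s}))
    (sSup (Set.range fun s => |deriv (fun t => μ (K.point i t)) s| ^ 2))) ^ (-(1 / 2) : ℝ)

/-- `FocRad⁰(K, μ)`, the minimum over the components. -/
def focRadZero (K : ClosedCurves n) (μ : K.carrier → ℝ) : EReal :=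
  ⨅ i, (K.focRadZeroComponent μ i : EReal)

/-- `FocRad⁻(K, μ)`, the minimum over the components. -/
def focRadMinus (K : ClosedCurves n) (μ : K.carrier → ℝ) : EReal :=
  ⨅ i, (K.focRadMinusComponent μ i : EReal)

/-- The lower radius. -/
def LR (K : ClosedCurves n) (μ : K.carrier → ℝ) : EReal :=
  min (K.halfDCSD μ) (K.focRadZero μ)

/-- The upper radius. -/
def UR (K : ClosedCurves n) (μ : K.carrier → ℝ) : EReal :=
  min (K.halfDCSD μ) (K.focRadMinus μ)

/-- The space `C³(K, (0, ∞))`. -/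
def C3Weight (K : ClosedCurves n) : Type :=
  {μ : K.carrier → ℝ // K.IsWeight 3 μ}

/-- The `C³` topology: uniform convergence of the derivatives of order `0, 1, 2, 3` with respect
to arclength on every component. -/
instance (K : ClosedCurves n) : TopologicalSpace K.C3Weight :=
  TopologicalSpace.induced
    (fun μ (i : Fin K.m) (d : Fin 4) =>
      UniformFun.ofFun (iteratedDeriv (d : ℕ) fun s => μ.1 (K.point i s)))
    (inferInstance : TopologicalSpace (Fin K.m → Fin 4 → UniformFun ℝ ℝ))

/-- `φ : K → M` is a `C²` diffeomorphism between two unions of closed curves. -/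
def IsC2Diffeo (K M : ClosedCurves n) (φ : K.carrier → M.carrier) : Prop :=
  Function.Bijective φ ∧ ∀ i,
    ContDiff ℝ 2 (fun s => (φ (K.point i s) : EuclideanSpace ℝ (Fin n))) ∧
    ∀ s, deriv (fun s => (φ (K.point i s) : EuclideanSpace ℝ (Fin n))) s ≠ 0

/-- `(K k, μ k) → (K₀, μ₀)` in the `C²` topology: for all large `k` there are `C²`
diffeomorphisms `φ k : K₀ → K k` such that, as maps on `K₀`, `φ k` converges to the inclusion
`K₀ ⊂ ℝⁿ` and `μ k ∘ φ k` converges to `μ₀`, uniformly with all derivatives up to order two. -/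
def C2Converges (K : ℕ → ClosedCurves n) (μ : ∀ k, (K k).carrier → ℝ)
    (K₀ : ClosedCurves n) (μ₀ : K₀.carrier → ℝ) : Prop :=
  ∃ φ : ∀ k, K₀.carrier → (K k).carrier,
    (∀ᶠ k in atTop, IsC2Diffeo K₀ (K k) (φ k)) ∧
    ∀ (i : Fin K₀.m) (d : ℕ), d ≤ 2 →
      TendstoUniformly
        (fun k => iteratedDeriv d
          fun s => ((φ k (K₀.point i s) : (K k).carrier) : EuclideanSpace ℝ (Fin n)))
        (iteratedDeriv d (K₀.γ i)) atTop ∧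
      TendstoUniformly
        (fun k => iteratedDeriv d fun s => μ k (φ k (K₀.point i s)))
        (iteratedDeriv d fun s => μ₀ (K₀.point i s)) atTop

end ClosedCurves

end

noncomputable section

namespace ClosedCurves

variable {n : ℕ} (K : ClosedCurves n)

/-! ### Parameters of points -/

/-! Fix p and look at q ↦ ‖p - q‖²/μ(q)² on K. As long as |μ'| r ≤ 1, the vectors of D(r) that exp^μ
sends to p correspond exactly to the critical points q with ‖p - q‖ < r μ(q), and the critical value
is ‖w‖² (`crit_expMap`, `logVec_expMap`, `expMap_logVec`). Where the second derivative `hess` does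
not vanish, the implicit function theorem gives exp^μ a local C¹ right inverse. For w in the
direction of γ'', `focal_identity` writes `hess` as a positive factor times a square minus μ(μ'' +
κ²μ/4). Its first zero is at ‖w‖ = Λ^(-1/2). It becomes negative beyond that zero when μ'' + κ²μ/4 >
0, but has only a double zero when this quantity is 0. This is the difference between FocRad⁰ and
FocRad⁻.

LR = DIR. Below LR all vectors are nondegenerate, and `crit_unique` shows that no p has two critical
points of small value: a pair with minimal larger value could be improved by moving p, unless it is
double critical. Conversely, a diffeomorphism has no degenerate vectors
(`hess_ne_zero_of_isDiffeoOntoImage`), and injectivity bounds r by every double critical distance.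

AIR = UR. The central notion is `ExpMinimal`: the foot q of each vector in D(r) is a global
minimizer of the weighted distance. AIR is the supremum of the r with this property
(`expMinimal_of_dense`, `ExpMinimal.le_AIR`). Minimality forces `hess` ≥ 0 and r ≤ ½DCSD, hence AIR
≤ UR. For UR ≤ AIR the weight is replaced by μ - ε. This turns double zeros of `hess` harmless,
since μ'' + κ²μ/4 drops wherever κ ≠ 0. The argument for LR then applies to μ - ε, and minimality
survives the limit ε → 0 although injectivity may not.

Semicontinuity holds because `ExpMinimal` is a closed condition under the given convergence. For
generic μ, the function μ'' + κ²μ/4 has only simple zeros. Then {≥ 0} is the closure of {> 0}, and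
the two focal radii agree. Density follows from the one-dimensional Sard theorem. -/

theorem point_param (q : K.carrier) : K.point (K.param q).1 (K.param q).2 = q :=
  Subtype.ext q.2.choose_spec

theorem exists_point (q : K.carrier) : ∃ i s, K.point i s = q :=
  ⟨_, _, K.point_param q⟩

theorem coe_point (i : Fin K.m) (s : ℝ) :
    (K.point i s : EuclideanSpace ℝ (Fin n)) = K.γ i s := rfl

theorem point_eq_iff {i j : Fin K.m} {s t : ℝ} :
    K.point i s = K.point j t ↔ i = j ∧ ∃ k : ℤ, t = s + k * K.len i := by
  constructor
  · intro h
    exact K.simple i j s t (congrArg Subtype.val h)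
  · rintro ⟨rfl, k, rfl⟩
    exact Subtype.ext ((K.periodic i).int_mul k s).symm

theorem point_periodic (i : Fin K.m) : Function.Periodic (K.point i) (K.len i) :=
  fun s => Subtype.ext (K.periodic i s)

theorem continuous_point (i : Fin K.m) : Continuous (K.point i) :=
  (K.contDiff i).continuous.subtype_mk _

theorem exists_point_Icc (q : K.carrier) :
    ∃ i, ∃ s ∈ Set.Icc 0 (K.len i), K.point i s = q := by
  obtain ⟨i, s, rfl⟩ := K.exists_point q
  obtain ⟨t, ht, h⟩ := (K.point_periodic i).exists_mem_Ico₀ (K.len_pos i) s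
  exact ⟨i, t, ⟨ht.1, ht.2.le⟩, h.symm⟩

instance : CompactSpace K.carrier := by
  have : (Set.univ : Set K.carrier) = ⋃ i, K.point i '' Set.Icc 0 (K.len i) := by
    refine (Set.eq_univ_of_forall fun q => ?_).symm
    obtain ⟨i, s, hs, rfl⟩ := K.exists_point_Icc q
    exact Set.mem_iUnion.2 ⟨i, s, hs, rfl⟩
  refine ⟨this ▸ isCompact_iUnion fun i => ?_⟩
  exact isCompact_Icc.image (K.continuous_point i)

instance : Nonempty K.carrier := ⟨K.point ⟨0, K.m_pos⟩ 0⟩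

/-- The parametrization of `K` by all parameters is an open map, component by component. -/
theorem isOpenMap_point (i : Fin K.m) : IsOpenMap (K.point i) := by
  intro O hO
  set P : Fin K.m → Set ℝ := fun j => {t | ∃ u ∈ O, K.point i u = K.point j t} with hP
  have hPo : ∀ j, IsOpen (P j) := by
    intro j
    by_cases hij : i = j
    · subst hij
      have : P i = ⋃ k : ℤ, (fun t => t + k * K.len i) ⁻¹' O := by
        ext t
        simp only [hP, Set.mem_ofPred_eq, Set.mem_iUnion, Set.mem_preimage]
        constructor
        · rintro ⟨u, hu, h⟩
          obtain ⟨-, k, rfl⟩ := K.point_eq_iff.1 h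
          exact ⟨-k, by simpa using hu⟩
        · rintro ⟨k, hk⟩
          exact ⟨_, hk, K.point_eq_iff.2 ⟨rfl, -k, by push_cast; ring⟩⟩
      rw [this]
      exact isOpen_iUnion fun k => hO.preimage (by fun_prop)
    · have : P j = ∅ := by
        refine Set.eq_empty_of_forall_notMem fun t => ?_
        rintro ⟨u, -, h⟩
        exact hij (K.point_eq_iff.1 h).1
      rw [this]
      exact isOpen_empty
  -- The complement is compact: on each component it is the image of a fundamental interval minus
  -- the open saturated set `P j`.
  have hcompl : (K.point i '' O)ᶜ = ⋃ j, K.point j '' (Set.Icc 0 (K.len j) \ P j) := by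
    ext q
    simp only [Set.mem_compl_iff, Set.mem_iUnion]
    constructor
    · intro hq
      obtain ⟨j, t, ht, rfl⟩ := K.exists_point_Icc q
      exact ⟨j, t, ⟨ht, fun ⟨u, hu, h⟩ => hq ⟨u, hu, h⟩⟩, rfl⟩
    · rintro ⟨j, t, ⟨-, ht⟩, rfl⟩ ⟨u, hu, h⟩
      exact ht ⟨u, hu, h⟩
  have hclosed : IsClosed (K.point i '' O)ᶜ := by
    rw [hcompl]
    refine (isCompact_iUnion fun j => ?_).isClosed
    exact (isCompact_Icc.diff (hPo j)).image (K.continuous_point j)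
  exact isClosed_compl_iff.1 hclosed

/-! ### Functions on `K` given by periodic functions of the parameter -/

/-- The function on `K` induced by a family of functions of the parameter. -/
def lift {X : Type*} (f : Fin K.m → ℝ → X) (q : K.carrier) : X :=
  f (K.param q).1 (K.param q).2

theorem lift_point {X : Type*} {f : Fin K.m → ℝ → X}
    (hf : ∀ i, Function.Periodic (f i) (K.len i)) (i : Fin K.m) (s : ℝ) :
    K.lift f (K.point i s) = f i s := by
  obtain ⟨h, k, hk⟩ := K.point_eq_iff.1 (K.point_param (K.point i s)).symm
  unfold lift
  rw [hk, ← h]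
  exact (hf i).int_mul k s

/-- Openness of the parametrization turns local questions on K into questions about the parameter.
-/
theorem map_nhds_point (i : Fin K.m) (s : ℝ) : map (K.point i) (𝓝 s) = 𝓝 (K.point i s) :=
  le_antisymm (K.continuous_point i).continuousAt ((K.isOpenMap_point i).nhds_le s)

theorem continuous_lift {X : Type*} [TopologicalSpace X] {f : Fin K.m → ℝ → X}
    (hf : ∀ i, Function.Periodic (f i) (K.len i)) (hc : ∀ i, Continuous (f i)) :
    Continuous (K.lift f) := by
  rw [continuous_iff_continuousAt]
  intro q
  obtain ⟨i, s, rfl⟩ := K.exists_point q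
  have : K.lift f ∘ K.point i = f i := funext (K.lift_point hf i)
  rw [ContinuousAt, ← K.map_nhds_point, tendsto_map'_iff, this, K.lift_point hf]
  exact (hc i).continuousAt

theorem continuous_of_point {X : Type*} [TopologicalSpace X] {f : K.carrier → X}
    (hc : ∀ i, Continuous fun s => f (K.point i s)) : Continuous f := by
  rw [continuous_iff_continuousAt]
  intro q
  obtain ⟨i, s, rfl⟩ := K.exists_point q
  rw [ContinuousAt, ← K.map_nhds_point, tendsto_map'_iff]
  exact (hc i).continuousAt

/-! ### Arclength derivatives as functions on K. -/

theorem periodic_deriv {F : Type*} [NormedAddCommGroup F] [NormedSpace ℝ F] {f : ℝ → F} {c : ℝ}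
    (hf : Function.Periodic f c) : Function.Periodic (deriv f) c := by
  intro s
  rw [← deriv_comp_add_const, show (fun x => f (x + c)) = f from funext hf]

theorem periodic_weight (μ : K.carrier → ℝ) (i : Fin K.m) :
    Function.Periodic (fun s => μ (K.point i s)) (K.len i) :=
  (K.point_periodic i).comp μ

/-- The derivative of `μ` with respect to arclength. -/
def slope (μ : K.carrier → ℝ) : K.carrier → ℝ :=
  K.lift fun i => deriv fun s => μ (K.point i s)

/-- The second derivative of `μ` with respect to arclength. -/
def slope₂ (μ : K.carrier → ℝ) : K.carrier → ℝ :=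
  K.lift fun i => deriv (deriv fun s => μ (K.point i s))

/-- The curvature vector `γ''`. -/
def curvVec : K.carrier → EuclideanSpace ℝ (Fin n) :=
  K.lift fun i => deriv (deriv (K.γ i))

theorem tangent_point (i : Fin K.m) (s : ℝ) : K.tangent (K.point i s) = deriv (K.γ i) s :=
  K.lift_point (f := fun i => deriv (K.γ i)) (fun i => periodic_deriv (K.periodic i)) i s

theorem slope_point (μ : K.carrier → ℝ) (i : Fin K.m) (s : ℝ) :
    K.slope μ (K.point i s) = deriv (fun s => μ (K.point i s)) s :=
  K.lift_point (fun i => periodic_deriv (K.periodic_weight μ i)) i s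

theorem slope₂_point (μ : K.carrier → ℝ) (i : Fin K.m) (s : ℝ) :
    K.slope₂ μ (K.point i s) = deriv (deriv fun s => μ (K.point i s)) s :=
  K.lift_point (fun i => periodic_deriv (periodic_deriv (K.periodic_weight μ i))) i s

theorem curvVec_point (i : Fin K.m) (s : ℝ) :
    K.curvVec (K.point i s) = deriv (deriv (K.γ i)) s :=
  K.lift_point (fun i => periodic_deriv (periodic_deriv (K.periodic i))) i s

theorem grad_eq (μ : K.carrier → ℝ) (q : K.carrier) : K.grad μ q = K.slope μ q • K.tangent q := rfl

theorem contDiff_deriv_γ (i : Fin K.m) : ContDiff ℝ 2 (deriv (K.γ i)) :=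
  ((contDiff_succ_iff_deriv (n := 2)).1 (K.contDiff i)).2.2

theorem contDiff_deriv₂_γ (i : Fin K.m) : ContDiff ℝ 1 (deriv (deriv (K.γ i))) :=
  ((contDiff_succ_iff_deriv (n := 1)).1 (K.contDiff_deriv_γ i)).2.2

variable {K} in
theorem IsWeight.contDiff_deriv {μ : K.carrier → ℝ} (h : K.IsWeight 2 μ) (i : Fin K.m) :
    ContDiff ℝ 1 (deriv fun s => μ (K.point i s)) :=
  ((contDiff_succ_iff_deriv (n := 1)).1 (h.2 i)).2.2

variable {K} in
theorem IsWeight.continuous_deriv₂ {μ : K.carrier → ℝ} (h : K.IsWeight 2 μ) (i : Fin K.m) :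
    Continuous (deriv (deriv fun s => μ (K.point i s))) :=
  (h.contDiff_deriv i).continuous_deriv le_rfl

variable {K} in
theorem IsWeight.continuous {μ : K.carrier → ℝ} {k : ℕ} (h : K.IsWeight k μ) : Continuous μ :=
  K.continuous_of_point fun i => (h.2 i).continuous

theorem continuous_tangent : Continuous K.tangent :=
  K.continuous_lift (f := fun i => deriv (K.γ i)) (fun i => periodic_deriv (K.periodic i))
    fun i => (K.contDiff_deriv_γ i).continuous

theorem continuous_curvVec : Continuous K.curvVec :=
  K.continuous_lift (fun i => periodic_deriv (periodic_deriv (K.periodic i)))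
    fun i => (K.contDiff_deriv₂_γ i).continuous

variable {K} in
theorem IsWeight.continuous_slope {μ : K.carrier → ℝ} (h : K.IsWeight 2 μ) :
    Continuous (K.slope μ) :=
  K.continuous_lift (fun i => periodic_deriv (K.periodic_weight μ i))
    fun i => (h.contDiff_deriv i).continuous

variable {K} in
theorem IsWeight.continuous_slope₂ {μ : K.carrier → ℝ} (h : K.IsWeight 2 μ) :
    Continuous (K.slope₂ μ) :=
  K.continuous_lift (fun i => periodic_deriv (periodic_deriv (K.periodic_weight μ i)))
    h.continuous_deriv₂

theorem norm_tangent (q : K.carrier) : ‖K.tangent q‖ = 1 := K.unit_speed _ _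

theorem inner_tangent_self (q : K.carrier) : inner ℝ (K.tangent q) (K.tangent q) = 1 := by
  rw [real_inner_self_eq_norm_sq, norm_tangent, one_pow]

theorem norm_grad (μ : K.carrier → ℝ) (q : K.carrier) : ‖K.grad μ q‖ = |K.slope μ q| := by
  rw [grad_eq, norm_smul, norm_tangent, mul_one, Real.norm_eq_abs]

theorem hasDerivAt_γ (i : Fin K.m) (s : ℝ) : HasDerivAt (K.γ i) (deriv (K.γ i) s) s :=
  ((K.contDiff i).differentiable (by norm_num) s).hasDerivAt

theorem hasDerivAt_deriv_γ (i : Fin K.m) (s : ℝ) :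
    HasDerivAt (deriv (K.γ i)) (deriv (deriv (K.γ i)) s) s :=
  ((K.contDiff_deriv_γ i).differentiable (by norm_num) s).hasDerivAt

variable {K} in
theorem IsWeight.hasDerivAt {μ : K.carrier → ℝ} (h : K.IsWeight 2 μ) (i : Fin K.m) (s : ℝ) :
    HasDerivAt (fun s => μ (K.point i s)) (deriv (fun s => μ (K.point i s)) s) s :=
  ((h.2 i).differentiable (by norm_num) s).hasDerivAt

variable {K} in
theorem IsWeight.hasDerivAt_deriv {μ : K.carrier → ℝ} (h : K.IsWeight 2 μ) (i : Fin K.m) (s : ℝ) :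
    HasDerivAt (deriv fun s => μ (K.point i s))
      (deriv (deriv fun s => μ (K.point i s)) s) s :=
  ((h.contDiff_deriv i).differentiable (by norm_num) s).hasDerivAt

theorem inner_tangent_curvVec (q : K.carrier) : inner ℝ (K.tangent q) (K.curvVec q) = 0 := by
  obtain ⟨i, s, rfl⟩ := K.exists_point q
  have h := (K.hasDerivAt_deriv_γ i s).inner ℝ (K.hasDerivAt_deriv_γ i s)
  have h1 : (fun s => inner ℝ (deriv (K.γ i) s) (deriv (K.γ i) s)) = fun _ => (1 : ℝ) := by
    funext t
    rw [real_inner_self_eq_norm_sq, K.unit_speed, one_pow]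
  rw [h1] at h
  have := h.unique (hasDerivAt_const s (1 : ℝ))
  rw [tangent_point, curvVec_point]
  rw [real_inner_comm (deriv (K.γ i) s)] at this
  linarith

/-- Every normal space contains a unit vector. -/
theorem exists_unit_normal (q : K.carrier) :
    ∃ u : EuclideanSpace ℝ (Fin n), ‖u‖ = 1 ∧ inner ℝ (K.tangent q) u = 0 := by
  have i : Fin K.m := ⟨0, K.m_pos⟩
  -- The height in the direction of the tangent at q has a maximum on a closed curve, and the unit
  -- tangent there is the required normal vector. In particular n ≥ 2 is automatic.
  have hper : Function.Periodic (fun s => inner ℝ (K.tangent q) (K.γ i s)) (K.len i) :=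
    (K.periodic i).comp fun x => inner ℝ (K.tangent q) x
  have hcont : Continuous fun s => inner ℝ (K.tangent q) (K.γ i s) :=
    continuous_const.inner (K.contDiff i).continuous
  obtain ⟨s, -, hs⟩ := isCompact_Icc.exists_isMaxOn (Set.nonempty_Icc.2 (K.len_pos i).le)
    hcont.continuousOn
  have hmax : IsLocalMax (fun s => inner ℝ (K.tangent q) (K.γ i s)) s := by
    refine Eventually.of_forall fun t => ?_
    obtain ⟨u, hu, h⟩ := hper.exists_mem_Ico₀ (K.len_pos i) t
    simp only at h ⊢
    rw [h]
    exact hs ⟨hu.1, hu.2.le⟩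
  refine ⟨deriv (K.γ i) s, K.unit_speed i s, ?_⟩
  have h := (hasDerivAt_const s (K.tangent q)).inner ℝ (K.hasDerivAt_γ i s)
  simpa using hmax.hasDerivAt_eq_zero h

end ClosedCurves

end

noncomputable section

namespace ClosedCurves

variable {n : ℕ} (K : ClosedCurves n)

/-! ### The exponential map and critical points of the weighted distance -/

/-- Up to a nonzero factor, the derivative of `q ↦ ‖p - q‖² / μ(q)²` along `K`. -/
def crit (μ : K.carrier → ℝ) (p : EuclideanSpace ℝ (Fin n)) (q : K.carrier) : ℝ :=
  inner ℝ (p - q) (K.tangent q) * μ q + ‖p - q‖ ^ 2 * K.slope μ q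

/-- The normal vector `w` at `q` with `exp^μ(q, w) = p`, if `q` is critical for `p`. -/
def logVec (μ : K.carrier → ℝ) (p : EuclideanSpace ℝ (Fin n)) (q : K.carrier) :
    EuclideanSpace ℝ (Fin n) :=
  (μ q * √(1 - K.slope μ q ^ 2 * (‖p - q‖ / μ q) ^ 2))⁻¹ •
    (p - q - inner ℝ (p - q) (K.tangent q) • K.tangent q)

/-- Up to a positive factor, the second derivative of `q ↦ ‖p - q‖² / μ(q)²` along `K` at the
critical point `q` of `p = exp^μ(q, w)`. -/
def hess (μ : K.carrier → ℝ) (x : K.carrier × EuclideanSpace ℝ (Fin n)) : ℝ :=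
  1 - μ x.1 * √(1 - K.slope μ x.1 ^ 2 * ‖x.2‖ ^ 2) * inner ℝ x.2 (K.curvVec x.1)
    - ‖x.2‖ ^ 2 * (μ x.1 * K.slope₂ μ x.1 + K.slope μ x.1 ^ 2)

variable {K} {μ : K.carrier → ℝ}

theorem expMap_eq (q : K.carrier) (w : EuclideanSpace ℝ (Fin n)) :
    K.expMap μ (q, w) = q - (μ q * ‖w‖ ^ 2 * K.slope μ q) • K.tangent q
      + (μ q * √(1 - K.slope μ q ^ 2 * ‖w‖ ^ 2)) • w := by
  simp only [expMap, norm_grad, sq_abs]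
  rw [grad_eq, smul_smul]

theorem expMap_sub (q : K.carrier) (w : EuclideanSpace ℝ (Fin n)) :
    K.expMap μ (q, w) - q = -(μ q * ‖w‖ ^ 2 * K.slope μ q) • K.tangent q
      + (μ q * √(1 - K.slope μ q ^ 2 * ‖w‖ ^ 2)) • w := by
  rw [expMap_eq]; module

theorem inner_expMap_sub_tangent {q : K.carrier} {w : EuclideanSpace ℝ (Fin n)}
    (hw : inner ℝ (K.tangent q) w = 0) :
    inner ℝ (K.expMap μ (q, w) - q) (K.tangent q) = -(μ q * ‖w‖ ^ 2 * K.slope μ q) := by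
  rw [expMap_sub, inner_add_left, inner_smul_left, inner_smul_left, inner_tangent_self,
    real_inner_comm, hw]
  simp

theorem inner_expMap_sub_curvVec (q : K.carrier) (w : EuclideanSpace ℝ (Fin n)) :
    inner ℝ (K.expMap μ (q, w) - q) (K.curvVec q) =
      μ q * √(1 - K.slope μ q ^ 2 * ‖w‖ ^ 2) * inner ℝ w (K.curvVec q) := by
  rw [expMap_sub, inner_add_left, inner_smul_left, inner_smul_left, inner_tangent_curvVec]
  simp

theorem slope_sq_mul_le {a b : ℝ} (hb : 0 ≤ b) (h : |a| * b ≤ 1) : a ^ 2 * b ^ 2 ≤ 1 := by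
  rw [← sq_abs a, ← mul_pow]
  exact pow_le_one₀ (by positivity) h

theorem slope_sq_mul_lt {a b : ℝ} (hb : 0 ≤ b) (h : |a| * b < 1) : a ^ 2 * b ^ 2 < 1 := by
  rw [← sq_abs a, ← mul_pow]
  exact pow_lt_one₀ (by positivity) h two_ne_zero

/-- The tangential and normal parts contribute μ²μ'²‖w‖⁴ and μ²(1 - μ'²‖w‖²)‖w‖². The square root in
exp^μ is there to make them add up to μ²‖w‖². -/
theorem norm_sq_expMap_sub {q : K.carrier} {w : EuclideanSpace ℝ (Fin n)}
    (hw : inner ℝ (K.tangent q) w = 0) (h : |K.slope μ q| * ‖w‖ ≤ 1) :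
    ‖K.expMap μ (q, w) - q‖ ^ 2 = (μ q * ‖w‖) ^ 2 := by
  have h1 := slope_sq_mul_le (norm_nonneg w) h
  rw [expMap_sub, norm_add_sq_real, norm_smul, norm_smul, norm_tangent, inner_smul_left,
    inner_smul_right, hw]
  simp only [mul_pow, Real.norm_eq_abs, sq_abs, abs_neg, abs_mul, abs_of_nonneg (Real.sqrt_nonneg _)]
  rw [Real.sq_sqrt (by linarith)]
  ring

theorem norm_expMap_sub {q : K.carrier} {w : EuclideanSpace ℝ (Fin n)} (hμ : 0 < μ q)
    (hw : inner ℝ (K.tangent q) w = 0) (h : |K.slope μ q| * ‖w‖ ≤ 1) :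
    ‖K.expMap μ (q, w) - q‖ = μ q * ‖w‖ :=
  (sq_eq_sq₀ (norm_nonneg _) (by positivity)).1 (norm_sq_expMap_sub hw h)

theorem crit_expMap {q : K.carrier} {w : EuclideanSpace ℝ (Fin n)}
    (hw : inner ℝ (K.tangent q) w = 0) (h : |K.slope μ q| * ‖w‖ ≤ 1) :
    K.crit μ (K.expMap μ (q, w)) q = 0 := by
  rw [crit, inner_expMap_sub_tangent hw, norm_sq_expMap_sub hw h]
  ring

theorem inner_tangent_logVec (p : EuclideanSpace ℝ (Fin n)) (q : K.carrier) :
    inner ℝ (K.tangent q) (K.logVec μ p q) = 0 := by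
  rw [logVec, inner_smul_right, inner_sub_right, inner_smul_right, inner_tangent_self,
    real_inner_comm]
  ring

theorem logVec_expMap {q : K.carrier} {w : EuclideanSpace ℝ (Fin n)} (hμ : 0 < μ q)
    (hw : inner ℝ (K.tangent q) w = 0) (h : |K.slope μ q| * ‖w‖ < 1) :
    K.logVec μ (K.expMap μ (q, w)) q = w := by
  have h1 := slope_sq_mul_lt (norm_nonneg w) h
  have h2 : 0 < √(1 - K.slope μ q ^ 2 * ‖w‖ ^ 2) := Real.sqrt_pos.2 (by linarith)
  rw [logVec, norm_expMap_sub hμ hw h.le, inner_expMap_sub_tangent hw, expMap_sub,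
    mul_div_cancel_left₀ _ hμ.ne', add_sub_cancel_left, smul_smul, inv_mul_cancel₀ (by positivity),
    one_smul]

theorem norm_logVec {p : EuclideanSpace ℝ (Fin n)} {q : K.carrier} (hμ : 0 < μ q)
    (hc : K.crit μ p q = 0) (h : |K.slope μ q| * (‖p - q‖ / μ q) < 1) :
    ‖K.logVec μ p q‖ = ‖p - q‖ / μ q := by
  have h1 := slope_sq_mul_lt (by positivity) h
  have h2 : 0 < √(1 - K.slope μ q ^ 2 * (‖p - q‖ / μ q) ^ 2) := Real.sqrt_pos.2 (by linarith)
  have hT : inner ℝ (p - q) (K.tangent q) = -(‖p - q‖ ^ 2 * K.slope μ q) / μ q := by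
    rw [eq_div_iff hμ.ne']; unfold crit at hc; linarith
  refine (sq_eq_sq₀ (norm_nonneg _) (by positivity)).1 ?_
  rw [logVec, norm_smul, mul_pow, norm_sub_sq_real, inner_smul_right, norm_smul, norm_tangent, hT]
  simp only [Real.norm_eq_abs, mul_one, sq_abs, inv_pow, mul_pow]
  rw [Real.sq_sqrt (by linarith)]
  have h3 : 1 - K.slope μ q ^ 2 * (‖p - q‖ / μ q) ^ 2 ≠ 0 := by linarith
  rw [inv_mul_eq_iff_eq_mul₀ (by positivity)]
  field_simp
  ring

/-- Together with `logVec_expMap` this matches normal vectors over p with critical points of the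
weighted distance from p. The strict bound keeps the square root away from zero. -/
theorem expMap_logVec {p : EuclideanSpace ℝ (Fin n)} {q : K.carrier} (hμ : 0 < μ q)
    (hc : K.crit μ p q = 0) (h : |K.slope μ q| * (‖p - q‖ / μ q) < 1) :
    K.expMap μ (q, K.logVec μ p q) = p := by
  have h1 := slope_sq_mul_lt (by positivity) h
  have h2 : 0 < √(1 - K.slope μ q ^ 2 * (‖p - q‖ / μ q) ^ 2) := Real.sqrt_pos.2 (by linarith)
  have hT : μ q * (‖p - q‖ / μ q) ^ 2 * K.slope μ q = - inner ℝ (p - q) (K.tangent q) := by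
    unfold crit at hc
    field_simp
    linarith
  rw [expMap_eq, norm_logVec hμ hc h, hT, logVec, smul_smul, mul_inv_cancel₀ (by positivity)]
  module

theorem expMap_smul_sub (q : K.carrier) (w : EuclideanSpace ℝ (Fin n)) (τ : ℝ) :
    K.expMap μ (q, τ • w) = q - (μ q * (τ ^ 2 * ‖w‖ ^ 2) * K.slope μ q) • K.tangent q
      + (μ q * √(1 - K.slope μ q ^ 2 * (τ ^ 2 * ‖w‖ ^ 2)) * τ) • w := by
  rw [expMap_eq, norm_smul, mul_pow, Real.norm_eq_abs, sq_abs, smul_smul]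

theorem continuous_expMap (h : K.IsWeight 2 μ) : Continuous (K.expMap μ) := by
  have h1 := h.continuous
  have h2 := h.continuous_slope
  have h3 := K.continuous_tangent
  have : K.expMap μ = fun x => (x.1 : EuclideanSpace ℝ (Fin n)) -
      (μ x.1 * ‖x.2‖ ^ 2 * K.slope μ x.1) • K.tangent x.1
      + (μ x.1 * √(1 - K.slope μ x.1 ^ 2 * ‖x.2‖ ^ 2)) • x.2 :=
    funext fun x => expMap_eq x.1 x.2
  rw [this]
  fun_prop

theorem continuous_hess (h : K.IsWeight 2 μ) : Continuous (K.hess μ) := by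
  have h1 := h.continuous
  have h2 := h.continuous_slope
  have h3 := h.continuous_slope₂
  have h4 := K.continuous_curvVec
  unfold hess
  fun_prop

theorem continuous_crit (h : K.IsWeight 2 μ) :
    Continuous fun x : EuclideanSpace ℝ (Fin n) × K.carrier => K.crit μ x.1 x.2 := by
  have h1 := h.continuous
  have h2 := h.continuous_slope
  have h3 := K.continuous_tangent
  unfold crit
  fun_prop

theorem mem_normalBundle {q : K.carrier} {w : EuclideanSpace ℝ (Fin n)} :
    (q, w) ∈ K.normalBundle ↔ inner ℝ (K.tangent q) w = 0 := Iff.rfl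

theorem mem_normalDisc {r : ℝ} {q : K.carrier} {w : EuclideanSpace ℝ (Fin n)} :
    (q, w) ∈ K.normalDisc r ↔ inner ℝ (K.tangent q) w = 0 ∧ ‖w‖ < r := Iff.rfl

theorem mem_expDomain {q : K.carrier} {w : EuclideanSpace ℝ (Fin n)} :
    (q, w) ∈ K.expDomain μ ↔ inner ℝ (K.tangent q) w = 0 ∧ |K.slope μ q| * ‖w‖ ≤ 1 := by
  refine and_congr Iff.rfl ?_
  rw [norm_grad]
  constructor
  · intro h
    by_cases h0 : |K.slope μ q| = 0
    · rw [h0]; simp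
    · have := h h0
      rw [le_div_iff₀ (lt_of_le_of_ne (abs_nonneg _) (Ne.symm h0))] at this
      linarith
  · intro h h0
    rw [le_div_iff₀ (lt_of_le_of_ne (abs_nonneg _) (Ne.symm h0))]
    linarith

theorem isClosed_expDomain (h : K.IsWeight 2 μ) : IsClosed (K.expDomain μ) := by
  have h2 := h.continuous_slope
  have h3 := K.continuous_tangent
  have : K.expDomain μ = {x | inner ℝ (K.tangent x.1) x.2 = 0} ∩
      {x | |K.slope μ x.1| * ‖x.2‖ ≤ 1} := by
    ext ⟨q, w⟩
    exact mem_expDomain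
  rw [this]
  exact (isClosed_eq (by fun_prop) continuous_const).inter
    (isClosed_le (by fun_prop) continuous_const)

/-- Each normal space contains vectors of every length below r; letting the length tend to r gives
the nonstrict bound. -/
theorem slope_mul_le_of_subset {r : ℝ} (hr : 0 < r) (hs : K.normalDisc r ⊆ K.expDomain μ)
    (q : K.carrier) : |K.slope μ q| * r ≤ 1 := by
  obtain ⟨u, hu, hq⟩ := K.exists_unit_normal q
  have key : ∀ t ∈ Set.Ioo 0 r, |K.slope μ q| * t ≤ 1 := by
    intro t ht
    have hnorm : ‖t • u‖ = t := by rw [norm_smul, hu, mul_one, Real.norm_of_nonneg ht.1.le]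
    have : (q, t • u) ∈ K.normalDisc r := by
      rw [mem_normalDisc, inner_smul_right, hq, mul_zero, hnorm]
      exact ⟨rfl, ht.2⟩
    simpa [hnorm] using (mem_expDomain.1 (hs this)).2
  have hlim : Tendsto (fun t => |K.slope μ q| * t) (𝓝[<] r) (𝓝 (|K.slope μ q| * r)) :=
    ((continuous_const.mul continuous_id).tendsto r).mono_left nhdsWithin_le_nhds
  refine le_of_tendsto hlim ?_
  filter_upwards [Ioo_mem_nhdsLT hr] with t ht using key t ht

theorem slope_mul_lt {r : ℝ} {q : K.carrier} {t : ℝ} (h : |K.slope μ q| * r ≤ 1)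
    (ht : t < r) : |K.slope μ q| * t < 1 := by
  rcases (abs_nonneg (K.slope μ q)).eq_or_lt with h0 | h0
  · rw [← h0]; simp
  · exact (mul_lt_mul_of_pos_left ht h0).trans_le h

theorem normalDisc_subset_expDomain {r : ℝ} (h : ∀ q, |K.slope μ q| * r ≤ 1) :
    K.normalDisc r ⊆ K.expDomain μ := fun x hx =>
  mem_expDomain.2 ⟨hx.1, (slope_mul_lt (h x.1) hx.2).le⟩

/-- A critical point of `p` with small value yields a preimage of `p` under `exp^μ`. -/
theorem logVec_mem_normalDisc {r : ℝ} {p : EuclideanSpace ℝ (Fin n)} {q : K.carrier}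
    (hμ : 0 < μ q) (h : |K.slope μ q| * r ≤ 1) (hc : K.crit μ p q = 0)
    (hr : ‖p - q‖ < r * μ q) :
    (q, K.logVec μ p q) ∈ K.normalDisc r ∧ K.expMap μ (q, K.logVec μ p q) = p := by
  have h1 : ‖p - q‖ / μ q < r := (div_lt_iff₀ hμ).2 hr
  have h2 := slope_mul_lt h h1
  exact ⟨mem_normalDisc.2 ⟨inner_tangent_logVec _ _, by rwa [norm_logVec hμ hc h2]⟩,
    expMap_logVec hμ hc h2⟩

/-! ### Derivatives along the curve -/

theorem crit_point (p : EuclideanSpace ℝ (Fin n)) (i : Fin K.m) (s : ℝ) :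
    K.crit μ p (K.point i s) = inner ℝ (p - K.γ i s) (deriv (K.γ i) s) * μ (K.point i s)
      + ‖p - K.γ i s‖ ^ 2 * deriv (fun t => μ (K.point i t)) s := by
  rw [crit, tangent_point, slope_point, coe_point]

theorem contDiff_crit (h : K.IsWeight 2 μ) (i : Fin K.m) :
    ContDiff ℝ 1 fun x : EuclideanSpace ℝ (Fin n) × ℝ => K.crit μ x.1 (K.point i x.2) := by
  simp only [crit_point]
  have h1 : ContDiff ℝ 1 (K.γ i) := (K.contDiff i).of_le (by norm_num)
  have h2 : ContDiff ℝ 1 (deriv (K.γ i)) := (K.contDiff_deriv_γ i).of_le (by norm_num)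
  have h3 : ContDiff ℝ 1 fun s => μ (K.point i s) := (h.2 i).of_le (by norm_num)
  have h4 := h.contDiff_deriv i
  have e1 : ContDiff ℝ 1 fun x : EuclideanSpace ℝ (Fin n) × ℝ => x.1 - K.γ i x.2 :=
    contDiff_fst.sub (h1.comp contDiff_snd)
  exact ((e1.inner ℝ (h2.comp contDiff_snd)).mul (h3.comp contDiff_snd)).add
    ((e1.norm_sq ℝ).mul (h4.comp contDiff_snd))

theorem hasDerivAt_crit (h : K.IsWeight 2 μ) (p : EuclideanSpace ℝ (Fin n)) (i : Fin K.m) (s : ℝ) :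
    HasDerivAt (fun s => K.crit μ p (K.point i s))
      ((inner ℝ (p - K.point i s) (K.curvVec (K.point i s)) - 1) * μ (K.point i s)
        - inner ℝ (p - K.point i s) (K.tangent (K.point i s)) * K.slope μ (K.point i s)
        + ‖p - K.point i s‖ ^ 2 * K.slope₂ μ (K.point i s)) s := by
  simp only [crit_point, curvVec_point, tangent_point, slope_point, slope₂_point, coe_point]
  have h1 := (K.hasDerivAt_γ i s).const_sub p
  have h2 := ((h1.inner ℝ (K.hasDerivAt_deriv_γ i s)).mul (h.hasDerivAt i s)).add
    (h1.norm_sq.mul (h.hasDerivAt_deriv i s))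
  refine h2.congr_deriv ?_
  rw [inner_neg_left, real_inner_self_eq_norm_sq, K.unit_speed, inner_neg_right]
  ring

/-- This is where `hess` comes from: inserting the components of exp^μ(q, w) - q into the derivative
of `crit` leaves -μ times it. -/
theorem hasDerivAt_crit_expMap (h : K.IsWeight 2 μ) {i : Fin K.m} {s : ℝ}
    {w : EuclideanSpace ℝ (Fin n)} (hw : inner ℝ (K.tangent (K.point i s)) w = 0)
    (hs : |K.slope μ (K.point i s)| * ‖w‖ ≤ 1) :
    HasDerivAt (fun t => K.crit μ (K.expMap μ (K.point i s, w)) (K.point i t))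
      (-(μ (K.point i s) * K.hess μ (K.point i s, w))) s := by
  refine (hasDerivAt_crit h _ i s).congr_deriv ?_
  rw [inner_expMap_sub_curvVec, inner_expMap_sub_tangent hw, norm_sq_expMap_sub hw hs, hess]
  ring

/-- The weighted squared distance. -/
def wdist (μ : K.carrier → ℝ) (p : EuclideanSpace ℝ (Fin n)) (q : K.carrier) : ℝ :=
  ‖p - q‖ ^ 2 / μ q ^ 2

theorem hasDerivAt_wdist (h : K.IsWeight 2 μ) (p : EuclideanSpace ℝ (Fin n)) (i : Fin K.m) (s : ℝ) :
    HasDerivAt (fun s => wdist μ p (K.point i s))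
      (-2 * K.crit μ p (K.point i s) / μ (K.point i s) ^ 3) s := by
  have h1 := ((K.hasDerivAt_γ i s).const_sub p).norm_sq
  have h0 := (h.1 (K.point i s)).ne'
  refine (h1.div ((h.hasDerivAt i s).fun_pow 2) (by positivity)).congr_deriv ?_
  rw [crit_point, inner_neg_right]
  field_simp
  push_cast
  ring

theorem wdist_le_iff {p p' : EuclideanSpace ℝ (Fin n)} {q q' : K.carrier} (hq : 0 < μ q)
    (hq' : 0 < μ q') : wdist μ p q ≤ wdist μ p' q' ↔ ‖p - q‖ / μ q ≤ ‖p' - q'‖ / μ q' := by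
  rw [wdist, wdist, ← div_pow, ← div_pow]
  exact pow_le_pow_iff_left₀ (by positivity) (by positivity) two_ne_zero

theorem continuous_wdist (h : K.IsWeight 2 μ) :
    Continuous fun x : EuclideanSpace ℝ (Fin n) × K.carrier => wdist μ x.1 x.2 := by
  have h1 := h.continuous
  unfold wdist
  exact Continuous.div₀ (by fun_prop) (by fun_prop) fun x => (pow_pos (h.1 x.2) 2).ne'

theorem exists_forall_wdist_le (h : K.IsWeight 2 μ) (p : EuclideanSpace ℝ (Fin n)) :
    ∃ q, ∀ q', wdist μ p q ≤ wdist μ p q' := by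
  obtain ⟨q, -, hq⟩ := isCompact_univ.exists_isMinOn Set.univ_nonempty
    ((continuous_wdist h).comp (Continuous.prodMk_right p)).continuousOn
  exact ⟨q, fun q' => hq (Set.mem_univ q')⟩

theorem crit_eq_zero_of_forall_le (h : K.IsWeight 2 μ) {p : EuclideanSpace ℝ (Fin n)} {q : K.carrier}
    (hq : ∀ q', wdist μ p q ≤ wdist μ p q') : K.crit μ p q = 0 := by
  obtain ⟨i, s, rfl⟩ := K.exists_point q
  have hmin : IsLocalMin (fun s => wdist μ p (K.point i s)) s :=
    Eventually.of_forall fun t => hq _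
  have := hmin.hasDerivAt_eq_zero (hasDerivAt_wdist h p i s)
  have h0 := (h.1 (K.point i s)).ne'
  field_simp at this
  linarith

/-- If `hess` were negative, a global minimum would also be a local maximum. The function would then
be locally constant, with vanishing second derivative. -/
theorem hess_nonneg_of_forall_le (h : K.IsWeight 2 μ) {q : K.carrier}
    {w : EuclideanSpace ℝ (Fin n)} (hw : inner ℝ (K.tangent q) w = 0)
    (hs : |K.slope μ q| * ‖w‖ ≤ 1)
    (hq : ∀ q', wdist μ (K.expMap μ (q, w)) q ≤ wdist μ (K.expMap μ (q, w)) q') :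
    0 ≤ K.hess μ (q, w) := by
  obtain ⟨i, s, rfl⟩ := K.exists_point q
  by_contra! hneg
  set p := K.expMap μ (K.point i s, w)
  have hμ := h.1 (K.point i s)
  have hd : deriv (fun s => wdist μ p (K.point i s)) =
      fun s => -2 * K.crit μ p (K.point i s) / μ (K.point i s) ^ 3 :=
    funext fun t => (hasDerivAt_wdist h p i t).deriv
  have hc : K.crit μ p (K.point i s) = 0 := crit_expMap hw hs
  have hd2 : HasDerivAt (deriv (fun s => wdist μ p (K.point i s)))
      (2 * K.hess μ (K.point i s, w) / μ (K.point i s) ^ 2) s := by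
    rw [hd]
    refine (((hasDerivAt_crit_expMap h hw hs).const_mul (-2)).div
      ((h.hasDerivAt i s).fun_pow 3) (by positivity)).congr_deriv ?_
    rw [show K.crit μ (K.expMap μ (K.point i s, w)) (K.point i s) = 0 from hc]
    field_simp
    ring
  have hmax : IsLocalMax (fun s => wdist μ p (K.point i s)) s := by
    refine isLocalMax_of_deriv_deriv_neg ?_ ?_
      (hasDerivAt_wdist h p i s).continuousAt
    · rw [hd2.deriv]
      exact div_neg_of_neg_of_pos (by linarith) (by positivity)
    · rw [hd]; simp [hc]
  have hconst : (fun s => wdist μ p (K.point i s)) =ᶠ[𝓝 s] fun _ => wdist μ p (K.point i s) := by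
    filter_upwards [hmax] with t ht using le_antisymm ht (hq _)
  have h0 : deriv (fun s => wdist μ p (K.point i s)) =ᶠ[𝓝 s] fun _ => 0 := by
    simpa using hconst.deriv
  have := hd2.unique (h0.hasDerivAt_iff.2 (hasDerivAt_const s (0 : ℝ)))
  rw [div_eq_zero_iff] at this
  rcases this with h1 | h1
  · linarith
  · exact absurd h1 (by positivity)

end ClosedCurves

end

noncomputable section

/-- Implicit function theorem for one scalar equation in one scalar unknown. -/
theorem exists_implicit_of_hasDerivAt {E : Type*} [NormedAddCommGroup E] [NormedSpace ℝ E]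
    [CompleteSpace E] {f : E × ℝ → ℝ} (hf : ContDiff ℝ 1 f) {p : E} {s d : ℝ} (h0 : f (p, s) = 0)
    (hd : HasDerivAt (fun t => f (p, t)) d s) (hd0 : d ≠ 0) :
    ∃ S : E → ℝ, ContDiffAt ℝ 1 S p ∧ S p = s ∧ (∀ᶠ x in 𝓝 p, f (x, S x) = 0) ∧
      ∀ᶠ v in 𝓝 (p, s), f v = 0 → S v.1 = v.2 := by
  have cdf : ContDiffAt ℝ 1 f (p, s) := hf.contDiffAt
  have hinv : (fderiv ℝ f (p, s) ∘L .inr ℝ E ℝ).IsInvertible := by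
    refine ⟨ContinuousLinearEquiv.unitsEquivAut ℝ (Units.mk0 d hd0), ?_⟩
    have h1 : HasFDerivAt (fun t => f (p, t)) (fderiv ℝ f (p, s) ∘L .inr ℝ E ℝ) s :=
      (hf.differentiable one_ne_zero (p, s)).hasFDerivAt.comp s (hasFDerivAt_prodMk_right p s)
    have h2 := h1.hasDerivAt.unique hd
    ext
    simpa using h2.symm
  refine ⟨cdf.implicitFunction one_ne_zero hinv, cdf.contDiffAt_implicitFunction one_ne_zero hinv,
    cdf.implicitFunction_apply_self one_ne_zero hinv, ?_, ?_⟩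
  · filter_upwards [cdf.eventually_apply_implicitFunction one_ne_zero hinv] with x hx
    rw [hx, h0]
  · filter_upwards [cdf.eventually_apply_eq_iff_implicitFunction one_ne_zero hinv] with v hv hv0
    exact hv.1 (by rw [hv0, h0])

/-! ### Local sections of exp^μ at nondegenerate vectors. -/

namespace ClosedCurves

variable {n : ℕ} {K : ClosedCurves n} {μ : K.carrier → ℝ}

/-- The parameter derivative of `crit` is a nonzero multiple of `hess`, so the scalar implicit
function theorem applies. The third clause is persistence of the critical point, the last one its
local uniqueness. -/
theorem exists_critical_section (h : K.IsWeight 2 μ) {i : Fin K.m} {s : ℝ}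
    {w : EuclideanSpace ℝ (Fin n)} (hw : inner ℝ (K.tangent (K.point i s)) w = 0)
    (hs : |K.slope μ (K.point i s)| * ‖w‖ ≤ 1) (hH : K.hess μ (K.point i s, w) ≠ 0) :
    ∃ S : EuclideanSpace ℝ (Fin n) → ℝ,
      ContDiffAt ℝ 1 S (K.expMap μ (K.point i s, w)) ∧ S (K.expMap μ (K.point i s, w)) = s ∧
      (∀ᶠ x in 𝓝 (K.expMap μ (K.point i s, w)), K.crit μ x (K.point i (S x)) = 0) ∧
      ∀ᶠ v in 𝓝 (K.expMap μ (K.point i s, w), s), K.crit μ v.1 (K.point i v.2) = 0 → S v.1 = v.2 :=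
  exists_implicit_of_hasDerivAt (contDiff_crit h i) (crit_expMap hw hs)
    (hasDerivAt_crit_expMap h hw hs)
    (neg_ne_zero.2 (mul_ne_zero (h.1 _).ne' hH))

theorem hess_zero (q : K.carrier) : K.hess μ (q, 0) = 1 := by simp [hess]

theorem expMap_zero (q : K.carrier) : K.expMap μ (q, 0) = q := by simp [expMap_eq]

variable (K) in
/-- The parameter extends locally to a `C¹` function on the ambient space. -/
theorem exists_local_parameter (i : Fin K.m) (s : ℝ) :
    ∃ S : EuclideanSpace ℝ (Fin n) → ℝ, ContDiffAt ℝ 1 S (K.γ i s) ∧ S (K.γ i s) = s ∧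
      ∀ᶠ q : K.carrier in 𝓝 (K.point i s), K.point i (S q) = q := by
  -- For the constant weight 1 and w = 0, `hess` equals 1. The critical section is then the
  -- parameter of a nearby critical foot point, and on K it returns the point itself.
  have h : K.IsWeight 2 fun _ => (1 : ℝ) := ⟨fun _ => one_pos, fun _ => contDiff_const⟩
  obtain ⟨S, h1, h2, -, h4⟩ := exists_critical_section h (i := i) (s := s) (w := 0)
    (by simp) (by simp) (by simp [hess_zero])
  rw [expMap_zero] at h1 h2 h4
  refine ⟨S, h1, h2, ?_⟩
  rw [← K.map_nhds_point, eventually_map]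
  have hc : Tendsto (fun t => (K.γ i t, t)) (𝓝 s) (𝓝 (K.γ i s, s)) :=
    ((K.contDiff i).continuous.prodMk continuous_id).tendsto s
  filter_upwards [hc.eventually h4] with t ht
  have hS : S (K.γ i t) = t := ht (by simp [crit, coe_point])
  rw [coe_point, hS]

theorem logVec_point (p : EuclideanSpace ℝ (Fin n)) (i : Fin K.m) (s : ℝ) :
    K.logVec μ p (K.point i s) = (μ (K.point i s) * √(1 - deriv (fun t => μ (K.point i t)) s ^ 2 *
      (‖p - K.γ i s‖ ^ 2 / μ (K.point i s) ^ 2)))⁻¹ •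
      (p - K.γ i s - inner ℝ (p - K.γ i s) (deriv (K.γ i) s) • deriv (K.γ i) s) := by
  rw [logVec, tangent_point, slope_point, coe_point, div_pow]

theorem contDiffAt_logVec (h : K.IsWeight 2 μ) {p : EuclideanSpace ℝ (Fin n)} {i : Fin K.m} {s : ℝ}
    (hs : |K.slope μ (K.point i s)| * (‖p - K.point i s‖ / μ (K.point i s)) < 1) :
    ContDiffAt ℝ 1 (fun x : EuclideanSpace ℝ (Fin n) × ℝ => K.logVec μ x.1 (K.point i x.2))
      (p, s) := by
  simp only [logVec_point]
  have hμ := h.1 (K.point i s)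
  have hpos := slope_sq_mul_lt (by positivity) hs
  rw [slope_point, div_pow, coe_point] at hpos
  have h1 : ContDiff ℝ 1 (K.γ i) := (K.contDiff i).of_le (by norm_num)
  have h2 : ContDiff ℝ 1 fun x : EuclideanSpace ℝ (Fin n) × ℝ => deriv (K.γ i) x.2 :=
    ((K.contDiff_deriv_γ i).of_le (by norm_num)).comp contDiff_snd
  have h3 : ContDiff ℝ 1 fun x : EuclideanSpace ℝ (Fin n) × ℝ => μ (K.point i x.2) :=
    ((h.2 i).of_le (by norm_num)).comp contDiff_snd
  have h4 : ContDiff ℝ 1 fun x : EuclideanSpace ℝ (Fin n) × ℝ =>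
      deriv (fun t => μ (K.point i t)) x.2 := (h.contDiff_deriv i).comp contDiff_snd
  have e1 : ContDiff ℝ 1 fun x : EuclideanSpace ℝ (Fin n) × ℝ => x.1 - K.γ i x.2 :=
    contDiff_fst.sub (h1.comp contDiff_snd)
  have e2 : ContDiffAt ℝ 1 (fun x : EuclideanSpace ℝ (Fin n) × ℝ =>
      1 - deriv (fun t => μ (K.point i t)) x.2 ^ 2 *
        (‖x.1 - K.γ i x.2‖ ^ 2 / μ (K.point i x.2) ^ 2)) (p, s) :=
    contDiffAt_const.sub ((h4.pow 2).contDiffAt.mul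
      ((e1.norm_sq ℝ).contDiffAt.div (h3.pow 2).contDiffAt (by simp [hμ.ne'])))
  have e3 := e2.sqrt (by simp only; linarith)
  refine ((h3.contDiffAt.mul e3).inv ?_).smul
    (e1.sub ((e1.inner ℝ h2).smul h2)).contDiffAt
  exact (mul_pos hμ (Real.sqrt_pos.2 (by simp only; linarith))).ne'

/-- Near the image of a nondegenerate normal vector, `exp^μ` has a `C¹` right inverse. -/
theorem exists_section (h : K.IsWeight 2 μ) {r : ℝ} (hr : ∀ q, |K.slope μ q| * r ≤ 1)
    {i : Fin K.m} {s : ℝ} {w : EuclideanSpace ℝ (Fin n)} (hx : (K.point i s, w) ∈ K.normalDisc r)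
    (hH : K.hess μ (K.point i s, w) ≠ 0) :
    ∃ S : EuclideanSpace ℝ (Fin n) → ℝ,
      ContDiffAt ℝ 1 S (K.expMap μ (K.point i s, w)) ∧ S (K.expMap μ (K.point i s, w)) = s ∧
      ContDiffAt ℝ 1 (fun x => K.logVec μ x (K.point i (S x))) (K.expMap μ (K.point i s, w)) ∧
      K.logVec μ (K.expMap μ (K.point i s, w)) (K.point i s) = w ∧
      ∀ᶠ x in 𝓝 (K.expMap μ (K.point i s, w)), K.crit μ x (K.point i (S x)) = 0 ∧
        ‖x - K.point i (S x)‖ < r * μ (K.point i (S x)) ∧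
        (K.point i (S x), K.logVec μ x (K.point i (S x))) ∈ K.normalDisc r ∧
        K.expMap μ (K.point i (S x), K.logVec μ x (K.point i (S x))) = x := by
  have hμ := h.1 (K.point i s)
  have hlt := slope_mul_lt (hr (K.point i s)) hx.2
  have hnorm := norm_expMap_sub hμ hx.1 hlt.le
  obtain ⟨S, h1, h2, h3, -⟩ := exists_critical_section h hx.1 hlt.le hH
  set p := K.expMap μ (K.point i s, w) with hp
  refine ⟨S, h1, h2, ?_, logVec_expMap hμ hx.1 hlt, ?_⟩
  · have hlog : ContDiffAt ℝ 1
        (fun x : EuclideanSpace ℝ (Fin n) × ℝ => K.logVec μ x.1 (K.point i x.2)) (p, S p) := by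
      rw [h2]
      refine contDiffAt_logVec h ?_
      rw [hnorm, mul_div_cancel_left₀ _ hμ.ne']
      exact hlt
    exact ContDiffAt.comp (f := fun x => (x, S x))
      (g := fun x : EuclideanSpace ℝ (Fin n) × ℝ => K.logVec μ x.1 (K.point i x.2)) p hlog
      (contDiffAt_id.prodMk h1)
  · have hc : ContinuousAt (fun x => K.point i (S x)) p :=
      (K.continuous_point i).continuousAt.comp h1.continuousAt
    have hev : ∀ᶠ x in 𝓝 p, ‖x - K.point i (S x)‖ < r * μ (K.point i (S x)) := by
      have c1 : ContinuousAt (fun x => ‖x - K.point i (S x)‖) p :=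
        (continuousAt_id.sub (continuous_subtype_val.continuousAt.comp hc)).norm
      have c2 : ContinuousAt (fun x => r * μ (K.point i (S x))) p :=
        continuousAt_const.mul (h.continuous.continuousAt.comp hc)
      refine c1.eventually_lt c2 ?_
      rw [h2, hnorm, mul_comm]
      exact mul_lt_mul_of_pos_right hx.2 hμ
    filter_upwards [h3, hev] with x hx1 hx2
    exact ⟨hx1, hx2, logVec_mem_normalDisc (h.1 _) (hr _) hx1 hx2⟩

/-- `exp^μ` is open at nondegenerate normal vectors. -/
theorem image_expMap_mem_nhds (h : K.IsWeight 2 μ) {r : ℝ} (hr : ∀ q, |K.slope μ q| * r ≤ 1)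
    {x : K.carrier × EuclideanSpace ℝ (Fin n)} (hx : x ∈ K.normalDisc r) (hH : K.hess μ x ≠ 0)
    {O : Set (K.carrier × EuclideanSpace ℝ (Fin n))} (hO : O ∈ 𝓝 x) :
    K.expMap μ '' (O ∩ K.normalDisc r) ∈ 𝓝 (K.expMap μ x) := by
  obtain ⟨q, w⟩ := x
  obtain ⟨i, s, rfl⟩ := K.exists_point q
  obtain ⟨S, h1, h2, h3, h4, h5⟩ := exists_section h hr hx hH
  set p := K.expMap μ (K.point i s, w) with hp
  have hc : ContinuousAt (fun x => (K.point i (S x), K.logVec μ x (K.point i (S x)))) p :=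
    ((K.continuous_point i).continuousAt.comp h1.continuousAt).prodMk h3.continuousAt
  have hO' : O ∈ 𝓝 (K.point i (S p), K.logVec μ p (K.point i (S p))) := by
    rw [h2, h4]; exact hO
  filter_upwards [hc hO', h5] with x hx hx'
  exact ⟨_, ⟨hx, hx'.2.2.1⟩, hx'.2.2.2⟩

/-- Envelope formula: the derivative of the critical value with respect to the base point. -/
theorem hasFDerivAt_wdist_section (h : K.IsWeight 2 μ) {p : EuclideanSpace ℝ (Fin n)} {i : Fin K.m}
    {S : EuclideanSpace ℝ (Fin n) → ℝ} (hS : ContDiffAt ℝ 1 S p)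
    (hc : K.crit μ p (K.point i (S p)) = 0) :
    HasFDerivAt (fun x => wdist μ x (K.point i (S x)))
      ((2 / μ (K.point i (S p)) ^ 2) • innerSL ℝ (p - K.point i (S p))) p := by
  have hμ := h.1 (K.point i (S p))
  have hS' := (hS.differentiableAt one_ne_zero).hasFDerivAt
  have hγ := (K.hasDerivAt_γ i (S p)).hasFDerivAt.comp p hS'
  have hm := (h.hasDerivAt i (S p)).comp_hasFDerivAt p hS'
  have h1 := ((hasFDerivAt_id p).sub hγ).norm_sq
  have h2 := h1.mul ((hasDerivAt_inv (pow_ne_zero 2 hμ.ne')).comp_hasFDerivAt p (hm.pow 2))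
  simp only [crit_point] at hc
  refine HasFDerivAt.congr_fderiv (f := fun x => wdist μ x (K.point i (S x))) h2 ?_
  ext v
  simp only [coe_point, Function.comp_apply, Pi.sub_apply, id_eq, add_apply, smul_apply,
    ContinuousLinearMap.comp_apply, sub_apply, innerSL_apply_apply, smul_eq_mul,
    ContinuousLinearMap.id_apply, inner_sub_right, nsmul_eq_mul,
    ContinuousLinearMap.toSpanSingleton_apply, inner_smul_right, Nat.cast_ofNat]
  field_simp
  -- The terms containing the derivative of S add up to a multiple of `crit`, which vanishes at p.
  linear_combination (-(fderiv ℝ S p v * μ (K.point i (S p)))) * hc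

/-! ### Density of nondegenerate normal vectors -/

/-- Squaring removes the root. The resulting polynomial takes the value 1 at t = 0, so it has
finitely many zeros. -/
theorem finite_setOf_sqrt_eq (A b c : ℝ) :
    {t : ℝ | b * t ^ 2 ≤ 1 ∧ 1 - c * √(1 - b * t ^ 2) * t - A * t ^ 2 = 0}.Finite := by
  set P : Polynomial ℝ := (1 - Polynomial.C A * Polynomial.X ^ 2) ^ 2 -
    Polynomial.C (c ^ 2) * Polynomial.X ^ 2 * (1 - Polynomial.C b * Polynomial.X ^ 2) with hP
  have hP0 : P ≠ 0 := by
    intro h0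
    have : P.eval 0 = 0 := by rw [h0]; simp
    simp [hP] at this
  refine (Polynomial.finite_setOfPred_isRoot hP0).subset ?_
  rintro t ⟨h1, h2⟩
  have h3 : (1 - A * t ^ 2) ^ 2 = (c * √(1 - b * t ^ 2) * t) ^ 2 := by
    congr 1; linarith
  rw [mul_pow, mul_pow, Real.sq_sqrt (by linarith)] at h3
  simp only [Set.mem_ofPred_eq, Polynomial.IsRoot, hP]
  simp
  linarith

theorem eventually_hess_smul_ne_zero (q : K.carrier) {w : EuclideanSpace ℝ (Fin n)}
    (hs : |K.slope μ q| * ‖w‖ < 1) : ∀ᶠ τ : ℝ in 𝓝[≠] 1, K.hess μ (q, τ • w) ≠ 0 := by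
  have hpos := slope_sq_mul_lt (norm_nonneg w) hs
  have hfin := finite_setOf_sqrt_eq (‖w‖ ^ 2 * (μ q * K.slope₂ μ q + K.slope μ q ^ 2))
    (K.slope μ q ^ 2 * ‖w‖ ^ 2) (μ q * inner ℝ w (K.curvVec q))
  have hc : Tendsto (fun τ : ℝ => K.slope μ q ^ 2 * ‖w‖ ^ 2 * τ ^ 2) (𝓝[≠] 1)
      (𝓝 (K.slope μ q ^ 2 * ‖w‖ ^ 2 * 1 ^ 2)) :=
    (Continuous.tendsto (by fun_prop) 1).mono_left nhdsWithin_le_nhds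
  filter_upwards [nhdsNE_le_cofinite 1 hfin.compl_mem_cofinite,
    hc.eventually_lt_const (u := 1) (by linarith)] with τ h1 h2 h3
  refine h1 ⟨h2.le, ?_⟩
  rw [← h3, hess, norm_smul, inner_smul_left, mul_pow]
  simp only [Real.norm_eq_abs, sq_abs, RCLike.conj_to_real]
  ring_nf

/-! ### Double critical pairs -/

theorem hasFDerivAt_pairDist (h : K.IsWeight 2 μ) (i j : Fin K.m) (s t : ℝ) :
    HasFDerivAt (fun p : ℝ × ℝ =>
        ‖K.γ i p.1 - K.γ j p.2‖ ^ 2 / (μ (K.point i p.1) + μ (K.point j p.2)) ^ 2)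
      ((2 / (μ (K.point i s) + μ (K.point j t)) ^ 3) •
        ((inner ℝ (K.γ i s - K.γ j t) (K.tangent (K.point i s)) * (μ (K.point i s) + μ (K.point j t))
            - ‖K.γ i s - K.γ j t‖ ^ 2 * K.slope μ (K.point i s)) • ContinuousLinearMap.fst ℝ ℝ ℝ
          - (inner ℝ (K.γ i s - K.γ j t) (K.tangent (K.point j t)) *
              (μ (K.point i s) + μ (K.point j t))
            + ‖K.γ i s - K.γ j t‖ ^ 2 * K.slope μ (K.point j t)) • ContinuousLinearMap.snd ℝ ℝ ℝ))
      (s, t) := by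
  have hμ : 0 < μ (K.point i s) + μ (K.point j t) := add_pos (h.1 _) (h.1 _)
  have f1 : HasFDerivAt (Prod.fst : ℝ × ℝ → ℝ) _ (s, t) := hasFDerivAt_fst (𝕜 := ℝ)
  have f2 : HasFDerivAt (Prod.snd : ℝ × ℝ → ℝ) _ (s, t) := hasFDerivAt_snd (𝕜 := ℝ)
  have g1 := (K.hasDerivAt_γ i s).hasFDerivAt.comp (s, t) f1
  have g2 := (K.hasDerivAt_γ j t).hasFDerivAt.comp (s, t) f2
  have m1 := (h.hasDerivAt i s).hasFDerivAt.comp (s, t) f1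
  have m2 := (h.hasDerivAt j t).hasFDerivAt.comp (s, t) f2
  have h2 := (g1.sub g2).norm_sq.mul
    ((hasDerivAt_inv (pow_ne_zero 2 hμ.ne')).comp_hasFDerivAt (s, t) ((m1.add m2).pow 2))
  refine HasFDerivAt.congr_fderiv (f := fun p : ℝ × ℝ =>
        ‖K.γ i p.1 - K.γ j p.2‖ ^ 2 / (μ (K.point i p.1) + μ (K.point j p.2)) ^ 2) h2 ?_
  ext
  all_goals
    simp [tangent_point, slope_point, inner_sub_left]
    field_simp
    ring

/-- The two equations say that q₁ and q₂ are both critical for the point dividing their segment in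
the ratio μ(q₁) : μ(q₂). -/
theorem isDoubleCriticalPair_iff (h : K.IsWeight 2 μ) {q₁ q₂ : K.carrier} :
    K.IsDoubleCriticalPair μ q₁ q₂ ↔ q₁ ≠ q₂ ∧
      inner ℝ ((q₁ : EuclideanSpace ℝ (Fin n)) - q₂) (K.tangent q₁) * (μ q₁ + μ q₂) =
        ‖(q₁ : EuclideanSpace ℝ (Fin n)) - q₂‖ ^ 2 * K.slope μ q₁ ∧
      inner ℝ ((q₁ : EuclideanSpace ℝ (Fin n)) - q₂) (K.tangent q₂) * (μ q₁ + μ q₂) =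
        -(‖(q₁ : EuclideanSpace ℝ (Fin n)) - q₂‖ ^ 2 * K.slope μ q₂) := by
  refine and_congr Iff.rfl ⟨?_, ?_⟩
  · rintro ⟨i, s, j, t, rfl, rfl, hd⟩
    have hμ : 0 < μ (K.point i s) + μ (K.point j t) := add_pos (h.1 _) (h.1 _)
    have hu := hd.unique (hasFDerivAt_pairDist h i j s t)
    have e1 := congrArg (fun L : ℝ × ℝ →L[ℝ] ℝ => L (1, 0)) hu
    have e2 := congrArg (fun L : ℝ × ℝ →L[ℝ] ℝ => L (0, 1)) hu
    have h3 : (2 / (μ (K.point i s) + μ (K.point j t)) ^ 3) ≠ 0 := by positivity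
    simp only [zero_apply, smul_apply, sub_apply, smul_eq_mul,
      ContinuousLinearMap.coe_fst', ContinuousLinearMap.coe_snd', mul_one, mul_zero, sub_zero,
      zero_sub] at e1 e2
    have e1' := (mul_eq_zero.1 e1.symm).resolve_left h3
    have e2' := (mul_eq_zero.1 e2.symm).resolve_left h3
    simp only [coe_point]
    constructor <;> linarith
  · rintro ⟨h1, h2⟩
    obtain ⟨i, s, rfl⟩ := K.exists_point q₁
    obtain ⟨j, t, rfl⟩ := K.exists_point q₂
    refine ⟨i, s, j, t, rfl, rfl, ?_⟩
    refine (hasFDerivAt_pairDist h i j s t).congr_fderiv ?_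
    simp only [coe_point] at h1 h2
    rw [h1, h2, sub_self, neg_add_cancel, zero_smul, zero_smul, sub_zero, smul_zero]

/-! ### Minimality of the exponential map -/

/-- Every normal vector `(q, w)` of length less than `r` has the property that `q` minimizes the
weighted distance to `exp^μ(q, w)`. -/
def ExpMinimal (K : ClosedCurves n) (μ : K.carrier → ℝ) (r : ℝ) : Prop :=
  (∀ q, |K.slope μ q| * r ≤ 1) ∧
    ∀ x ∈ K.normalDisc r, ∀ q, wdist μ (K.expMap μ x) x.1 ≤ wdist μ (K.expMap μ x) q

theorem wdist_expMap {q : K.carrier} {w : EuclideanSpace ℝ (Fin n)} (hμ : 0 < μ q)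
    (hw : inner ℝ (K.tangent q) w = 0) (hs : |K.slope μ q| * ‖w‖ ≤ 1) :
    wdist μ (K.expMap μ (q, w)) q = ‖w‖ ^ 2 := by
  rw [wdist, norm_sq_expMap_sub hw hs]
  field_simp

theorem norm_lt_of_wdist_lt {p : EuclideanSpace ℝ (Fin n)} {q : K.carrier} (hμ : 0 < μ q) {r : ℝ}
    (hr : 0 < r) (h : wdist μ p q < r ^ 2) : ‖p - q‖ < r * μ q := by
  rw [wdist, ← div_pow] at h
  exact (div_lt_iff₀ hμ).1 (lt_of_pow_lt_pow_left₀ 2 hr.le h)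

/-- A global minimizer of the weighted distance from exp^μ(x) is critical with value below r², so it
is the foot of a vector in D(r) with the same image. By uniqueness that vector is x. -/
theorem forall_wdist_le_of_unique (h : K.IsWeight 2 μ) {r : ℝ} (hr : ∀ q, |K.slope μ q| * r ≤ 1)
    {x : K.carrier × EuclideanSpace ℝ (Fin n)} (hx : x ∈ K.normalDisc r)
    (hu : ∀ y ∈ K.normalDisc r, K.expMap μ y = K.expMap μ x → y = x) (q : K.carrier) :
    wdist μ (K.expMap μ x) x.1 ≤ wdist μ (K.expMap μ x) q := by
  obtain ⟨q₀, hq₀⟩ := exists_forall_wdist_le h (K.expMap μ x)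
  have hr0 : 0 < r := (norm_nonneg _).trans_lt hx.2
  have hlt : wdist μ (K.expMap μ x) q₀ < r ^ 2 := by
    refine (hq₀ x.1).trans_lt ?_
    rw [wdist_expMap (h.1 _) hx.1 (slope_mul_lt (hr _) hx.2).le]
    exact pow_lt_pow_left₀ hx.2 (norm_nonneg _) two_ne_zero
  obtain ⟨h1, h2⟩ := logVec_mem_normalDisc (h.1 q₀) (hr q₀) (crit_eq_zero_of_forall_le h hq₀)
    (norm_lt_of_wdist_lt (h.1 q₀) hr0 hlt)
  have := congrArg Prod.fst (hu _ h1 h2)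
  simp only at this
  rw [← this]
  exact hq₀ q

theorem expMinimal_of_injOn (h : K.IsWeight 2 μ) {r : ℝ} (hr : ∀ q, |K.slope μ q| * r ≤ 1)
    (hi : Set.InjOn (K.expMap μ) (K.normalDisc r)) : K.ExpMinimal μ r :=
  ⟨hr, fun _ hx => forall_wdist_le_of_unique h hr hx fun _ hy hxy => hi hy hx hxy⟩

theorem ExpMinimal.mono {r r' : ℝ} (hm : K.ExpMinimal μ r) (hr : r' ≤ r) : K.ExpMinimal μ r' :=
  ⟨fun q => (mul_le_mul_of_nonneg_left hr (abs_nonneg _)).trans (hm.1 q),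
    fun x hx => hm.2 x ⟨hx.1, hx.2.trans_le hr⟩⟩

theorem ExpMinimal.hess_nonneg (h : K.IsWeight 2 μ) {r : ℝ} (hm : K.ExpMinimal μ r)
    {x : K.carrier × EuclideanSpace ℝ (Fin n)} (hx : x ∈ K.normalDisc r) : 0 ≤ K.hess μ x :=
  hess_nonneg_of_forall_le h hx.1 (slope_mul_lt (hm.1 _) hx.2).le (hm.2 x hx)

theorem differentiableAt_expMap_smul {q : K.carrier} {w : EuclideanSpace ℝ (Fin n)}
    (hs : |K.slope μ q| * ‖w‖ < 1) :
    DifferentiableAt ℝ (fun τ : ℝ => K.expMap μ (q, τ • w)) 1 := by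
  have hpos := slope_sq_mul_lt (norm_nonneg w) hs
  simp only [expMap_smul_sub]
  have : DifferentiableAt ℝ (fun τ : ℝ => √(1 - K.slope μ q ^ 2 * (τ ^ 2 * ‖w‖ ^ 2))) 1 := by
    refine DifferentiableAt.sqrt (by fun_prop) ?_
    simp only [one_pow, one_mul]
    linarith
  fun_prop

/-- At the dividing point p of the segment both weighted distances equal ρ, and p - q₂ is opposite
to p - q₁. If ρ < r, lengthening the normal vector at q₁ over p raises the weighted distance to q₁
and lowers the one to q₂ to first order, against minimality. -/
theorem ExpMinimal.le_of_isDoubleCriticalPair (h : K.IsWeight 2 μ) {r : ℝ}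
    (hm : K.ExpMinimal μ r) {q₁ q₂ : K.carrier} (hq : K.IsDoubleCriticalPair μ q₁ q₂) :
    r ≤ ‖(q₁ : EuclideanSpace ℝ (Fin n)) - q₂‖ / (μ q₁ + μ q₂) := by
  by_contra! hlt
  obtain ⟨hne, he, -⟩ := (isDoubleCriticalPair_iff h).1 hq
  have h1 := h.1 q₁
  have h2 := h.1 q₂
  have hD : 0 < ‖(q₁ : EuclideanSpace ℝ (Fin n)) - q₂‖ :=
    norm_pos_iff.2 (sub_ne_zero.2 fun h => hne (Subtype.ext h))
  set D := ‖(q₁ : EuclideanSpace ℝ (Fin n)) - q₂‖ with hDdef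
  set ρ := D / (μ q₁ + μ q₂) with hρ
  have hρ0 : 0 < ρ := by positivity
  set p : EuclideanSpace ℝ (Fin n) :=
    q₁ - (μ q₁ / (μ q₁ + μ q₂)) • ((q₁ : EuclideanSpace ℝ (Fin n)) - q₂) with hp
  have hp1 : p - q₁ = -(μ q₁ / (μ q₁ + μ q₂)) • ((q₁ : EuclideanSpace ℝ (Fin n)) - q₂) := by
    rw [hp]; module
  have hp2 : p - q₂ = (μ q₂ / (μ q₁ + μ q₂)) • ((q₁ : EuclideanSpace ℝ (Fin n)) - q₂) := by
    have : μ q₂ / (μ q₁ + μ q₂) = 1 - μ q₁ / (μ q₁ + μ q₂) := by field_simp; ring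
    rw [hp, this]; module
  have hn1 : ‖p - q₁‖ = ρ * μ q₁ := by
    rw [hp1, norm_smul, norm_neg, Real.norm_of_nonneg (by positivity), hρ]; ring
  have hn2 : ‖p - q₂‖ = ρ * μ q₂ := by
    rw [hp2, norm_smul, Real.norm_of_nonneg (by positivity), hρ]; ring
  have hc : K.crit μ p q₁ = 0 := by
    rw [crit, hn1, hp1, inner_smul_left, hρ]
    simp only [RCLike.conj_to_real]
    field_simp
    linear_combination (-μ q₁ ^ 2) * he
  obtain ⟨hx, hxp⟩ := logVec_mem_normalDisc (r := r) h1 (hm.1 q₁) hc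
    (by rw [hn1]; exact mul_lt_mul_of_pos_right hlt h1)
  set w := K.logVec μ p q₁ with hw
  have hwn : ‖w‖ = ρ := by
    have : |K.slope μ q₁| * (‖p - q₁‖ / μ q₁) < 1 := by
      rw [hn1, mul_div_cancel_right₀ _ h1.ne']
      exact slope_mul_lt (hm.1 q₁) hlt
    rw [hw, norm_logVec h1 hc this, hn1, mul_div_cancel_right₀ _ h1.ne']
  have hd := (differentiableAt_expMap_smul (slope_mul_lt (hm.1 q₁) hx.2)).hasDerivAt
  set d := deriv (fun τ : ℝ => K.expMap μ (q₁, τ • w)) 1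
  have hd1 := (hd.sub_const (q₁ : EuclideanSpace ℝ (Fin n))).norm_sq
  have hd2 := (hd.sub_const (q₂ : EuclideanSpace ℝ (Fin n))).norm_sq
  rw [one_smul, hxp] at hd1 hd2
  have hev : ∀ᶠ τ : ℝ in 𝓝 1, (q₁, τ • w) ∈ K.normalDisc r := by
    have hcont : Continuous fun τ : ℝ => ‖τ • w‖ := by fun_prop
    have := hcont.continuousAt.eventually_lt (continuousAt_const (y := r)) (x₀ := 1)
      (by simpa using hx.2)
    filter_upwards [this] with τ hτ
    exact mem_normalDisc.2 ⟨by rw [inner_smul_right, mem_normalBundle.1 hx.1, mul_zero], hτ⟩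
  have hval : (fun τ : ℝ => ‖K.expMap μ (q₁, τ • w) - q₁‖ ^ 2) =ᶠ[𝓝 1]
      fun τ => (μ q₁ * ρ) ^ 2 * τ ^ 2 := by
    filter_upwards [hev] with τ hτ
    rw [norm_sq_expMap_sub hτ.1 (slope_mul_lt (hm.1 q₁) hτ.2).le, norm_smul, hwn,
      Real.norm_eq_abs, mul_pow, mul_pow, sq_abs]
    ring
  have e1 := (hval.hasDerivAt_iff.1 hd1).unique (((hasDerivAt_id (1 : ℝ)).pow 2).const_mul _)
  have hmin : IsLocalMin (fun τ : ℝ => ‖K.expMap μ (q₁, τ • w) - q₂‖ ^ 2 / μ q₂ ^ 2 -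
      ‖K.expMap μ (q₁, τ • w) - q₁‖ ^ 2 / μ q₁ ^ 2) 1 := by
    filter_upwards [hev] with τ hτ
    have := hm.2 _ hτ q₂
    simp only [wdist] at this
    rw [one_smul, hxp, hn1, hn2]
    have e : (ρ * μ q₂) ^ 2 / μ q₂ ^ 2 - (ρ * μ q₁) ^ 2 / μ q₁ ^ 2 = 0 := by field_simp; ring
    rw [e]
    linarith
  have e2 := hmin.hasDerivAt_eq_zero ((hd2.div_const _).sub (hd1.div_const _))
  have e3 : inner ℝ (p - q₂) d = -(μ q₂ / μ q₁) * inner ℝ (p - q₁) d := by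
    rw [hp1, hp2, inner_smul_left, inner_smul_left]
    simp only [RCLike.conj_to_real]
    field_simp
  have e1' : inner ℝ (p - q₁) d = (μ q₁ * ρ) ^ 2 := by
    norm_num at e1
    linarith
  rw [e3, e1'] at e2
  -- The derivative of the difference is -2ρ²(μ(q₁) + μ(q₂))/μ(q₂), which would have to vanish at
  -- the local minimum τ = 1.
  have e4 : ρ ^ 2 * (μ q₁ + μ q₂) = 0 := by
    field_simp at e2
    linarith
  have : 0 < ρ ^ 2 * (μ q₁ + μ q₂) := by positivity
  linarith

theorem ExpMinimal.le_halfDCSD (h : K.IsWeight 2 μ) {r : ℝ} (hm : K.ExpMinimal μ r) :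
    (r : EReal) ≤ K.halfDCSD μ := by
  refine le_sInf ?_
  rintro d ⟨q₁, q₂, hq, rfl⟩
  exact EReal.coe_le_coe_iff.2 (hm.le_of_isDoubleCriticalPair h hq)

/-! ### The almost injectivity radius -/

/-- Degenerate vectors are limits of nondegenerate ones along their own ray, and the inequality is
closed. -/
theorem expMinimal_of_forall_hess_ne_zero (h : K.IsWeight 2 μ) {r : ℝ}
    (hr : ∀ q, |K.slope μ q| * r ≤ 1)
    (hx : ∀ x ∈ K.normalDisc r, K.hess μ x ≠ 0 →
      ∀ q, wdist μ (K.expMap μ x) x.1 ≤ wdist μ (K.expMap μ x) q) : K.ExpMinimal μ r := by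
  refine ⟨hr, ?_⟩
  rintro ⟨q₀, w⟩ hw q
  have hs := slope_mul_lt (hr q₀) hw.2
  have hcont : Continuous fun τ : ℝ => K.expMap μ (q₀, τ • w) :=
    (continuous_expMap h).comp (by fun_prop)
  have hlim : ∀ q : K.carrier, Tendsto (fun τ : ℝ => wdist μ (K.expMap μ (q₀, τ • w)) q) (𝓝[≠] 1)
      (𝓝 (wdist μ (K.expMap μ (q₀, w)) q)) := by
    intro q
    have : Continuous fun τ : ℝ => wdist μ (K.expMap μ (q₀, τ • w)) q :=
      Continuous.comp (g := fun x : EuclideanSpace ℝ (Fin n) × K.carrier => wdist μ x.1 x.2)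
        (f := fun τ : ℝ => (K.expMap μ (q₀, τ • w), q)) (continuous_wdist h)
        (hcont.prodMk continuous_const)
    have h2 := this.tendsto 1
    rw [one_smul] at h2
    exact h2.mono_left nhdsWithin_le_nhds
  refine le_of_tendsto_of_tendsto (hlim q₀) (hlim q) ?_
  have hn : ∀ᶠ τ : ℝ in 𝓝[≠] 1, ‖τ • w‖ < r := by
    have hcont : Continuous fun τ : ℝ => ‖τ • w‖ := by fun_prop
    exact (hcont.continuousAt.eventually_lt (continuousAt_const (y := r)) (x₀ := 1)
      (by simpa using hw.2)).filter_mono nhdsWithin_le_nhds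
  filter_upwards [eventually_hess_smul_ne_zero q₀ hs, hn] with τ h1 h2
  exact hx (q₀, τ • w)
    (mem_normalDisc.2 ⟨by rw [inner_smul_right, mem_normalBundle.1 hw.1, mul_zero], h2⟩) h1 q

/-- A nondegenerate x has no second preimage y of its image in D(r), because such a coincidence
could be pushed into U. Density replaces y by a nearby y' in U, openness of exp^μ at x gives x' near
x with the image of y', and density again gives x'' in U near x' whose image still lies in the open
image of U near y. This contradicts injectivity on U. -/
theorem expMinimal_of_dense (h : K.IsWeight 2 μ) {r : ℝ} (hr0 : 0 < r)
    {U : Set (K.carrier × EuclideanSpace ℝ (Fin n))} (hU : U ⊆ K.expDomain μ)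
    (hd : K.normalDisc r ⊆ closure U)
    (ho : IsOpen (K.expMap μ '' U)) (he : IsEmbedding (U.domRestrict (K.expMap μ))) :
    K.ExpMinimal μ r := by
  have hr := slope_mul_le_of_subset hr0
    (hd.trans ((isClosed_expDomain h).closure_subset_iff.2 hU))
  have hopen : ∀ O : Set (K.carrier × EuclideanSpace ℝ (Fin n)), IsOpen O →
      IsOpen (K.expMap μ '' (O ∩ U)) := by
    intro O hO
    have hoe : IsOpenEmbedding (U.domRestrict (K.expMap μ)) :=
      ⟨he, by rwa [Set.range_domRestrict]⟩
    have := hoe.isOpenMap _ (hO.preimage continuous_subtype_val)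
    convert this using 1
    ext y
    constructor
    · rintro ⟨x, ⟨hx1, hx2⟩, rfl⟩
      exact ⟨⟨x, hx2⟩, hx1, rfl⟩
    · rintro ⟨⟨x, hx2⟩, hx1, rfl⟩
      exact ⟨x, ⟨hx1, hx2⟩, rfl⟩
  have hinj : ∀ x ∈ U, ∀ y ∈ U, K.expMap μ x = K.expMap μ y → x = y := by
    intro x hx y hy hxy
    exact congrArg Subtype.val (he.injective (a₁ := ⟨x, hx⟩) (a₂ := ⟨y, hy⟩) hxy)
  refine expMinimal_of_forall_hess_ne_zero h hr fun x hx hH =>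
    forall_wdist_le_of_unique h hr hx fun y hy hxy => ?_
  by_contra hne
  obtain ⟨Oy, Ox, hOy, hOx, hyO, hxO, hdisj⟩ := t2_separation hne
  have hN := image_expMap_mem_nhds h hr hx hH (hOx.mem_nhds hxO)
  rw [← hxy] at hN
  obtain ⟨P, hPN, hPo, hyP⟩ := mem_nhds_iff.1 hN
  obtain ⟨y', ⟨hy'O, hy'P⟩, hy'U⟩ := mem_closure_iff.1 (hd hy) (Oy ∩ K.expMap μ ⁻¹' P)
    (hOy.inter (hPo.preimage (continuous_expMap h))) ⟨hyO, hyP⟩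
  obtain ⟨x', ⟨hx'O, hx'D⟩, hx'⟩ := hPN hy'P
  obtain ⟨x'', ⟨hx''O, hx''P⟩, hx''U⟩ := mem_closure_iff.1 (hd hx'D)
    (Ox ∩ K.expMap μ ⁻¹' (K.expMap μ '' (Oy ∩ U)))
    (hOx.inter ((hopen Oy hOy).preimage (continuous_expMap h)))
    ⟨hx'O, y', ⟨hy'O, hy'U⟩, hx'.symm⟩
  obtain ⟨y'', ⟨hy''O, hy''U⟩, hy''⟩ := hx''P
  have := hinj _ hy''U _ hx''U hy''
  exact Set.disjoint_left.1 hdisj hy''O (this ▸ hx''O)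

/-- If `exp^μ` is minimal then it is injective on nondegenerate normal vectors. -/
theorem ExpMinimal.injOn (h : K.IsWeight 2 μ) {r : ℝ} (hm : K.ExpMinimal μ r) :
    Set.InjOn (K.expMap μ) (K.normalDisc r ∩ {x | K.hess μ x ≠ 0}) := by
  rintro ⟨q₁, w₁⟩ ⟨hx₁, hH₁⟩ ⟨q₂, w₂⟩ ⟨hx₂, hH₂⟩ hp
  have hs₁ : |K.slope μ q₁| * ‖w₁‖ < 1 := slope_mul_lt (hm.1 q₁) hx₁.2
  have hs₂ : |K.slope μ q₂| * ‖w₂‖ < 1 := slope_mul_lt (hm.1 q₂) hx₂.2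
  suffices hq : q₁ = q₂ by
    subst hq
    have e₁ := logVec_expMap (h.1 q₁) (w := w₁) hx₁.1 hs₁
    have e₂ := logVec_expMap (h.1 q₁) (w := w₂) hx₂.1 hs₂
    rw [← e₁, ← e₂, hp, e₂]
  have hnorm₁ := norm_expMap_sub (h.1 q₁) (w := w₁) hx₁.1 hs₁.le
  have hnorm₂ := norm_expMap_sub (h.1 q₂) (w := w₂) hx₂.1 hs₂.le
  obtain ⟨i, s, rfl⟩ := K.exists_point q₁
  obtain ⟨j, t, rfl⟩ := K.exists_point q₂
  obtain ⟨S₁, a1, a2, -, -, a5⟩ := exists_section h hm.1 hx₁ hH₁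
  obtain ⟨S₂, b1, b2, -, -, b5⟩ := exists_section h hm.1 hx₂ hH₂
  have hval : ‖w₁‖ = ‖w₂‖ := by
    have c1 := hm.2 (K.point i s, w₁) hx₁ (K.point j t)
    have c2 := hm.2 (K.point j t, w₂) hx₂ (K.point i s)
    have d1 := wdist_expMap (h.1 (K.point i s)) (w := w₁) hx₁.1 hs₁.le
    have d2 := wdist_expMap (h.1 (K.point j t)) (w := w₂) hx₂.1 hs₂.le
    simp only at c1 c2
    rw [hp] at c1 d1
    refine (sq_eq_sq₀ (norm_nonneg _) (norm_nonneg _)).1 ?_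
    rw [← d1, ← d2]
    exact le_antisymm c1 c2
  rw [← hp] at b1 b2 b5 hnorm₂
  set p := K.expMap μ (K.point i s, w₁) with hpdef
  -- Near p both critical values equal the minimum of the weighted distance. They agree as
  -- functions, hence so do their gradients 2(p - q)/μ(q)².
  have hEq : (fun x => wdist μ x (K.point i (S₁ x))) =ᶠ[𝓝 p]
      fun x => wdist μ x (K.point j (S₂ x)) := by
    filter_upwards [a5, b5] with x hx hx'
    have c1 := hm.2 _ hx.2.2.1 (K.point j (S₂ x))
    have c2 := hm.2 _ hx'.2.2.1 (K.point i (S₁ x))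
    simp only [hx.2.2.2] at c1
    simp only [hx'.2.2.2] at c2
    exact le_antisymm c1 c2
  have f1 := hasFDerivAt_wdist_section h a1 a5.self_of_nhds.1
  have f2 := hasFDerivAt_wdist_section h b1 b5.self_of_nhds.1
  have := (hEq.hasFDerivAt_iff.1 f1).unique f2
  rw [a2, b2, ← map_smul, ← map_smul] at this
  have hvec : (2 / μ (K.point i s) ^ 2) • (p - K.point i s) =
      (2 / μ (K.point j t) ^ 2) • (p - K.point j t) :=
    ext_inner_right ℝ fun v => DFunLike.congr_fun this v
  have hμ₁ := h.1 (K.point i s)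
  have hμ₂ := h.1 (K.point j t)
  refine Subtype.ext ?_
  rcases eq_or_ne ‖w₂‖ 0 with h0 | h0
  · rw [hval, h0, mul_zero, norm_eq_zero, sub_eq_zero] at hnorm₁
    rw [h0, mul_zero, norm_eq_zero, sub_eq_zero] at hnorm₂
    rw [← hnorm₁, ← hnorm₂]
  -- The two sides have lengths 2‖w₁‖/μ(q₁) and 2‖w₂‖/μ(q₂) with ‖w₁‖ = ‖w₂‖, so the weights agree
  -- and then the points do.
  · have hn := congrArg norm hvec
    rw [norm_smul, norm_smul, hnorm₁, hnorm₂, hval, Real.norm_of_nonneg (by positivity),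
      Real.norm_of_nonneg (by positivity)] at hn
    have hμ : μ (K.point i s) = μ (K.point j t) := by
      field_simp at hn
      linarith
    rw [hμ] at hvec
    have := smul_right_injective _ (by positivity : 2 / μ (K.point j t) ^ 2 ≠ 0) hvec
    exact sub_right_injective this

theorem normalDisc_subset_closure {r : ℝ} (hr : ∀ q, |K.slope μ q| * r ≤ 1) :
    K.normalDisc r ⊆ closure (K.normalDisc r ∩ {x | K.hess μ x ≠ 0}) := by
  rintro ⟨q, w⟩ hw
  have hlim : Tendsto (fun τ : ℝ => (q, τ • w)) (𝓝[≠] 1) (𝓝 (q, w)) := by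
    have hc : Continuous fun τ : ℝ => (q, τ • w) := by fun_prop
    have := hc.tendsto 1
    rw [one_smul] at this
    exact this.mono_left nhdsWithin_le_nhds
  have hn : ∀ᶠ τ : ℝ in 𝓝[≠] 1, ‖τ • w‖ < r := by
    have hcont : Continuous fun τ : ℝ => ‖τ • w‖ := by fun_prop
    exact (hcont.continuousAt.eventually_lt (continuousAt_const (y := r)) (x₀ := 1)
      (by simpa using hw.2)).filter_mono nhdsWithin_le_nhds
  refine mem_closure_of_tendsto hlim ?_
  filter_upwards [eventually_hess_smul_ne_zero q (slope_mul_lt (hr q) hw.2), hn] with τ h1 h2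
  exact ⟨mem_normalDisc.2 ⟨by rw [inner_smul_right, mem_normalBundle.1 hw.1, mul_zero], h2⟩, h1⟩

/-- The nondegenerate vectors serve as U: dense along rays, mapped openly by the local sections,
injectively by the envelope formula. -/
theorem ExpMinimal.le_AIR (h : K.IsWeight 2 μ) {r : ℝ} (hm : K.ExpMinimal μ r) :
    (r : EReal) ≤ K.AIR μ := by
  set N : Set (K.carrier × EuclideanSpace ℝ (Fin n)) := {x | K.hess μ x ≠ 0} with hN
  have hNo : IsOpen N := isOpen_ne_fun (continuous_hess h) continuous_const
  set U := K.normalDisc r ∩ N with hU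
  have hopen : ∀ O : Set (K.carrier × EuclideanSpace ℝ (Fin n)), IsOpen O →
      IsOpen (K.expMap μ '' (O ∩ U)) := by
    intro O hO
    rw [isOpen_iff_mem_nhds]
    rintro _ ⟨x, ⟨hxO, hxD, hxN⟩, rfl⟩
    refine mem_of_superset (image_expMap_mem_nhds h hm.1 hxD hxN
      ((hO.inter hNo).mem_nhds ⟨hxO, hxN⟩)) (Set.image_mono ?_)
    rintro y ⟨⟨hyO, hyN⟩, hyD⟩
    exact ⟨hyO, hyD, hyN⟩
  refine le_sSup ⟨r, ⟨U, ?_, ⟨N, hNo, rfl⟩, normalDisc_subset_closure hm.1, ?_, ?_⟩, rfl⟩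
  · exact Set.inter_subset_left.trans (normalDisc_subset_expDomain hm.1)
  · simpa using hopen Set.univ isOpen_univ
  · refine (IsOpenEmbedding.of_continuous_injective_isOpenMap
      ((continuous_expMap h).comp continuous_subtype_val) ?_ ?_).isEmbedding
    · rintro ⟨x, hx⟩ ⟨y, hy⟩ hxy
      exact Subtype.ext (hm.injOn h hx hy hxy)
    · intro O hO
      obtain ⟨O', hO', rfl⟩ := isOpen_induced_iff.1 hO
      rw [Set.image_comp, Subtype.image_preimage_coe, Set.inter_comm]
      exact hopen O' hO'

theorem expMinimal_of_nonpos {r : ℝ} (hr : r ≤ 0) : K.ExpMinimal μ r :=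
  ⟨fun _ => (mul_nonpos_of_nonneg_of_nonpos (abs_nonneg _) hr).trans zero_le_one,
    fun x hx => absurd (hx.2.trans_le hr) (norm_nonneg x.2).not_gt⟩

/-- With `ExpMinimal.le_AIR` this makes AIR the supremum of the radii of minimality, so the set U
plays no further role. -/
theorem expMinimal_of_lt_AIR (h : K.IsWeight 2 μ) {r : ℝ} (hr : (r : EReal) < K.AIR μ) :
    K.ExpMinimal μ r := by
  obtain ⟨_, ⟨r', ⟨U, h1, -, h3, h4, h5⟩, rfl⟩, hlt⟩ := lt_sSup_iff.1 hr
  rcases le_or_gt r 0 with h0 | h0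
  · exact expMinimal_of_nonpos h0
  · have hlt' : r < r' := EReal.coe_lt_coe_iff.1 hlt
    exact (expMinimal_of_dense h (h0.trans hlt') h1 h3 h4 h5).mono hlt'.le

theorem TIR_le_AIR (h : K.IsWeight 2 μ) : K.TIR μ ≤ K.AIR μ := by
  refine sSup_le ?_
  rintro _ ⟨r, ⟨h1, h2⟩, rfl⟩
  rcases le_or_gt r 0 with h0 | h0
  · exact (expMinimal_of_nonpos h0).le_AIR h
  · refine ExpMinimal.le_AIR h (expMinimal_of_injOn h (slope_mul_le_of_subset h0 h1) ?_)
    exact Set.injOn_iff_injective.2 h2.injective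

theorem DIR_le_TIR (h : K.IsWeight 2 μ) : K.DIR μ ≤ K.TIR μ := by
  refine sSup_le_sSup (Set.image_mono ?_)
  rintro r ⟨h1, f, g, -, hg, hfg⟩
  refine ⟨h1, ?_⟩
  set D := K.normalDisc r
  set e : D → K.expMap μ '' D := fun x => ⟨K.expMap μ x, x, x.2, rfl⟩ with he
  have hec : Continuous e :=
    ((continuous_expMap h).comp continuous_subtype_val).subtype_mk _
  have hgc : Continuous ((K.expMap μ '' D).domRestrict g) := hg.continuousOn.domRestrict
  have hcomp : IsEmbedding ((K.expMap μ '' D).domRestrict g ∘ e) := by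
    have : (K.expMap μ '' D).domRestrict g ∘ e =
        (Prod.map Subtype.val id) ∘ (Subtype.val : D → _) :=
      funext fun x => (hfg x x.2).2
    rw [this]
    exact (IsEmbedding.subtypeVal.prodMap IsEmbedding.id).comp IsEmbedding.subtypeVal
  exact IsEmbedding.subtypeVal.comp (IsEmbedding.of_comp hec hgc hcomp)

/-! ### The differentiable injectivity radius -/

/-- A point in one of the balls has a global minimizer, and the normal vector over it lies in D(r).
The image is therefore open even where exp^μ is not injective. -/
theorem image_expMap_normalDisc (h : K.IsWeight 2 μ) {r : ℝ} (hr : ∀ q, |K.slope μ q| * r ≤ 1) :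
    K.expMap μ '' K.normalDisc r = ⋃ q : K.carrier, Metric.ball (q : EuclideanSpace ℝ (Fin n))
      (r * μ q) := by
  ext p
  simp only [Set.mem_iUnion, mem_ball_iff_norm]
  constructor
  · rintro ⟨⟨q, w⟩, hx, rfl⟩
    refine ⟨q, ?_⟩
    rw [norm_expMap_sub (h.1 q) hx.1 (slope_mul_lt (hr q) hx.2).le, mul_comm]
    exact mul_lt_mul_of_pos_right hx.2 (h.1 q)
  · rintro ⟨q, hq⟩
    obtain ⟨q₀, hq₀⟩ := exists_forall_wdist_le h p
    have hlt : ‖p - q₀‖ < r * μ q₀ := by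
      have := (wdist_le_iff (h.1 _) (h.1 _)).1 (hq₀ q)
      exact (div_lt_iff₀ (h.1 _)).1 (this.trans_lt ((div_lt_iff₀ (h.1 _)).2 hq))
    obtain ⟨h1, h2⟩ := logVec_mem_normalDisc (h.1 q₀) (hr q₀) (crit_eq_zero_of_forall_le h hq₀) hlt
    exact ⟨_, h1, h2⟩

theorem isOpen_image_expMap (h : K.IsWeight 2 μ) {r : ℝ} (hr : ∀ q, |K.slope μ q| * r ≤ 1) :
    IsOpen (K.expMap μ '' K.normalDisc r) := by
  rw [image_expMap_normalDisc h hr]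
  exact isOpen_iUnion fun q => Metric.isOpen_ball

variable (K) in
-- The same local parameter, stated on ambient neighbourhoods so that it can be composed with maps
-- into ℝⁿ whose values are only known to lie on K at some points.
theorem exists_ambient_parameter (i : Fin K.m) (s : ℝ) :
    ∃ S : EuclideanSpace ℝ (Fin n) → ℝ, ContDiffAt ℝ 1 S (K.γ i s) ∧ S (K.γ i s) = s ∧
      ∀ᶠ y in 𝓝 (K.γ i s), ∀ q : K.carrier, (q : EuclideanSpace ℝ (Fin n)) = y →
        K.point i (S y) = q := by
  obtain ⟨S, h1, h2, h3⟩ := K.exists_local_parameter i s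
  refine ⟨S, h1, h2, ?_⟩
  rw [nhds_subtype_eq_comap, eventually_comap] at h3
  filter_upwards [h3] with y hy q hq
  rw [← hq]
  exact hy q hq

theorem hasFDerivAt_crit_left (p : EuclideanSpace ℝ (Fin n)) (q : K.carrier) :
    HasFDerivAt (fun p => K.crit μ p q)
      (μ q • innerSL ℝ (K.tangent q) + (2 * K.slope μ q) • innerSL ℝ (p - q)) p := by
  have h1 := (hasFDerivAt_id (𝕜 := ℝ) p).sub_const (q : EuclideanSpace ℝ (Fin n))
  have h2 := ((h1.inner ℝ (hasFDerivAt_const (K.tangent q) p)).mul_const (μ q)).add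
    (h1.norm_sq.mul_const (K.slope μ q))
  refine HasFDerivAt.congr_fderiv (f := fun p => K.crit μ p q) h2 ?_
  ext v
  simp [real_inner_comm]
  ring

/-- The functional is the derivative of `crit` in p. Evaluated on the tangent and on exp^μ(q, w) -
q, its vanishing would force μ'‖w‖² = 0 and then μ = 0. -/
theorem exists_inner_ne_zero {q : K.carrier} {w : EuclideanSpace ℝ (Fin n)} (hμ : 0 < μ q)
    (hw : inner ℝ (K.tangent q) w = 0) (hs : |K.slope μ q| * ‖w‖ < 1) :
    (μ q • innerSL ℝ (K.tangent q) + (2 * K.slope μ q) • innerSL ℝ (K.expMap μ (q, w) - q) :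
      EuclideanSpace ℝ (Fin n) →L[ℝ] ℝ) ≠ 0 := by
  intro h0
  have e1 := DFunLike.congr_fun h0 (K.tangent q)
  have e2 := DFunLike.congr_fun h0 (K.expMap μ (q, w) - q)
  simp only [add_apply, smul_apply, innerSL_apply_apply, smul_eq_mul, zero_apply,
    real_inner_self_eq_norm_sq, norm_tangent, norm_sq_expMap_sub hw hs.le,
    inner_expMap_sub_tangent hw, real_inner_comm (K.expMap μ (q, w) - q)] at e1 e2
  have e3 : μ q ^ 2 * (K.slope μ q * ‖w‖ ^ 2) = 0 := by linarith
  have e4 : K.slope μ q * ‖w‖ ^ 2 = 0 := (mul_eq_zero.1 e3).resolve_left (by positivity)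
  have e5 : μ q * (1 - 2 * K.slope μ q * (K.slope μ q * ‖w‖ ^ 2)) = 0 := by linarith
  rw [e4] at e5
  linarith

/-- The smooth inverse supplies a differentiable σ with crit(y, σ(y)) = 0 near p. If `hess`
vanished, so would the parameter derivative of `crit`; differentiating the identity would then make
its derivative in y vanish, against `exists_inner_ne_zero`. -/
theorem hess_ne_zero_of_isDiffeoOntoImage (h : K.IsWeight 2 μ) {r : ℝ}
    (hr : ∀ q, |K.slope μ q| * r ≤ 1) (hd : K.IsDiffeoOntoImage (K.normalDisc r) (K.expMap μ))
    {x : K.carrier × EuclideanSpace ℝ (Fin n)} (hx : x ∈ K.normalDisc r) : K.hess μ x ≠ 0 := by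
  intro hH
  obtain ⟨f, g, -, hg, hfg⟩ := hd
  obtain ⟨q, w⟩ := x
  obtain ⟨i, s, rfl⟩ := K.exists_point q
  have hs : |K.slope μ (K.point i s)| * ‖w‖ < 1 := slope_mul_lt (hr _) hx.2
  have hD := hasDerivAt_crit_expMap h (w := w) hx.1 hs.le
  have hC := crit_expMap (μ := μ) (w := w) hx.1 hs.le
  have hL := exists_inner_ne_zero (h.1 (K.point i s)) (w := w) hx.1 hs
  -- Because the image is open, smoothness of g on it gives genuine differentiability at p.
  have hnhds := (isOpen_image_expMap h hr).mem_nhds ⟨_, hx, rfl⟩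
  have hgd := (hg.contDiffAt hnhds).differentiableAt one_ne_zero
  have hg0 := (hfg _ hx).2
  set p := K.expMap μ (K.point i s, w) with hp
  obtain ⟨S, hS1, hS2, hS3⟩ := K.exists_ambient_parameter i s
  have hgp : (g p).1 = K.γ i s := by rw [hg0]; rfl
  have hσ : DifferentiableAt ℝ (fun y => S (g y).1) p := by
    refine DifferentiableAt.comp (g := S) (f := fun y => (g y).1) p ?_ hgd.fst
    rw [hgp]
    exact hS1.differentiableAt one_ne_zero
  have hgc : Tendsto (fun y => (g y).1) (𝓝 p) (𝓝 (K.γ i s)) := by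
    have := hgd.continuousAt.fst
    rwa [ContinuousAt, hgp] at this
  have hzero : (fun y => K.crit μ y (K.point i (S (g y).1))) =ᶠ[𝓝 p] fun _ => 0 := by
    filter_upwards [hgc.eventually hS3, hnhds] with y hy1 hy2
    obtain ⟨x', hx', rfl⟩ := hy2
    rw [hy1 x'.1 (by rw [(hfg x' hx').2])]
    exact crit_expMap hx'.1 (slope_mul_lt (hr _) hx'.2).le
  have hF := ((contDiff_crit h i).differentiable one_ne_zero (p, s)).hasFDerivAt
  set F' := fderiv ℝ (fun x : EuclideanSpace ℝ (Fin n) × ℝ => K.crit μ x.1 (K.point i x.2)) (p, s)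
  have h0 : HasFDerivAt (fun y => K.crit μ y (K.point i s)) (F' ∘L .inl ℝ _ ℝ) p :=
    HasFDerivAt.comp (f := fun y => (y, s)) (g := fun x : EuclideanSpace ℝ (Fin n) × ℝ =>
      K.crit μ x.1 (K.point i x.2)) p hF (hasFDerivAt_prodMk_left p s)
  have h1 := h0.unique (hasFDerivAt_crit_left p (K.point i s))
  have h2 : F' (0, 1) = 0 := by
    have h0 : HasFDerivAt (fun t => K.crit μ p (K.point i t)) (F' ∘L .inr ℝ _ ℝ) s :=
      HasFDerivAt.comp (f := fun t => (p, t)) (g := fun x : EuclideanSpace ℝ (Fin n) × ℝ =>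
        K.crit μ x.1 (K.point i x.2)) s hF (hasFDerivAt_prodMk_right p s)
    have := h0.hasDerivAt.unique hD
    simpa [hH] using this
  have hSp : S (g p).1 = s := by rw [hgp, hS2]
  have h3 := HasFDerivAt.comp (g := fun x : EuclideanSpace ℝ (Fin n) × ℝ =>
      K.crit μ x.1 (K.point i x.2)) (f := fun y => (y, S (g y).1)) (g' := F') p (by rwa [hSp])
    ((hasFDerivAt_id p).prodMk hσ.hasFDerivAt)
  have h4 := (hzero.hasFDerivAt_iff.1 h3).unique (hasFDerivAt_const 0 p)
  refine hL ?_
  rw [← h1]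
  ext v
  have h5 := DFunLike.congr_fun h4 v
  simp only [ContinuousLinearMap.comp_apply, ContinuousLinearMap.prod_apply,
    ContinuousLinearMap.id_apply, zero_apply] at h5
  have h6 : ∀ c : ℝ, F' (v, c) = F' (v, 0) := by
    intro c
    have : (v, c) = (v, (0 : ℝ)) + c • ((0 : EuclideanSpace ℝ (Fin n)), (1 : ℝ)) := by simp
    rw [this, map_add, map_smul, h2, smul_zero, add_zero]
  rw [h6] at h5
  simpa using h5

theorem contDiffAt_expMap_point (h : K.IsWeight 2 μ) {i : Fin K.m} {s : ℝ}
    {w : EuclideanSpace ℝ (Fin n)} (hs : |K.slope μ (K.point i s)| * ‖w‖ < 1) :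
    ContDiffAt ℝ 1 (fun x : ℝ × EuclideanSpace ℝ (Fin n) => K.expMap μ (K.point i x.1, x.2))
      (s, w) := by
  have hpos := slope_sq_mul_lt (norm_nonneg w) hs
  rw [slope_point] at hpos
  simp only [expMap_eq, slope_point, tangent_point, coe_point]
  have h1 : ContDiff ℝ 1 fun x : ℝ × EuclideanSpace ℝ (Fin n) => K.γ i x.1 :=
    ((K.contDiff i).of_le (by norm_num)).comp contDiff_fst
  have h2 : ContDiff ℝ 1 fun x : ℝ × EuclideanSpace ℝ (Fin n) => deriv (K.γ i) x.1 :=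
    ((K.contDiff_deriv_γ i).of_le (by norm_num)).comp contDiff_fst
  have h3 : ContDiff ℝ 1 fun x : ℝ × EuclideanSpace ℝ (Fin n) => μ (K.point i x.1) :=
    ((h.2 i).of_le (by norm_num)).comp contDiff_fst
  have h4 : ContDiff ℝ 1 fun x : ℝ × EuclideanSpace ℝ (Fin n) =>
      deriv (fun t => μ (K.point i t)) x.1 := (h.contDiff_deriv i).comp contDiff_fst
  have h5 : ContDiff ℝ 1 fun x : ℝ × EuclideanSpace ℝ (Fin n) => ‖x.2‖ ^ 2 :=
    contDiff_snd.norm_sq ℝ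
  have h6 : ContDiffAt ℝ 1 (fun x : ℝ × EuclideanSpace ℝ (Fin n) =>
      √(1 - deriv (fun t => μ (K.point i t)) x.1 ^ 2 * ‖x.2‖ ^ 2)) (s, w) :=
    (contDiff_const.sub ((h4.pow 2).mul h5)).contDiffAt.sqrt (by simp only; linarith)
  exact (h1.sub (((h3.mul h5).mul h4).smul h2)).contDiffAt.add
    ((h3.contDiffAt.mul h6).smul contDiff_snd.contDiffAt)

open Classical in
-- The values of f off K × ℝⁿ and of g off the image are irrelevant. Locally f agrees on the disc
-- with exp^μ in a local parameter, and injectivity identifies g with the local section.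
theorem isDiffeoOntoImage_of_injOn (h : K.IsWeight 2 μ) {r : ℝ} (hr : ∀ q, |K.slope μ q| * r ≤ 1)
    (hi : Set.InjOn (K.expMap μ) (K.normalDisc r)) (hH : ∀ x ∈ K.normalDisc r, K.hess μ x ≠ 0) :
    K.IsDiffeoOntoImage (K.normalDisc r) (K.expMap μ) := by
  set ι : K.carrier × EuclideanSpace ℝ (Fin n) →
    EuclideanSpace ℝ (Fin n) × EuclideanSpace ℝ (Fin n) := fun x => (x.1, x.2) with hι
  set f : EuclideanSpace ℝ (Fin n) × EuclideanSpace ℝ (Fin n) → EuclideanSpace ℝ (Fin n) :=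
    fun y => if hy : y.1 ∈ K.carrier then K.expMap μ (⟨y.1, hy⟩, y.2) else 0 with hf
  set g : EuclideanSpace ℝ (Fin n) → EuclideanSpace ℝ (Fin n) × EuclideanSpace ℝ (Fin n) :=
    fun p => if hp : p ∈ K.expMap μ '' K.normalDisc r then ι hp.choose else 0 with hg
  have hfι : ∀ x, f (ι x) = K.expMap μ x := fun x => by
    simp only [hf, hι, dif_pos x.1.2]
  have hgF : ∀ x ∈ K.normalDisc r, g (K.expMap μ x) = ι x := by
    intro x hx
    have hp : K.expMap μ x ∈ K.expMap μ '' K.normalDisc r := ⟨x, hx, rfl⟩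
    simp only [hg, dif_pos hp]
    rw [hi hp.choose_spec.1 hx hp.choose_spec.2]
  refine ⟨f, g, ?_, ?_, fun x hx => ⟨hfι x, hgF x hx⟩⟩
  · rintro _ ⟨⟨q, w⟩, hx, rfl⟩
    obtain ⟨i, s, rfl⟩ := K.exists_point q
    obtain ⟨S, hS1, hS2, hS3⟩ := K.exists_ambient_parameter i s
    have hs : |K.slope μ (K.point i s)| * ‖w‖ < 1 := slope_mul_lt (hr _) hx.2
    have hcomp : ContDiffAt ℝ 1 (fun y : EuclideanSpace ℝ (Fin n) × EuclideanSpace ℝ (Fin n) =>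
        K.expMap μ (K.point i (S y.1), y.2)) (K.γ i s, w) := by
      refine ContDiffAt.comp (g := fun x : ℝ × EuclideanSpace ℝ (Fin n) =>
        K.expMap μ (K.point i x.1, x.2)) (f := fun y : EuclideanSpace ℝ (Fin n) ×
          EuclideanSpace ℝ (Fin n) => (S y.1, y.2)) (K.γ i s, w) ?_ ?_
      · simp only [hS2]
        exact contDiffAt_expMap_point h hs
      · exact (ContDiffAt.comp (g := S) (f := Prod.fst) (K.γ i s, w) hS1 contDiffAt_fst).prodMk
          contDiffAt_snd
    refine hcomp.contDiffWithinAt.congr_of_eventuallyEq (f₁ := f) ?_ ?_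
    · have hev : ∀ᶠ y in 𝓝 ((K.γ i s, w) : EuclideanSpace ℝ (Fin n) × EuclideanSpace ℝ (Fin n)),
          ∀ q : K.carrier, (q : EuclideanSpace ℝ (Fin n)) = y.1 → K.point i (S y.1) = q :=
        (continuous_fst.tendsto (K.γ i s, w)).eventually hS3
      filter_upwards [hev.filter_mono nhdsWithin_le_nhds, self_mem_nhdsWithin] with y hy1 hy2
      obtain ⟨x', hx', rfl⟩ := hy2
      rw [hy1 x'.1 rfl]
      exact hfι x'
    · rw [hS2]
      exact hfι (K.point i s, w)
  · rintro _ ⟨⟨q, w⟩, hx, rfl⟩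
    obtain ⟨i, s, rfl⟩ := K.exists_point q
    obtain ⟨S, h1, h2, h3, h4, h5⟩ := exists_section h hr hx (hH _ hx)
    have hev : g =ᶠ[𝓝 (K.expMap μ (K.point i s, w))]
        fun x => (K.γ i (S x), K.logVec μ x (K.point i (S x))) := by
      filter_upwards [h5] with x hx
      have := hgF _ hx.2.2.1
      rw [hx.2.2.2] at this
      exact this
    have hγ : ContDiff ℝ 1 (K.γ i) := (K.contDiff i).of_le (by norm_num)
    exact ((ContDiffAt.prodMk (hγ.contDiffAt.comp _ h1) h3).congr_of_eventuallyEq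
      hev).contDiffWithinAt

/-! ### Focal radii -/

theorem curvature_eq (i : Fin K.m) (s : ℝ) : K.curvature i s = ‖K.curvVec (K.point i s)‖ := by
  rw [curvature, curvVec_point, iteratedDeriv_succ, iteratedDeriv_one]

theorem focalSign_eq (i : Fin K.m) (s : ℝ) :
    K.focalSign μ i s = K.slope₂ μ (K.point i s)
      + 1 / 4 * ‖K.curvVec (K.point i s)‖ ^ 2 * μ (K.point i s) := by
  rw [focalSign, curvature_eq, slope₂_point, iteratedDeriv_succ, iteratedDeriv_one]

theorem focalValue_eq (h : K.IsWeight 2 μ) (i : Fin K.m) (s : ℝ) :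
    K.focalValue μ i s = K.slope μ (K.point i s) ^ 2 + μ (K.point i s) * K.slope₂ μ (K.point i s)
      + 1 / 2 * ‖K.curvVec (K.point i s)‖ ^ 2 * μ (K.point i s) ^ 2
      + ‖K.curvVec (K.point i s)‖ * μ (K.point i s) * √(μ (K.point i s) * K.focalSign μ i s) := by
  have h1 : deriv (fun t => μ (K.point i t) ^ 2) =
      fun t => 2 * μ (K.point i t) * deriv (fun t => μ (K.point i t)) t := by
    funext t
    rw [((h.hasDerivAt i t).fun_pow 2).deriv]
    norm_num
  have h2 := ((h.hasDerivAt i s).const_mul 2).mul (h.hasDerivAt_deriv i s)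
  rw [focalValue, curvature_eq, iteratedDeriv_succ, iteratedDeriv_one, h1, slope_point,
    slope₂_point]
  rw [show deriv (fun t => 2 * μ (K.point i t) * deriv (fun t => μ (K.point i t)) t) s = _ from
    h2.deriv]
  ring

theorem focalValue_eq_sq (h : K.IsWeight 2 μ) {i : Fin K.m} {s : ℝ}
    (hs : 0 ≤ K.focalSign μ i s) :
    K.focalValue μ i s = K.slope μ (K.point i s) ^ 2 +
      (μ (K.point i s) * ‖K.curvVec (K.point i s)‖ / 2 +
        √(μ (K.point i s) * K.focalSign μ i s)) ^ 2 := by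
  have h1 := Real.sq_sqrt (mul_nonneg (h.1 (K.point i s)).le hs)
  rw [focalValue_eq h, add_sq, h1, focalSign_eq]
  ring

/-- The left side is `hess` for a vector of length R in the direction of γ''. The variable y = √(1 -
b²R²)/R decreases in R, so the first zero in R is the larger root in y; by `focalValue_eq_sq` it is
the R with Λ R² = 1. -/
theorem focal_identity {a b m k R : ℝ} (hR : 0 < R) (hb : b ^ 2 * R ^ 2 ≤ 1) :
    1 - m * √(1 - b ^ 2 * R ^ 2) * (R * k) - R ^ 2 * (m * a + b ^ 2) =
      R ^ 2 * ((√(1 - b ^ 2 * R ^ 2) / R - m * k / 2) ^ 2 - m * (a + 1 / 4 * k ^ 2 * m)) := by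
  have h1 := Real.sq_sqrt (sub_nonneg.2 hb)
  field_simp
  linear_combination (-16 : ℝ) * h1

/-- `exp^μ` is nondegenerate below the focal radius. -/
theorem hess_pos (h : K.IsWeight 2 μ) {i : Fin K.m} {s : ℝ} {w : EuclideanSpace ℝ (Fin n)}
    (hs : |K.slope μ (K.point i s)| * ‖w‖ < 1)
    (hΛ : 0 ≤ K.focalSign μ i s → K.focalValue μ i s * ‖w‖ ^ 2 < 1) :
    0 < K.hess μ (K.point i s, w) := by
  rcases (norm_nonneg w).eq_or_lt with h0 | h0
  · rw [norm_eq_zero.1 h0.symm, hess_zero]; exact one_pos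
  have hμ := h.1 (K.point i s)
  have hb := slope_sq_mul_lt h0.le hs
  -- By Cauchy-Schwarz, `hess` is smallest in the direction of γ''.
  have hle : 1 - μ (K.point i s) * √(1 - K.slope μ (K.point i s) ^ 2 * ‖w‖ ^ 2) *
      (‖w‖ * ‖K.curvVec (K.point i s)‖) - ‖w‖ ^ 2 * (μ (K.point i s) * K.slope₂ μ (K.point i s) +
      K.slope μ (K.point i s) ^ 2) ≤ K.hess μ (K.point i s, w) := by
    unfold hess
    gcongr
    exact real_inner_le_norm _ _
  refine lt_of_lt_of_le ?_ hle
  rw [focal_identity h0 hb.le, ← focalSign_eq]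
  set y := √(1 - K.slope μ (K.point i s) ^ 2 * ‖w‖ ^ 2) / ‖w‖ with hy
  have hy0 : 0 ≤ y := by positivity
  have hy2 : y ^ 2 * ‖w‖ ^ 2 = 1 - K.slope μ (K.point i s) ^ 2 * ‖w‖ ^ 2 := by
    rw [hy, div_pow, Real.sq_sqrt (by linarith)]
    field_simp
  refine mul_pos (by positivity) ?_
  -- A negative sign leaves no real root in y; otherwise the bound on Λ places y above the larger
  -- root.
  rcases lt_or_ge (K.focalSign μ i s) 0 with hφ | hφ
  · have := mul_neg_of_pos_of_neg hμ hφ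
    nlinarith [sq_nonneg (y - μ (K.point i s) * ‖K.curvVec (K.point i s)‖ / 2)]
  · have h1 := hΛ hφ
    rw [focalValue_eq_sq h hφ] at h1
    set z := √(μ (K.point i s) * K.focalSign μ i s) with hz
    have hz0 : 0 ≤ z := Real.sqrt_nonneg _
    have hz2 : z ^ 2 = μ (K.point i s) * K.focalSign μ i s := Real.sq_sqrt (by positivity)
    have h2 : (μ (K.point i s) * ‖K.curvVec (K.point i s)‖ / 2 + z) ^ 2 * ‖w‖ ^ 2 <
        y ^ 2 * ‖w‖ ^ 2 := by linarith
    have h3 := lt_of_mul_lt_mul_right h2 (by positivity)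
    have h4 := lt_of_pow_lt_pow_left₀ 2 hy0 h3
    rw [← hz2]
    nlinarith

variable (K) in
theorem exists_unit_normal_curvVec (q : K.carrier) : ∃ u : EuclideanSpace ℝ (Fin n), ‖u‖ = 1 ∧
    inner ℝ (K.tangent q) u = 0 ∧ inner ℝ u (K.curvVec q) = ‖K.curvVec q‖ := by
  rcases eq_or_ne (K.curvVec q) 0 with h0 | h0
  · obtain ⟨u, h1, h2⟩ := K.exists_unit_normal q
    exact ⟨u, h1, h2, by simp [h0]⟩
  · have hn : ‖K.curvVec q‖ ≠ 0 := norm_ne_zero_iff.2 h0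
    refine ⟨‖K.curvVec q‖⁻¹ • K.curvVec q, ?_, ?_, ?_⟩
    · rw [norm_smul, norm_inv, norm_norm, inv_mul_cancel₀ hn]
    · rw [inner_smul_right, inner_tangent_curvVec, mul_zero]
    · rw [inner_smul_left, real_inner_self_eq_norm_sq]
      simp only [RCLike.conj_to_real]
      field_simp

/-- Inverts the substitution: R = (μ'² + y²)^(-1/2) is the length belonging to y, and the hypothesis
says that R < r. -/
theorem exists_hess_eq {r : ℝ} (hr : 0 < r) (i : Fin K.m) (s : ℝ) {y : ℝ} (hy : 0 ≤ y)
    (hyr : 1 < (K.slope μ (K.point i s) ^ 2 + y ^ 2) * r ^ 2) :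
    ∃ x ∈ K.normalDisc r, ∃ R : ℝ, 0 < R ∧ K.hess μ x =
      R ^ 2 * ((y - μ (K.point i s) * ‖K.curvVec (K.point i s)‖ / 2) ^ 2 -
        μ (K.point i s) * K.focalSign μ i s) := by
  obtain ⟨u, hu1, hu2, hu3⟩ := K.exists_unit_normal_curvVec (K.point i s)
  set b := K.slope μ (K.point i s)
  have hpos : 0 < b ^ 2 + y ^ 2 := by
    by_contra! hneg
    nlinarith [sq_nonneg r, mul_nonneg (sub_nonneg.2 hneg) (sq_nonneg r)]
  set R := (√(b ^ 2 + y ^ 2))⁻¹ with hR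
  have hR0 : 0 < R := inv_pos.2 (Real.sqrt_pos.2 hpos)
  have hR2 : R ^ 2 * (b ^ 2 + y ^ 2) = 1 := by
    rw [hR, inv_pow, Real.sq_sqrt hpos.le, inv_mul_cancel₀ hpos.ne']
  have hRr : R < r := by
    refine lt_of_pow_lt_pow_left₀ 2 hr.le ?_
    refine lt_of_mul_lt_mul_right ?_ hpos.le
    rw [hR2]
    linarith
  have hnorm : ‖R • u‖ = R := by rw [norm_smul, hu1, mul_one, Real.norm_of_nonneg hR0.le]
  have hsq : √(1 - b ^ 2 * R ^ 2) = R * y := by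
    rw [show 1 - b ^ 2 * R ^ 2 = (R * y) ^ 2 by linear_combination (-1 : ℝ) * hR2]
    exact Real.sqrt_sq (by positivity)
  refine ⟨(K.point i s, R • u), mem_normalDisc.2
    ⟨by rw [inner_smul_right, hu2, mul_zero], by rwa [hnorm]⟩, R, hR0, ?_⟩
  have hb : b ^ 2 * R ^ 2 ≤ 1 := by nlinarith [mul_nonneg (sq_nonneg R) (sq_nonneg y)]
  have hid := focal_identity (a := K.slope₂ μ (K.point i s)) (m := μ (K.point i s))
    (k := ‖K.curvVec (K.point i s)‖) hR0 hb
  rw [focalSign_eq]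
  rw [hsq, mul_div_cancel_left₀ _ hR0.ne'] at hid
  rw [← hid]
  simp only [hess, hnorm, inner_smul_left, hu3, RCLike.conj_to_real]
  rw [show K.slope μ (K.point i s) = b from rfl, hsq]

/-- If Λ r² > 1, some y strictly between the vertex of the parabola and its larger root still gives
a vector in D(r), and `hess` is negative there. The strict sign condition is what separates the
vertex from the root. -/
theorem focalValue_le_of_hess_nonneg (h : K.IsWeight 2 μ) {r : ℝ} (hr : 0 < r)
    (hH : ∀ x ∈ K.normalDisc r, 0 ≤ K.hess μ x) {i : Fin K.m} {s : ℝ}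
    (hφ : 0 < K.focalSign μ i s) : K.focalValue μ i s * r ^ 2 ≤ 1 := by
  by_contra! hlt
  have hμ := h.1 (K.point i s)
  rw [focalValue_eq_sq h hφ.le] at hlt
  set z := √(μ (K.point i s) * K.focalSign μ i s) with hz
  have hz0 : 0 < z := Real.sqrt_pos.2 (by positivity)
  have hz2 : z ^ 2 = μ (K.point i s) * K.focalSign μ i s := Real.sq_sqrt (by positivity)
  set c := μ (K.point i s) * ‖K.curvVec (K.point i s)‖ / 2 with hc
  have hc0 : 0 ≤ c := by positivity
  have hev : ∀ᶠ t in 𝓝[<] z, 1 < (K.slope μ (K.point i s) ^ 2 + (c + t) ^ 2) * r ^ 2 := by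
    have hcont : Continuous fun t => (K.slope μ (K.point i s) ^ 2 + (c + t) ^ 2) * r ^ 2 := by
      fun_prop
    exact (hcont.continuousAt.eventually_const_lt hlt).filter_mono nhdsWithin_le_nhds
  obtain ⟨t, ht, ht0, htz⟩ := (hev.and (Ioo_mem_nhdsLT hz0)).exists
  obtain ⟨x, hx, R, hR, he⟩ := exists_hess_eq hr i s (by positivity : 0 ≤ c + t) ht
  have := hH x hx
  rw [he, ← hz2, ← hc, add_sub_cancel_left] at this
  have h1 : t ^ 2 < z ^ 2 := pow_lt_pow_left₀ htz ht0.le two_ne_zero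
  nlinarith [mul_pos (pow_pos hR 2) (sub_pos.2 h1)]

/-- Here the larger root itself is used, so a double root is enough. -/
theorem focalValue_le_of_hess_ne_zero (h : K.IsWeight 2 μ) {r : ℝ} (hr : 0 < r)
    (hH : ∀ x ∈ K.normalDisc r, K.hess μ x ≠ 0) {i : Fin K.m} {s : ℝ}
    (hφ : 0 ≤ K.focalSign μ i s) : K.focalValue μ i s * r ^ 2 ≤ 1 := by
  by_contra! hlt
  have hμ := h.1 (K.point i s)
  rw [focalValue_eq_sq h hφ] at hlt
  obtain ⟨x, hx, R, hR, he⟩ := exists_hess_eq hr i s (by positivity) hlt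
  refine hH x hx ?_
  rw [he, add_sub_cancel_left, Real.sq_sqrt (by positivity), sub_self, mul_zero]

theorem continuous_focalSign (h : K.IsWeight 2 μ) (i : Fin K.m) :
    Continuous (K.focalSign μ i) := by
  have h1 := h.continuous
  have h2 := h.continuous_slope₂
  have h3 := K.continuous_curvVec
  have h4 := K.continuous_point i
  rw [funext (focalSign_eq (μ := μ) i)]
  fun_prop

theorem continuous_focalValue (h : K.IsWeight 2 μ) (i : Fin K.m) :
    Continuous (K.focalValue μ i) := by
  have h1 := h.continuous
  have h2 := h.continuous_slope₂
  have h3 := K.continuous_curvVec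
  have h4 := K.continuous_point i
  have h5 := h.continuous_slope
  have h6 := continuous_focalSign h i
  rw [funext (focalValue_eq h i)]
  fun_prop

theorem bddAbove_image_of_periodic {f : ℝ → ℝ} {c : ℝ} (hc : 0 < c) (hf : Continuous f)
    (hp : Function.Periodic f c) (A : Set ℝ) : BddAbove (f '' A) := by
  obtain ⟨M, hM⟩ := (isCompact_Icc.image hf (s := Set.Icc 0 c)).bddAbove
  refine ⟨M, ?_⟩
  rintro _ ⟨s, -, rfl⟩
  obtain ⟨t, ht, h⟩ := hp.exists_mem_Ico₀ hc s
  rw [h]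
  exact hM ⟨t, ⟨ht.1, ht.2.le⟩, rfl⟩

theorem bddAbove_focalValue (h : K.IsWeight 2 μ) (i : Fin K.m) (A : Set ℝ) :
    BddAbove (K.focalValue μ i '' A) := by
  refine bddAbove_image_of_periodic (K.len_pos i) (continuous_focalValue h i) ?_ A
  intro s
  simp only [focalValue_eq h, focalSign_eq, K.point_periodic i s]

theorem bddAbove_slope (h : K.IsWeight 2 μ) (i : Fin K.m) :
    BddAbove (Set.range fun s => |deriv (fun t => μ (K.point i t)) s| ^ 2) := by
  rw [← Set.image_univ]
  refine bddAbove_image_of_periodic (K.len_pos i) ?_ ?_ _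
  · have := (h.contDiff_deriv i).continuous
    fun_prop
  · exact (periodic_deriv (K.periodic_weight μ i)).comp fun x => |x| ^ 2

variable (K) in
-- A unit speed curve without curvature is a straight line and does not close up.
theorem exists_curvVec_ne_zero (i : Fin K.m) : ∃ s, K.curvVec (K.point i s) ≠ 0 := by
  by_contra! h0
  simp only [curvVec_point] at h0
  have hc : ∀ s, deriv (K.γ i) s = deriv (K.γ i) 0 := fun s =>
    is_const_of_deriv_eq_zero ((K.contDiff_deriv_γ i).differentiable (by norm_num)) h0 s 0
  have hd : ∀ s, HasDerivAt (fun s => K.γ i s - s • deriv (K.γ i) 0) 0 s := by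
    intro s
    have := (K.hasDerivAt_γ i s).sub ((hasDerivAt_id s).smul_const (deriv (K.γ i) 0))
    rw [hc s, one_smul, sub_self] at this
    exact this
  have h1 := is_const_of_deriv_eq_zero (fun s => (hd s).differentiableAt)
    (fun s => (hd s).deriv) (K.len i) 0
  have hper : K.γ i (K.len i) = K.γ i 0 := by simpa using K.periodic i 0
  rw [hper, zero_smul, sub_zero, sub_eq_self, smul_eq_zero] at h1
  rcases h1 with h1 | h1
  · exact (K.len_pos i).ne' h1
  · have := K.unit_speed i 0
    rw [h1, norm_zero] at this
    exact zero_ne_one this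

/-- The maximum in the definition of the focal radii is positive. -/
theorem focal_max_pos (h : K.IsWeight 2 μ) (i : Fin K.m) {A : Set ℝ}
    (hA : {s | 0 < K.focalSign μ i s} ⊆ A) :
    0 < max (sSup (K.focalValue μ i '' A))
      (sSup (Set.range fun s => |deriv (fun t => μ (K.point i t)) s| ^ 2)) := by
  rw [lt_max_iff]
  by_cases h0 : ∃ s, deriv (fun t => μ (K.point i t)) s ≠ 0
  · obtain ⟨s, hs⟩ := h0
    right
    exact (pow_pos (abs_pos.2 hs) 2).trans_le (le_csSup (bddAbove_slope h i) ⟨s, rfl⟩)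
  · push Not at h0
    left
    obtain ⟨s, hs⟩ := K.exists_curvVec_ne_zero i
    have hκ := norm_pos_iff.2 hs
    have hμ := h.1 (K.point i s)
    have h2 : K.slope₂ μ (K.point i s) = 0 := by
      rw [slope₂_point, show deriv (fun t => μ (K.point i t)) = fun _ => 0 from funext h0]
      simp
    have hφ : 0 < K.focalSign μ i s := by
      rw [focalSign_eq, h2]; positivity
    refine lt_of_lt_of_le ?_ (le_csSup (bddAbove_focalValue h i A) ⟨s, hA hφ, rfl⟩)
    rw [focalValue_eq_sq h hφ.le]
    positivity

/-- Positivity of X matters: the real power of 0 is 0 here, not infinity. -/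
theorem le_rpow_neg_half {X r : ℝ} (hr : 0 < r) (hX : 0 < X) (h : X * r ^ 2 ≤ 1) :
    r ≤ X ^ (-(1 / 2) : ℝ) := by
  rw [Real.rpow_neg hX.le, ← Real.sqrt_eq_rpow, le_inv_comm₀ hr (Real.sqrt_pos.2 hX),
    Real.sqrt_le_left (by positivity), inv_pow, ← one_div, le_div_iff₀ (by positivity)]
  exact h

theorem mul_sq_lt_one_of_lt_rpow {X r : ℝ} (hr : 0 < r) (hX : 0 < X)
    (h : r < X ^ (-(1 / 2) : ℝ)) : X * r ^ 2 < 1 := by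
  rw [Real.rpow_neg hX.le, ← Real.sqrt_eq_rpow, lt_inv_comm₀ hr (Real.sqrt_pos.2 hX),
    Real.sqrt_lt' (by positivity), inv_pow, ← one_div, lt_div_iff₀ (by positivity)] at h
  exact h

/-- A is {≥ 0} for FocRad⁰ and {> 0} for FocRad⁻. If it is empty its supremum is 0, which is
harmless next to the nonnegative slope term. -/
theorem le_focal_rpow (h : K.IsWeight 2 μ) {r : ℝ} (hr : 0 < r)
    (hs : ∀ q, |K.slope μ q| * r ≤ 1) {i : Fin K.m} {A : Set ℝ}
    (hA : {s | 0 < K.focalSign μ i s} ⊆ A) (hΛ : ∀ s ∈ A, K.focalValue μ i s * r ^ 2 ≤ 1) :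
    r ≤ (max (sSup (K.focalValue μ i '' A))
      (sSup (Set.range fun s => |deriv (fun t => μ (K.point i t)) s| ^ 2))) ^ (-(1 / 2) : ℝ) := by
  refine le_rpow_neg_half hr (focal_max_pos h i hA) ?_
  rw [← le_div_iff₀ (by positivity)]
  refine max_le (Real.sSup_le ?_ (by positivity)) (Real.sSup_le ?_ (by positivity))
  · rintro _ ⟨s, hsA, rfl⟩
    rw [le_div_iff₀ (by positivity)]
    exact hΛ s hsA
  · rintro _ ⟨s, rfl⟩
    rw [le_div_iff₀ (by positivity), ← mul_pow, ← slope_point]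
    exact pow_le_one₀ (by positivity) (hs _)

theorem focalSign_pos_subset {i : Fin K.m} :
    {s | 0 < K.focalSign μ i s} ⊆ {s | 0 ≤ K.focalSign μ i s} := by
  intro s hs
  simp only [Set.mem_ofPred_eq] at hs ⊢
  exact hs.le

theorem le_focRadZero (h : K.IsWeight 2 μ) {r : ℝ} (hr : 0 < r)
    (hs : ∀ q, |K.slope μ q| * r ≤ 1) (hH : ∀ x ∈ K.normalDisc r, K.hess μ x ≠ 0) :
    (r : EReal) ≤ K.focRadZero μ :=
  le_iInf fun _ => EReal.coe_le_coe_iff.2 (le_focal_rpow h hr hs focalSign_pos_subset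
    fun _ hsA => focalValue_le_of_hess_ne_zero h hr hH hsA)

theorem le_focRadMinus (h : K.IsWeight 2 μ) {r : ℝ} (hr : 0 < r)
    (hs : ∀ q, |K.slope μ q| * r ≤ 1) (hH : ∀ x ∈ K.normalDisc r, 0 ≤ K.hess μ x) :
    (r : EReal) ≤ K.focRadMinus μ :=
  le_iInf fun _ => EReal.coe_le_coe_iff.2 (le_focal_rpow h hr hs subset_rfl
    fun _ hsA => focalValue_le_of_hess_nonneg h hr hH hsA)

theorem zero_le_focRadZero : 0 ≤ K.focRadZero μ := by
  refine le_iInf fun i => EReal.coe_nonneg.2 (Real.rpow_nonneg (le_max_of_le_right ?_) _)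
  exact Real.sSup_nonneg (by rintro _ ⟨s, rfl⟩; positivity)

theorem zero_le_focRadMinus : 0 ≤ K.focRadMinus μ := by
  refine le_iInf fun i => EReal.coe_nonneg.2 (Real.rpow_nonneg (le_max_of_le_right ?_) _)
  exact Real.sSup_nonneg (by rintro _ ⟨s, rfl⟩; positivity)

theorem of_lt_focal_rpow (h : K.IsWeight 2 μ) {r : ℝ} (hr : 0 < r) {i : Fin K.m} {A : Set ℝ}
    (hA : {s | 0 < K.focalSign μ i s} ⊆ A)
    (hlt : r < (max (sSup (K.focalValue μ i '' A))
      (sSup (Set.range fun s => |deriv (fun t => μ (K.point i t)) s| ^ 2))) ^ (-(1 / 2) : ℝ)) :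
    (∀ s, |K.slope μ (K.point i s)| * r < 1) ∧
      ∃ c, c * r ^ 2 < 1 ∧ ∀ s ∈ A, K.focalValue μ i s ≤ c := by
  have hX := mul_sq_lt_one_of_lt_rpow hr (focal_max_pos h i hA) hlt
  refine ⟨fun s => ?_, _, hX, fun s hs =>
    le_max_of_le_left (le_csSup (bddAbove_focalValue h i A) ⟨s, hs, rfl⟩)⟩
  have h1 := le_max_of_le_right (b := sSup (K.focalValue μ i '' A))
    (le_csSup (bddAbove_slope h i) ⟨s, rfl⟩)
  beta_reduce at h1
  rw [slope_point]
  have h2 := (mul_le_mul_of_nonneg_right h1 (sq_nonneg r)).trans_lt hX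
  rw [← mul_pow] at h2
  exact lt_of_pow_lt_pow_left₀ 2 zero_le_one (by simpa using h2)

theorem of_lt_focRadZero (h : K.IsWeight 2 μ) {r : ℝ} (hr : 0 < r)
    (hlt : (r : EReal) < K.focRadZero μ) :
    (∀ q, |K.slope μ q| * r < 1) ∧
      ∀ i s, 0 ≤ K.focalSign μ i s → K.focalValue μ i s * r ^ 2 < 1 := by
  have hi : ∀ i, _ := fun i => of_lt_focal_rpow h hr
    (A := {s | 0 ≤ K.focalSign μ i s}) focalSign_pos_subset
    (EReal.coe_lt_coe_iff.1 (hlt.trans_le (iInf_le _ i)))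
  refine ⟨fun q => ?_, fun i s hs => ?_⟩
  · obtain ⟨i, s, rfl⟩ := K.exists_point q
    exact (hi i).1 s
  · obtain ⟨c, hc, hA⟩ := (hi i).2
    exact (mul_le_mul_of_nonneg_right (hA s hs) (sq_nonneg r)).trans_lt hc

/-- The uniform bound c, rather than a pointwise inequality, leaves the margin needed when μ is
replaced by μ - ε. -/
theorem of_lt_focRadMinus (h : K.IsWeight 2 μ) {r : ℝ} (hr : 0 < r)
    (hlt : (r : EReal) < K.focRadMinus μ) :
    (∀ q, |K.slope μ q| * r < 1) ∧
      ∀ i, ∃ c, c * r ^ 2 < 1 ∧ ∀ s, 0 < K.focalSign μ i s → K.focalValue μ i s ≤ c := by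
  have hi : ∀ i, _ := fun i => of_lt_focal_rpow h hr
    (A := {s | 0 < K.focalSign μ i s}) subset_rfl
    (EReal.coe_lt_coe_iff.1 (hlt.trans_le (iInf_le _ i)))
  refine ⟨fun q => ?_, fun i => (hi i).2⟩
  obtain ⟨i, s, rfl⟩ := K.exists_point q
  exact (hi i).1 s

/-! ### Uniqueness of critical points below the double critical distance -/

/-- Nondegenerate critical points are locally unique. -/
theorem eventually_crit_unique (h : K.IsWeight 2 μ) {q : K.carrier}
    {w : EuclideanSpace ℝ (Fin n)} (hw : inner ℝ (K.tangent q) w = 0)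
    (hs : |K.slope μ q| * ‖w‖ ≤ 1) (hH : K.hess μ (q, w) ≠ 0) :
    ∀ᶠ x : EuclideanSpace ℝ (Fin n) × K.carrier × K.carrier in 𝓝 (K.expMap μ (q, w), q, q),
      K.crit μ x.1 x.2.1 = 0 → K.crit μ x.1 x.2.2 = 0 → x.2.1 = x.2.2 := by
  obtain ⟨i, s, rfl⟩ := K.exists_point q
  obtain ⟨S, -, -, -, hS⟩ := exists_critical_section h hw hs hH
  set p := K.expMap μ (K.point i s, w)
  have hev : ∀ᶠ y : EuclideanSpace ℝ (Fin n) × K.carrier in 𝓝 (p, K.point i s),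
      K.crit μ y.1 y.2 = 0 → K.point i (S y.1) = y.2 := by
    have hmap : 𝓝 (p, K.point i s) = map (Prod.map id (K.point i)) (𝓝 (p, s)) := by
      rw [nhds_prod_eq, nhds_prod_eq, ← K.map_nhds_point, ← Filter.prod_map_map_eq', map_id]
    rw [hmap, eventually_map]
    filter_upwards [hS] with v hv hv0
    simp only [Prod.map_fst, Prod.map_snd, id_eq] at hv0 ⊢
    rw [hv hv0]
  have c1 : Tendsto (fun x : EuclideanSpace ℝ (Fin n) × K.carrier × K.carrier => (x.1, x.2.1))
      (𝓝 (p, K.point i s, K.point i s)) (𝓝 (p, K.point i s)) :=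
    Continuous.tendsto (by fun_prop) (p, K.point i s, K.point i s)
  have c2 : Tendsto (fun x : EuclideanSpace ℝ (Fin n) × K.carrier × K.carrier => (x.1, x.2.2))
      (𝓝 (p, K.point i s, K.point i s)) (𝓝 (p, K.point i s)) :=
    Continuous.tendsto (by fun_prop) (p, K.point i s, K.point i s)
  filter_upwards [c1.eventually hev, c2.eventually hev] with x h1 h2 h3 h4
  exact (h1 h3).symm.trans (h2 h4)

/-- A nondegenerate critical point persists when `p` moves, and its value decreases if `p` moves
towards it. -/
theorem eventually_exists_crit (h : K.IsWeight 2 μ) {q : K.carrier}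
    {w v : EuclideanSpace ℝ (Fin n)} (hw : inner ℝ (K.tangent q) w = 0)
    (hs : |K.slope μ q| * ‖w‖ ≤ 1) (hH : K.hess μ (q, w) ≠ 0) {N : Set K.carrier} (hN : N ∈ 𝓝 q)
    {c : ℝ} (hc : wdist μ (K.expMap μ (q, w)) q < c ∨
      wdist μ (K.expMap μ (q, w)) q ≤ c ∧ inner ℝ (K.expMap μ (q, w) - q) v < 0) :
    ∀ᶠ τ : ℝ in 𝓝[>] 0, ∃ q' ∈ N, K.crit μ (K.expMap μ (q, w) + τ • v) q' = 0 ∧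
      wdist μ (K.expMap μ (q, w) + τ • v) q' < c := by
  obtain ⟨i, s, rfl⟩ := K.exists_point q
  obtain ⟨S, h1, h2, h3, -⟩ := exists_critical_section h hw hs hH
  set p := K.expMap μ (K.point i s, w)
  have hμ := h.1 (K.point i s)
  have hG := hasFDerivAt_wdist_section h h1 h3.self_of_nhds
  have hline : HasDerivAt (fun τ : ℝ => p + τ • v) v 0 := by
    simpa using ((hasDerivAt_id (0 : ℝ)).smul_const v).const_add p
  have hp0 : p + (0 : ℝ) • v = p := by simp
  have htend : Tendsto (fun τ : ℝ => p + τ • v) (𝓝[>] 0) (𝓝 p) := by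
    have := hline.continuousAt.tendsto
    rw [hp0] at this
    exact this.mono_left nhdsWithin_le_nhds
  have hq : ContinuousAt (fun x => K.point i (S x)) p :=
    (K.continuous_point i).continuousAt.comp h1.continuousAt
  have hN' : ∀ᶠ x in 𝓝 p, K.point i (S x) ∈ N := hq (by simp only [h2]; exact hN)
  have hval : ∀ᶠ τ : ℝ in 𝓝[>] 0, wdist μ (p + τ • v) (K.point i (S (p + τ • v))) < c := by
    -- A strict inequality persists by continuity; in the other case the envelope formula gives a
    -- negative one-sided derivative.
    rcases hc with hc | ⟨hc, hv⟩
    · have := htend.eventually (hG.continuousAt.eventually_lt_const (u := c)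
        (by simp only [h2]; exact hc))
      exact this
    · have hGl : HasDerivAt (fun τ : ℝ => wdist μ (p + τ • v) (K.point i (S (p + τ • v))))
          (2 / μ (K.point i s) ^ 2 * inner ℝ (p - K.point i s) v) 0 := by
        have hG' := hG
        rw [← hp0] at hG'
        have := HasFDerivAt.comp_hasDerivAt (0 : ℝ) hG' hline
        simpa [hp0, h2, Function.comp_def, inner_sub_left] using this
      have hneg : 2 / μ (K.point i s) ^ 2 * inner ℝ (p - K.point i s) v < 0 :=
        mul_neg_of_pos_of_neg (by positivity) hv
      have hsl := hGl.tendsto_slope_zero_right.eventually_lt_const hneg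
      filter_upwards [hsl, self_mem_nhdsWithin] with τ hτ hτ0
      have hτ0' : (0 : ℝ) < τ := hτ0
      simp only [zero_add, hp0, h2, smul_eq_mul] at hτ
      have : wdist μ (p + τ • v) (K.point i (S (p + τ • v))) - wdist μ p (K.point i s) < 0 := by
        by_contra! hge
        exact absurd hτ (not_lt.2 (mul_nonneg (inv_nonneg.2 hτ0'.le) hge))
      linarith
  filter_upwards [htend.eventually h3, htend.eventually hN', hval] with τ a1 a2 a3
  exact ⟨_, a2, a1, a3⟩

/-- Among all triples (p, q₁, q₂) of a point with two distinct critical points of value at most r²,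
take one whose larger value is minimal. If no motion of p lowers it, then p divides the segment q₁q₂
in the ratio of the weights, and the pair is double critical with quotient at most r. -/
theorem crit_unique (h : K.IsWeight 2 μ) {r : ℝ} (hr : 0 < r) (hs : ∀ q, |K.slope μ q| * r < 1)
    (hH : ∀ q w, inner ℝ (K.tangent q) w = 0 → ‖w‖ ≤ r → K.hess μ (q, w) ≠ 0)
    (hdc : ∀ q₁ q₂, K.IsDoubleCriticalPair μ q₁ q₂ →
      r < ‖(q₁ : EuclideanSpace ℝ (Fin n)) - q₂‖ / (μ q₁ + μ q₂))
    {p : EuclideanSpace ℝ (Fin n)} {q₁ q₂ : K.carrier} (h₁ : K.crit μ p q₁ = 0)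
    (h₂ : K.crit μ p q₂ = 0) (hr₁ : wdist μ p q₁ ≤ r ^ 2) (hr₂ : wdist μ p q₂ ≤ r ^ 2) :
    q₁ = q₂ := by
  by_contra hne
  have hlog : ∀ p q, K.crit μ p q = 0 → wdist μ p q ≤ r ^ 2 →
      ∃ w, inner ℝ (K.tangent q) w = 0 ∧ |K.slope μ q| * ‖w‖ ≤ 1 ∧ K.hess μ (q, w) ≠ 0 ∧
        K.expMap μ (q, w) = p := by
    intro p q hc hv
    have hμ := h.1 q
    rw [wdist, ← div_pow] at hv
    have h1 : ‖p - q‖ / μ q ≤ r := le_of_sq_le_sq hv hr.le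
    have h2 : |K.slope μ q| * (‖p - q‖ / μ q) < 1 :=
      (mul_le_mul_of_nonneg_left h1 (abs_nonneg _)).trans_lt (hs q)
    have h3 := norm_logVec hμ hc h2
    exact ⟨_, inner_tangent_logVec p q, by rw [h3]; exact h2.le,
      hH q _ (inner_tangent_logVec p q) (by rwa [h3]), expMap_logVec hμ hc h2⟩
  set A : Set (EuclideanSpace ℝ (Fin n) × K.carrier × K.carrier) :=
    {x | (K.crit μ x.1 x.2.1 = 0 ∧ K.crit μ x.1 x.2.2 = 0) ∧
      (wdist μ x.1 x.2.1 ≤ r ^ 2 ∧ wdist μ x.1 x.2.2 ≤ r ^ 2)} with hA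
  set X := A ∩ {x | x.2.1 ≠ x.2.2} with hX
  have cw1 : Continuous fun x : EuclideanSpace ℝ (Fin n) × K.carrier × K.carrier =>
      wdist μ x.1 x.2.1 :=
    Continuous.comp (g := fun x : EuclideanSpace ℝ (Fin n) × K.carrier => wdist μ x.1 x.2)
      (f := fun x : EuclideanSpace ℝ (Fin n) × K.carrier × K.carrier => (x.1, x.2.1))
      (continuous_wdist h) (by fun_prop)
  have cw2 : Continuous fun x : EuclideanSpace ℝ (Fin n) × K.carrier × K.carrier =>
      wdist μ x.1 x.2.2 :=
    Continuous.comp (g := fun x : EuclideanSpace ℝ (Fin n) × K.carrier => wdist μ x.1 x.2)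
      (f := fun x : EuclideanSpace ℝ (Fin n) × K.carrier × K.carrier => (x.1, x.2.2))
      (continuous_wdist h) (by fun_prop)
  have cc1 : Continuous fun x : EuclideanSpace ℝ (Fin n) × K.carrier × K.carrier =>
      K.crit μ x.1 x.2.1 :=
    Continuous.comp (g := fun x : EuclideanSpace ℝ (Fin n) × K.carrier => K.crit μ x.1 x.2)
      (f := fun x : EuclideanSpace ℝ (Fin n) × K.carrier × K.carrier => (x.1, x.2.1))
      (continuous_crit h) (by fun_prop)
  have cc2 : Continuous fun x : EuclideanSpace ℝ (Fin n) × K.carrier × K.carrier =>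
      K.crit μ x.1 x.2.2 :=
    Continuous.comp (g := fun x : EuclideanSpace ℝ (Fin n) × K.carrier => K.crit μ x.1 x.2)
      (f := fun x : EuclideanSpace ℝ (Fin n) × K.carrier × K.carrier => (x.1, x.2.2))
      (continuous_crit h) (by fun_prop)
  have hAc : IsClosed A :=
    ((isClosed_eq cc1 continuous_const).inter (isClosed_eq cc2 continuous_const)).inter
      ((isClosed_le cw1 continuous_const).inter (isClosed_le cw2 continuous_const))
  -- Two critical points could only be lost by merging, which local uniqueness at nondegenerate
  -- points excludes.
  have hXc : IsClosed X := by
    refine isClosed_of_closure_subset ?_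
    rintro ⟨p, q, q'⟩ hx
    have hxA : (p, q, q') ∈ A := hAc.closure_subset_iff.2 Set.inter_subset_left hx
    refine ⟨hxA, fun hqq => ?_⟩
    simp only at hqq
    subst hqq
    obtain ⟨w, w1, w2, w3, rfl⟩ := hlog p q hxA.1.1 hxA.2.1
    obtain ⟨y, hy, hyX⟩ := mem_closure_iff_nhds.1 hx _ (eventually_crit_unique h w1 w2 w3)
    exact hyX.2 (hy hyX.1.1.1 hyX.1.1.2)
  have hXk : IsCompact X := by
    have hbc : Continuous fun q : K.carrier => ‖(q : EuclideanSpace ℝ (Fin n))‖ + r * μ q := by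
      have := h.continuous
      fun_prop
    obtain ⟨B, hB⟩ := (isCompact_range hbc).bddAbove
    refine ((isCompact_closedBall (0 : EuclideanSpace ℝ (Fin n)) B).prod
      (isCompact_univ (X := K.carrier × K.carrier))).of_isClosed_subset hXc ?_
    rintro ⟨p, q, q'⟩ ⟨⟨-, hx, -⟩, -⟩
    refine ⟨mem_closedBall_zero_iff.2 ?_, Set.mem_univ _⟩
    simp only [wdist] at hx
    rw [← div_pow] at hx
    have h1 := (div_le_iff₀ (h.1 q)).1 (le_of_sq_le_sq hx hr.le)
    have h2 : ‖p‖ ≤ ‖p - q‖ + ‖(q : EuclideanSpace ℝ (Fin n))‖ := by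
      simpa using norm_add_le (p - q) (q : EuclideanSpace ℝ (Fin n))
    have h3 := hB ⟨q, rfl⟩
    simp only at h3 ⊢
    linarith
  obtain ⟨⟨p, q₁, q₂⟩, ⟨⟨⟨hc1, hc2⟩, hv1, hv2⟩, hne⟩, hmin⟩ := hXk.exists_isMinOn
    ⟨(p, q₁, q₂), ⟨⟨h₁, h₂⟩, hr₁, hr₂⟩, hne⟩ (cw1.max cw2).continuousOn
  simp only at hc1 hc2 hv1 hv2 hne
  set c := max (wdist μ p q₁) (wdist μ p q₂) with hcdef
  have hcr : c ≤ r ^ 2 := max_le hv1 hv2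
  obtain ⟨w₁, a1, a2, a3, a4⟩ := hlog p q₁ hc1 hv1
  obtain ⟨w₂, b1, b2, b3, b4⟩ := hlog p q₂ hc2 hv2
  obtain ⟨N₁, N₂, hN₁, hN₂, hqN₁, hqN₂, hdisj⟩ := t2_separation hne
  -- If v lowers every value that attains the maximum, a small move of p along v yields a better
  -- triple; the disjoint neighbourhoods keep the two critical points distinct.
  have improve : ∀ v, (wdist μ p q₁ < c ∨ wdist μ p q₁ ≤ c ∧ inner ℝ (p - q₁) v < 0) →
      (wdist μ p q₂ < c ∨ wdist μ p q₂ ≤ c ∧ inner ℝ (p - q₂) v < 0) → False := by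
    intro v hv₁ hv₂
    rw [← a4] at hv₁
    have e1 := eventually_exists_crit h a1 a2 a3 (hN₁.mem_nhds hqN₁) hv₁
    rw [← b4] at hv₂
    have e2 := eventually_exists_crit h b1 b2 b3 (hN₂.mem_nhds hqN₂) hv₂
    rw [a4] at e1
    rw [b4] at e2
    obtain ⟨τ, ⟨q₁', d1, d2, d3⟩, q₂', d4, d5, d6⟩ := (e1.and e2).exists
    have hmem : (p + τ • v, q₁', q₂') ∈ X :=
      ⟨⟨⟨d2, d5⟩, d3.le.trans hcr, d6.le.trans hcr⟩,
        fun hq => Set.disjoint_left.1 hdisj d1 (by simp only at hq; rwa [hq])⟩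
    have := hmin hmem
    simp only [Set.mem_ofPred_eq] at this
    exact absurd this (not_le.2 (max_lt d3 d6))
  have hμ₁ := h.1 q₁
  have hμ₂ := h.1 q₂
  rcases lt_trichotomy (wdist μ p q₁) (wdist μ p q₂) with hlt | heq | hlt
  -- Only the larger value has to decrease, so p moves straight towards its critical point.
  · refine improve (-(p - q₂)) (Or.inl (hlt.trans_le (le_max_right _ _)))
      (Or.inr ⟨le_max_right _ _, ?_⟩)
    have : 0 < wdist μ p q₂ := lt_of_le_of_lt (by unfold wdist; positivity) hlt
    rw [inner_neg_right, real_inner_self_eq_norm_sq, neg_lt_zero]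
    unfold wdist at this
    exact (div_pos_iff_of_pos_right (by positivity)).1 this
  · set x₁ := (μ q₁)⁻¹ • (p - q₁) with hx₁
    set x₂ := (μ q₂)⁻¹ • (p - q₂) with hx₂
    have hp₁ : p - q₁ = μ q₁ • x₁ := by rw [hx₁, smul_inv_smul₀ hμ₁.ne']
    have hp₂ : p - q₂ = μ q₂ • x₂ := by rw [hx₂, smul_inv_smul₀ hμ₂.ne']
    have hw₁ : wdist μ p q₁ = ‖x₁‖ ^ 2 := by
      rw [wdist, hp₁, norm_smul, Real.norm_of_nonneg hμ₁.le]; field_simp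
    have hw₂ : wdist μ p q₂ = ‖x₂‖ ^ 2 := by
      rw [wdist, hp₂, norm_smul, Real.norm_of_nonneg hμ₂.le]; field_simp
    have hnn : ‖x₂‖ ^ 2 = ‖x₁‖ ^ 2 := by rw [← hw₁, ← hw₂, heq]
    -- x₁ and x₂ have equal length, so -(x₁ + x₂) has negative inner product with both unless they
    -- are opposite.
    by_cases hx : x₁ + x₂ = 0
    · have hx' : x₂ = -x₁ := (neg_eq_of_add_eq_zero_right hx).symm
      have hqq : (q₁ : EuclideanSpace ℝ (Fin n)) - q₂ = -((μ q₁ + μ q₂) • x₁) := by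
        have : (q₁ : EuclideanSpace ℝ (Fin n)) - q₂ = (p - q₂) - (p - q₁) := by abel
        rw [this, hp₁, hp₂, hx']
        module
      have hnorm : ‖(q₁ : EuclideanSpace ℝ (Fin n)) - q₂‖ = (μ q₁ + μ q₂) * ‖x₁‖ := by
        rw [hqq, norm_neg, norm_smul, Real.norm_of_nonneg (by positivity)]
      have t1 : inner ℝ x₁ (K.tangent q₁) = -(‖x₁‖ ^ 2 * K.slope μ q₁) := by
        rw [crit, hp₁, inner_smul_left, norm_smul, Real.norm_of_nonneg hμ₁.le] at hc1
        simp only [RCLike.conj_to_real] at hc1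
        have : μ q₁ ^ 2 * (inner ℝ x₁ (K.tangent q₁) + ‖x₁‖ ^ 2 * K.slope μ q₁) = 0 := by
          linarith
        have := (mul_eq_zero.1 this).resolve_left (by positivity)
        linarith
      have t2 : inner ℝ x₁ (K.tangent q₂) = ‖x₁‖ ^ 2 * K.slope μ q₂ := by
        rw [crit, hp₂, inner_smul_left, norm_smul, Real.norm_of_nonneg hμ₂.le, hx',
          inner_neg_left, norm_neg] at hc2
        simp only [RCLike.conj_to_real] at hc2
        have : μ q₂ ^ 2 * (-inner ℝ x₁ (K.tangent q₂) + ‖x₁‖ ^ 2 * K.slope μ q₂) = 0 := by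
          linarith
        have := (mul_eq_zero.1 this).resolve_left (by positivity)
        linarith
      have hD : K.IsDoubleCriticalPair μ q₁ q₂ := by
        refine (isDoubleCriticalPair_iff h).2 ⟨hne, ?_, ?_⟩
        · rw [hnorm, hqq, inner_neg_left, inner_smul_left, t1]
          simp only [RCLike.conj_to_real]
          ring
        · rw [hnorm, hqq, inner_neg_left, inner_smul_left, t2]
          simp only [RCLike.conj_to_real]
          ring
      have := hdc q₁ q₂ hD
      rw [hnorm, mul_div_cancel_left₀ _ (by positivity)] at this
      rw [hw₁] at hv1
      exact absurd (le_of_sq_le_sq hv1 hr.le) (not_le.2 this)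
    · have hpos : 0 < ‖x₁‖ ^ 2 + inner ℝ x₁ x₂ := by
        have := norm_add_sq_real x₁ x₂
        have h3 : 0 < ‖x₁ + x₂‖ ^ 2 := by positivity
        linarith
      refine improve (-(x₁ + x₂)) (Or.inr ⟨le_max_left _ _, ?_⟩) (Or.inr ⟨le_max_right _ _, ?_⟩)
      · rw [hp₁, inner_neg_right, inner_smul_left, inner_add_right, real_inner_self_eq_norm_sq,
          neg_lt_zero]
        exact mul_pos hμ₁ hpos
      · rw [hp₂, inner_neg_right, inner_smul_left, inner_add_right, real_inner_self_eq_norm_sq,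
          neg_lt_zero, hnn, real_inner_comm, add_comm]
        exact mul_pos hμ₂ hpos
  · refine improve (-(p - q₁)) (Or.inr ⟨le_max_left _ _, ?_⟩)
      (Or.inl (hlt.trans_le (le_max_left _ _)))
    have : 0 < wdist μ p q₁ := lt_of_le_of_lt (by unfold wdist; positivity) hlt
    rw [inner_neg_right, real_inner_self_eq_norm_sq, neg_lt_zero]
    unfold wdist at this
    exact (div_pos_iff_of_pos_right (by positivity)).1 this

/-! ### The lower radius -/

theorem hess_pos_of_le (h : K.IsWeight 2 μ) {r : ℝ} (hs : ∀ q, |K.slope μ q| * r < 1)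
    (hΛ : ∀ i s, 0 ≤ K.focalSign μ i s → K.focalValue μ i s * r ^ 2 < 1) {q : K.carrier}
    {w : EuclideanSpace ℝ (Fin n)} (hw : ‖w‖ ≤ r) : 0 < K.hess μ (q, w) := by
  obtain ⟨i, s, rfl⟩ := K.exists_point q
  refine hess_pos h ((mul_le_mul_of_nonneg_left hw (abs_nonneg _)).trans_lt (hs _)) fun hφ => ?_
  refine lt_of_le_of_lt ?_ (hΛ i s hφ)
  have : 0 ≤ K.focalValue μ i s := by rw [focalValue_eq_sq h hφ]; positivity
  gcongr

theorem injOn_expMap (h : K.IsWeight 2 μ) {r : ℝ} (hr : 0 < r) (hs : ∀ q, |K.slope μ q| * r < 1)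
    (hΛ : ∀ i s, 0 ≤ K.focalSign μ i s → K.focalValue μ i s * r ^ 2 < 1)
    (hdc : ∀ q₁ q₂, K.IsDoubleCriticalPair μ q₁ q₂ →
      r < ‖(q₁ : EuclideanSpace ℝ (Fin n)) - q₂‖ / (μ q₁ + μ q₂)) :
    Set.InjOn (K.expMap μ) (K.normalDisc r) := by
  rintro ⟨q₁, w₁⟩ hx₁ ⟨q₂, w₂⟩ hx₂ hp
  have hs₁ : |K.slope μ q₁| * ‖w₁‖ < 1 := slope_mul_lt (hs q₁).le hx₁.2
  have hs₂ : |K.slope μ q₂| * ‖w₂‖ < 1 := slope_mul_lt (hs q₂).le hx₂.2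
  have hc₁ := crit_expMap (μ := μ) (w := w₁) hx₁.1 hs₁.le
  have hc₂ := crit_expMap (μ := μ) (w := w₂) hx₂.1 hs₂.le
  have hd₁ := wdist_expMap (h.1 q₁) (w := w₁) hx₁.1 hs₁.le
  have hd₂ := wdist_expMap (h.1 q₂) (w := w₂) hx₂.1 hs₂.le
  have hn₁ : ‖w₁‖ ^ 2 ≤ r ^ 2 := pow_le_pow_left₀ (norm_nonneg _) hx₁.2.le 2
  have hn₂ : ‖w₂‖ ^ 2 ≤ r ^ 2 := pow_le_pow_left₀ (norm_nonneg _) hx₂.2.le 2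
  rw [← hp] at hc₂ hd₂
  have hq : q₁ = q₂ := crit_unique h hr hs
    (fun q w _ hw => (hess_pos_of_le h hs hΛ hw).ne') hdc hc₁ hc₂ (by rwa [hd₁]) (by rwa [hd₂])
  subst hq
  have e₁ := logVec_expMap (h.1 q₁) (w := w₁) hx₁.1 hs₁
  have e₂ := logVec_expMap (h.1 q₁) (w := w₂) hx₂.1 hs₂
  rw [← e₁, ← e₂, hp, e₂]

theorem lt_of_lt_halfDCSD {r : ℝ} (hr : (r : EReal) < K.halfDCSD μ) {q₁ q₂ : K.carrier}
    (hq : K.IsDoubleCriticalPair μ q₁ q₂) :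
    r < ‖(q₁ : EuclideanSpace ℝ (Fin n)) - q₂‖ / (μ q₁ + μ q₂) :=
  EReal.coe_lt_coe_iff.1 (hr.trans_le (sInf_le ⟨q₁, q₂, hq, rfl⟩))

theorem LR_le_DIR (h : K.IsWeight 2 μ) : K.LR μ ≤ K.DIR μ := by
  refine le_of_forall_lt fun c hc => ?_
  obtain ⟨r, hcr, hr⟩ := EReal.lt_iff_exists_real_btwn.1 hc
  refine hcr.trans_le (le_sSup ⟨r, ?_, rfl⟩)
  rcases le_or_gt r 0 with h0 | h0
  · have hs := (expMinimal_of_nonpos (K := K) (μ := μ) h0).1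
    have hempty : ∀ x, x ∉ K.normalDisc r :=
      fun x hx => absurd (hx.2.trans_le h0) (norm_nonneg x.2).not_gt
    exact ⟨normalDisc_subset_expDomain hs, isDiffeoOntoImage_of_injOn h hs
      (fun x hx => absurd hx (hempty x)) fun x hx => absurd hx (hempty x)⟩
  · obtain ⟨hdc, hfoc⟩ := lt_min_iff.1 hr
    obtain ⟨hs, hΛ⟩ := of_lt_focRadZero h h0 hfoc
    refine ⟨normalDisc_subset_expDomain fun q => (hs q).le, isDiffeoOntoImage_of_injOn h
      (fun q => (hs q).le) (injOn_expMap h h0 hs hΛ fun _ _ hq => lt_of_lt_halfDCSD hdc hq) ?_⟩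
    rintro ⟨q, w⟩ hx
    exact (hess_pos_of_le h hs hΛ hx.2.le).ne'

theorem DIR_le_LR (h : K.IsWeight 2 μ) : K.DIR μ ≤ K.LR μ := by
  refine sSup_le ?_
  rintro _ ⟨r, ⟨h1, h2⟩, rfl⟩
  rcases le_or_gt r 0 with h0 | h0
  · exact le_min ((expMinimal_of_nonpos h0).le_halfDCSD h)
      ((EReal.coe_nonpos.2 h0).trans zero_le_focRadZero)
  · have hs := slope_mul_le_of_subset h0 h1
    have hi : Set.InjOn (K.expMap μ) (K.normalDisc r) := by
      obtain ⟨f, g, -, -, hfg⟩ := h2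
      intro x hx y hy hxy
      have := (hfg x hx).2.symm.trans ((congrArg g hxy).trans (hfg y hy).2)
      simp only [Prod.mk.injEq] at this
      exact Prod.ext (Subtype.ext this.1) this.2
    exact le_min ((expMinimal_of_injOn h hs hi).le_halfDCSD h)
      (le_focRadZero h h0 hs fun _ hx => hess_ne_zero_of_isDiffeoOntoImage h hs h2 hx)

/-! ### The upper radius -/

theorem AIR_le_UR (h : K.IsWeight 2 μ) : K.AIR μ ≤ K.UR μ := by
  refine le_of_forall_lt fun c hc => ?_
  obtain ⟨r, hcr, hr⟩ := EReal.lt_iff_exists_real_btwn.1 hc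
  refine hcr.trans_le ?_
  have hm := expMinimal_of_lt_AIR h hr
  refine le_min (hm.le_halfDCSD h) ?_
  rcases le_or_gt r 0 with h0 | h0
  · exact (EReal.coe_nonpos.2 h0).trans zero_le_focRadMinus
  · exact le_focRadMinus h h0 hm.1 fun _ hx => hm.hess_nonneg h hx

/-! ### Shrinking the weight to μ - ε. -/

theorem slope_sub_const (ε : ℝ) : K.slope (fun q => μ q - ε) = K.slope μ := by
  unfold slope
  simp

theorem slope₂_sub_const (ε : ℝ) : K.slope₂ (fun q => μ q - ε) = K.slope₂ μ := by
  unfold slope₂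
  simp

theorem IsWeight.sub_const {k : ℕ} (h : K.IsWeight k μ) {ε : ℝ} (hε : ∀ q, ε < μ q) :
    K.IsWeight k fun q => μ q - ε :=
  ⟨fun q => sub_pos.2 (hε q), fun i => (h.2 i).sub contDiff_const⟩

theorem IsWeight.exists_forall_lt {k : ℕ} (h : K.IsWeight k μ) : ∃ ε > 0, ∀ q, ε < μ q := by
  obtain ⟨q, -, hq⟩ := isCompact_univ.exists_isMinOn Set.univ_nonempty h.continuous.continuousOn
  exact ⟨μ q / 2, half_pos (h.1 q), fun q' => (half_lt_self (h.1 q)).trans_le (hq (Set.mem_univ q'))⟩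

/-- Double critical pairs stay away from the diagonal, locally uniformly for the weights `μ - ε`. -/
theorem eventually_eq_of_inner_eq (h : K.IsWeight 2 μ) (q : K.carrier) :
    ∀ᶠ x : ℝ × K.carrier × K.carrier in 𝓝 (0, q, q),
      inner ℝ ((x.2.1 : EuclideanSpace ℝ (Fin n)) - x.2.2) (K.tangent x.2.1) *
        ((μ x.2.1 - x.1) + (μ x.2.2 - x.1)) =
        ‖(x.2.1 : EuclideanSpace ℝ (Fin n)) - x.2.2‖ ^ 2 * K.slope μ x.2.1 → x.2.1 = x.2.2 := by
  obtain ⟨i, a, rfl⟩ := K.exists_point q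
  have hmap : 𝓝 ((0 : ℝ), K.point i a, K.point i a) =
      map (Prod.map id (Prod.map (K.point i) (K.point i))) (𝓝 ((0 : ℝ), a, a)) := by
    rw [nhds_prod_eq, nhds_prod_eq, nhds_prod_eq, nhds_prod_eq, ← K.map_nhds_point,
      ← Filter.prod_map_map_eq', ← Filter.prod_map_map_eq', map_id]
  rw [hmap, eventually_map]
  simp only [Prod.map_fst, Prod.map_snd, id_eq, coe_point, tangent_point]
  have hμ := h.1 (K.point i a)
  have cμ : Continuous fun s => μ (K.point i s) := (h.2 i).continuous
  have cγ' : Continuous (deriv (K.γ i)) := (K.contDiff_deriv_γ i).continuous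
  have cμ₁ : Continuous fun x : ℝ × ℝ × ℝ => μ (K.point i x.2.1) := cμ.comp (by fun_prop)
  have cμ₂ : Continuous fun x : ℝ × ℝ × ℝ => μ (K.point i x.2.2) := cμ.comp (by fun_prop)
  have cσ : Continuous fun x : ℝ × ℝ × ℝ => K.slope μ (K.point i x.2.1) :=
    (h.continuous_slope.comp (K.continuous_point i)).comp (by fun_prop)
  -- Near the diagonal the left side of the equation has order |s - t| and the right side order |s -
  -- t|². The constants 3/4 and 1/4 leave the lower bound |s - t|/2 for the inner product.
  have hstrict := ((K.contDiff i).contDiffAt (x := a)).hasStrictDerivAt (by norm_num)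
  have e1 : ∀ᶠ x : ℝ × ℝ × ℝ in 𝓝 (0, a, a),
      ‖K.γ i x.2.1 - K.γ i x.2.2 - (x.2.1 - x.2.2) • deriv (K.γ i) a‖ ≤
        1 / 4 * ‖x.2.1 - x.2.2‖ := by
    have := hstrict.isLittleO.def (show (0 : ℝ) < 1 / 4 by norm_num)
    simp only [ContinuousLinearMap.toSpanSingleton_apply] at this
    exact (continuous_snd.tendsto ((0 : ℝ), a, a)).eventually this
  have e2 : ∀ᶠ x : ℝ × ℝ × ℝ in 𝓝 (0, a, a),
      3 / 4 < inner ℝ (deriv (K.γ i) a) (deriv (K.γ i) x.2.1) := by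
    have hc : Continuous fun x : ℝ × ℝ × ℝ => inner ℝ (deriv (K.γ i) a) (deriv (K.γ i) x.2.1) := by
      fun_prop
    refine hc.continuousAt.eventually_const_lt ?_
    simp only [real_inner_self_eq_norm_sq, K.unit_speed]
    norm_num
  have e3 : ∀ᶠ x : ℝ × ℝ × ℝ in 𝓝 (0, a, a), μ (K.point i a) <
      (μ (K.point i x.2.1) - x.1) + (μ (K.point i x.2.2) - x.1) := by
    have hc : Continuous fun x : ℝ × ℝ × ℝ =>
        (μ (K.point i x.2.1) - x.1) + (μ (K.point i x.2.2) - x.1) :=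
      (cμ₁.sub continuous_fst).add (cμ₂.sub continuous_fst)
    refine hc.continuousAt.eventually_const_lt ?_
    simp only
    linarith
  have e4 : ∀ᶠ x : ℝ × ℝ × ℝ in 𝓝 (0, a, a),
      4 * |x.2.1 - x.2.2| * |K.slope μ (K.point i x.2.1)| < μ (K.point i a) / 2 := by
    have hc : Continuous fun x : ℝ × ℝ × ℝ =>
        4 * |x.2.1 - x.2.2| * |K.slope μ (K.point i x.2.1)| := by fun_prop
    refine hc.continuousAt.eventually_lt_const ?_
    simp only [sub_self, abs_zero, mul_zero, zero_mul]
    linarith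
  filter_upwards [e1, e2, e3, e4] with x h1 h2 h3 h4 heq
  obtain ⟨ε, s, t⟩ := x
  simp only at h1 h2 h3 h4 heq ⊢
  by_contra hne
  have hst : s ≠ t := fun hst => hne (by rw [hst])
  have hpos : 0 < |s - t| := abs_pos.2 (sub_ne_zero.2 hst)
  rw [Real.norm_eq_abs] at h1
  set d := K.γ i s - K.γ i t with hd
  set e := d - (s - t) • deriv (K.γ i) a with he
  have hde : d = (s - t) • deriv (K.γ i) a + e := by rw [he]; abel
  have hdn : ‖d‖ ≤ 2 * |s - t| := by
    rw [hde]
    refine (norm_add_le _ _).trans ?_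
    rw [norm_smul, K.unit_speed, Real.norm_eq_abs]
    linarith
  have hin : |s - t| / 2 ≤ |inner ℝ d (deriv (K.γ i) s)| := by
    have k1 : inner ℝ d (deriv (K.γ i) s) =
        (s - t) * inner ℝ (deriv (K.γ i) a) (deriv (K.γ i) s) + inner ℝ e (deriv (K.γ i) s) := by
      rw [hde, inner_add_left, inner_smul_left]
      rfl
    have k2 : |inner ℝ e (deriv (K.γ i) s)| ≤ 1 / 4 * |s - t| := by
      refine (abs_real_inner_le_norm _ _).trans ?_
      rw [K.unit_speed, mul_one]
      exact h1
    have k3 : |s - t| * (3 / 4) ≤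
        |(s - t) * inner ℝ (deriv (K.γ i) a) (deriv (K.γ i) s)| := by
      rw [abs_mul, abs_of_pos (show 0 < inner ℝ (deriv (K.γ i) a) (deriv (K.γ i) s) by linarith)]
      gcongr
    have k4 := abs_sub_abs_le_abs_sub ((s - t) * inner ℝ (deriv (K.γ i) a) (deriv (K.γ i) s))
      (-inner ℝ e (deriv (K.γ i) s))
    rw [abs_neg, sub_neg_eq_add, ← k1] at k4
    linarith
  have hL : |s - t| / 2 * μ (K.point i a) ≤ ‖d‖ ^ 2 * |K.slope μ (K.point i s)| := by
    have := congrArg abs heq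
    rw [abs_mul, abs_mul, abs_of_nonneg (sq_nonneg ‖d‖), abs_of_pos (hμ.trans h3)] at this
    rw [← this]
    gcongr
  have hR : ‖d‖ ^ 2 * |K.slope μ (K.point i s)| ≤ (2 * |s - t|) ^ 2 * |K.slope μ (K.point i s)| := by
    gcongr
  have hF : |s - t| * (4 * |s - t| * |K.slope μ (K.point i s)|) < |s - t| * (μ (K.point i a) / 2) :=
    mul_lt_mul_of_pos_left h4 hpos
  nlinarith

/-- By compactness of K × K: an off-diagonal limit of short double critical pairs for μ - ε would be
one for μ, and `eventually_eq_of_inner_eq` handles the diagonal. -/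
theorem eventually_lt_of_isDoubleCriticalPair (h : K.IsWeight 2 μ) {r : ℝ}
    (hr : (r : EReal) < K.halfDCSD μ) :
    ∀ᶠ ε : ℝ in 𝓝[>] 0, ∀ q₁ q₂, K.IsDoubleCriticalPair (fun q => μ q - ε) q₁ q₂ →
      r < ‖(q₁ : EuclideanSpace ℝ (Fin n)) - q₂‖ / ((μ q₁ - ε) + (μ q₂ - ε)) := by
  set C : Set (ℝ × K.carrier × K.carrier) := {x |
    (inner ℝ ((x.2.1 : EuclideanSpace ℝ (Fin n)) - x.2.2) (K.tangent x.2.1) *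
        ((μ x.2.1 - x.1) + (μ x.2.2 - x.1)) =
        ‖(x.2.1 : EuclideanSpace ℝ (Fin n)) - x.2.2‖ ^ 2 * K.slope μ x.2.1 ∧
      inner ℝ ((x.2.1 : EuclideanSpace ℝ (Fin n)) - x.2.2) (K.tangent x.2.2) *
        ((μ x.2.1 - x.1) + (μ x.2.2 - x.1)) =
        -(‖(x.2.1 : EuclideanSpace ℝ (Fin n)) - x.2.2‖ ^ 2 * K.slope μ x.2.2)) ∧
      ‖(x.2.1 : EuclideanSpace ℝ (Fin n)) - x.2.2‖ ≤ r * ((μ x.2.1 - x.1) + (μ x.2.2 - x.1))} with hC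
  have c1 := h.continuous
  have c2 := h.continuous_slope
  have c3 := K.continuous_tangent
  have hCc : IsClosed C := by
    simp only [hC, Set.ofPred_and]
    refine IsClosed.inter (IsClosed.inter (isClosed_eq ?_ ?_) (isClosed_eq ?_ ?_))
      (isClosed_le ?_ ?_) <;> fun_prop
  have key : ∀ᶠ ε : ℝ in 𝓝 0, ∀ y ∈ (Set.univ : Set (K.carrier × K.carrier)),
      (ε, y) ∈ C → y.1 = y.2 := by
    refine isCompact_univ.eventually_forall_of_forall_eventually ?_
    rintro ⟨q₁, q₂⟩ -
    by_cases hq : q₁ = q₂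
    · subst hq
      filter_upwards [eventually_eq_of_inner_eq h q₁] with x hx hxC
      exact hx hxC.1.1
    · have hnot : ((0 : ℝ), q₁, q₂) ∉ C := by
        rintro ⟨⟨h1, h2⟩, h3⟩
        simp only [sub_zero] at h1 h2 h3
        have := lt_of_lt_halfDCSD hr ((isDoubleCriticalPair_iff h).2 ⟨hq, h1, h2⟩)
        rw [lt_div_iff₀ (add_pos (h.1 _) (h.1 _))] at this
        linarith
      filter_upwards [hCc.isOpen_compl.mem_nhds hnot] with x hx hxC
      exact absurd hxC hx
  obtain ⟨ε₀, hε₀, hμ⟩ := h.exists_forall_lt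
  filter_upwards [key.filter_mono nhdsWithin_le_nhds, Ioo_mem_nhdsGT hε₀] with ε hε hεI q₁ q₂ hq
  have hw : K.IsWeight 2 fun q => μ q - ε := h.sub_const fun q => hεI.2.trans (hμ q)
  obtain ⟨hne, h1, h2⟩ := (isDoubleCriticalPair_iff hw).1 hq
  rw [slope_sub_const] at h1 h2
  by_contra! hle
  rw [div_le_iff₀ (add_pos (hw.1 q₁) (hw.1 q₂))] at hle
  exact hne (hε (q₁, q₂) (Set.mem_univ _) ⟨⟨h1, h2⟩, hle⟩)

/-- Subtracting ε keeps the derivatives of μ and lowers μ'' + κ²μ/4 by εκ²/4. A nonnegative value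
for μ - ε is therefore positive for μ, where Λ has a uniform bound, unless κ = 0 and μ'' = 0. -/
theorem eventually_focalValue_lt (h : K.IsWeight 2 μ) {r : ℝ} (hr : 0 < r)
    (hlt : (r : EReal) < K.focRadMinus μ) :
    ∀ᶠ ε : ℝ in 𝓝[>] 0, ∀ i s, 0 ≤ K.focalSign (fun q => μ q - ε) i s →
      K.focalValue (fun q => μ q - ε) i s * r ^ 2 < 1 := by
  obtain ⟨hs, hc⟩ := of_lt_focRadMinus h hr hlt
  rw [eventually_all]
  intro i
  obtain ⟨c, hcr, hcs⟩ := hc i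
  set G : ℝ → K.carrier → ℝ := fun ε q => K.slope μ q ^ 2 + (μ q - ε) * K.slope₂ μ q
      + 1 / 2 * ‖K.curvVec q‖ ^ 2 * (μ q - ε) ^ 2
      + ‖K.curvVec q‖ * (μ q - ε) * √((μ q - ε) * (K.slope₂ μ q +
        1 / 4 * ‖K.curvVec q‖ ^ 2 * (μ q - ε))) with hG
  have hGc : Continuous fun x : ℝ × K.carrier => G x.1 x.2 := by
    have c1 := h.continuous
    have c2 := h.continuous_slope
    have c3 := h.continuous_slope₂
    have c4 := K.continuous_curvVec
    simp only [hG]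
    fun_prop
  have hev : ∀ᶠ ε : ℝ in 𝓝 0, ∀ q ∈ (Set.univ : Set K.carrier),
      (G ε q - G 0 q + c) * r ^ 2 < 1 := by
    refine isCompact_univ.eventually_forall_of_forall_eventually fun q _ => ?_
    have hc' : Continuous fun x : ℝ × K.carrier => (G x.1 x.2 - G 0 x.2 + c) * r ^ 2 := by
      have : Continuous fun x : ℝ × K.carrier => G 0 x.2 :=
        hGc.comp (continuous_const.prodMk continuous_snd)
      fun_prop
    exact hc'.continuousAt.eventually_lt_const (by simpa using hcr)
  obtain ⟨ε₀, hε₀, hμ⟩ := h.exists_forall_lt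
  filter_upwards [hev.filter_mono nhdsWithin_le_nhds, Ioo_mem_nhdsGT hε₀] with ε hε hεI s hφ
  have hw : K.IsWeight 2 fun q => μ q - ε := h.sub_const fun q => hεI.2.trans (hμ q)
  have hval : K.focalValue (fun q => μ q - ε) i s = G ε (K.point i s) := by
    rw [focalValue_eq hw, focalSign_eq, slope_sub_const, slope₂_sub_const]
  have hval0 : K.focalValue μ i s = G 0 (K.point i s) := by
    rw [focalValue_eq h, focalSign_eq]
    simp only [hG, sub_zero]
  have hμs := hw.1 (K.point i s)
  by_cases hpos : 0 < K.focalSign μ i s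
  · have h1 := hcs s hpos
    have h2 := hε (K.point i s) (Set.mem_univ _)
    rw [hval]
    refine lt_of_le_of_lt ?_ h2
    gcongr
    linarith
  -- In the exceptional case Λ reduces to μ'², which the slope bound controls.
  · have hκ : ‖K.curvVec (K.point i s)‖ = 0 ∧ K.slope₂ μ (K.point i s) = 0 := by
      rw [focalSign_eq] at hφ hpos
      rw [slope₂_sub_const] at hφ
      have h1 : 0 ≤ 1 / 4 * ‖K.curvVec (K.point i s)‖ ^ 2 * ε := by
        have := hεI.1
        positivity
      have h2 : 1 / 4 * ‖K.curvVec (K.point i s)‖ ^ 2 * ε = 0 := by nlinarith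
      have h3 : ‖K.curvVec (K.point i s)‖ = 0 := by
        have := hεI.1.ne'
        simpa [this] using h2
      rw [h3] at hφ hpos
      exact ⟨h3, by linarith⟩
    rw [hval]
    simp only [hG, hκ.1, hκ.2, mul_zero, zero_mul, add_zero, ne_eq, OfNat.ofNat_ne_zero,
      not_false_eq_true, zero_pow]
    rw [← sq_abs, ← mul_pow]
    exact pow_lt_one₀ (by positivity) (hs _) two_ne_zero

/-- For μ - ε the argument for the lower radius gives injectivity and hence minimality; only the
latter passes to the limit. -/
theorem expMinimal_of_lt_UR (h : K.IsWeight 2 μ) {r : ℝ} (hlt : (r : EReal) < K.UR μ) :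
    K.ExpMinimal μ r := by
  rcases le_or_gt r 0 with h0 | h0
  · exact expMinimal_of_nonpos h0
  obtain ⟨hdc, hfoc⟩ := lt_min_iff.1 hlt
  have hs := (of_lt_focRadMinus h h0 hfoc).1
  obtain ⟨ε₀, hε₀, hμ⟩ := h.exists_forall_lt
  have hmin : ∀ᶠ ε : ℝ in 𝓝[>] 0, K.ExpMinimal (fun q => μ q - ε) r := by
    filter_upwards [eventually_lt_of_isDoubleCriticalPair h hdc, eventually_focalValue_lt h h0 hfoc,
      Ioo_mem_nhdsGT hε₀] with ε h1 h2 hεI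
    have hw : K.IsWeight 2 fun q => μ q - ε := h.sub_const fun q => hεI.2.trans (hμ q)
    have hs' : ∀ q, |K.slope (fun q => μ q - ε) q| * r < 1 := by rwa [slope_sub_const]
    exact expMinimal_of_injOn hw (fun q => (hs' q).le) (injOn_expMap hw h0 hs' h2 h1)
  refine ⟨fun q => (hs q).le, ?_⟩
  rintro ⟨q₀, w⟩ hx q
  have hexp : Continuous fun ε : ℝ => K.expMap (fun q => μ q - ε) (q₀, w) := by
    simp only [expMap_eq, slope_sub_const]
    fun_prop
  have hlim : ∀ q, Tendsto (fun ε : ℝ => wdist (fun q => μ q - ε)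
      (K.expMap (fun q => μ q - ε) (q₀, w)) q) (𝓝[>] 0) (𝓝 (wdist μ (K.expMap μ (q₀, w)) q)) := by
    intro q
    have : ContinuousAt (fun ε : ℝ => wdist (fun q => μ q - ε)
        (K.expMap (fun q => μ q - ε) (q₀, w)) q) 0 := by
      unfold wdist
      refine ContinuousAt.div₀ ((hexp.sub continuous_const).norm.pow 2).continuousAt (by fun_prop) ?_
      simpa using (h.1 q).ne'
    have h2 := this.tendsto
    simp only [sub_zero] at h2
    exact h2.mono_left nhdsWithin_le_nhds
  refine le_of_tendsto_of_tendsto (hlim q₀) (hlim q) ?_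
  filter_upwards [hmin] with ε hε
  exact hε.2 (q₀, w) hx q

theorem UR_le_AIR (h : K.IsWeight 2 μ) : K.UR μ ≤ K.AIR μ := by
  refine le_of_forall_lt fun c hc => ?_
  obtain ⟨r, hcr, hr⟩ := EReal.lt_iff_exists_real_btwn.1 hc
  exact hcr.trans_le ((expMinimal_of_lt_UR h hr).le_AIR h)

/-! ### Semicontinuity of the almost injectivity radius -/

/-- The diffeomorphisms φ_k need not preserve arclength. This lemma and the next two express the
gradient and the normal projection through an arbitrary regular parametrization. -/
theorem exists_hasDerivAt_comp (h : K.IsWeight 2 μ) {c : ℝ → K.carrier} {s : ℝ}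
    {v : EuclideanSpace ℝ (Fin n)}
    (hc : HasDerivAt (fun t => (c t : EuclideanSpace ℝ (Fin n))) v s) :
    ∃ a : ℝ, v = a • K.tangent (c s) ∧
      HasDerivAt (fun t => μ (c t)) (a * K.slope μ (c s)) s := by
  obtain ⟨i, u, hu⟩ := K.exists_point (c s)
  have hcu : (c s : EuclideanSpace ℝ (Fin n)) = K.γ i u := by rw [← hu]; rfl
  obtain ⟨S, hS1, hS2, hS3⟩ := K.exists_ambient_parameter i u
  rw [← hcu] at hS1 hS2 hS3
  have hσ : DifferentiableAt ℝ (fun t => S (c t)) s :=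
    DifferentiableAt.comp (g := S) (f := fun t => (c t : EuclideanSpace ℝ (Fin n))) s
      (hS1.differentiableAt one_ne_zero) hc.differentiableAt
  have hev : ∀ᶠ t in 𝓝 s, K.point i (S (c t)) = c t := by
    filter_upwards [hc.continuousAt.eventually hS3] with t ht
    exact ht _ rfl
  refine ⟨deriv (fun t => S (c t)) s, ?_, ?_⟩
  · have h1 : HasDerivAt (fun t => K.γ i (S (c t)))
        (deriv (fun t => S (c t)) s • deriv (K.γ i) u) s := by
      have h2 := K.hasDerivAt_γ i (S (c s))
      rw [hS2] at h2
      exact HasDerivAt.scomp_of_eq (h := fun t => S (c t)) s h2 hσ.hasDerivAt hS2.symm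
    rw [← hu, tangent_point]
    refine hc.unique (h1.congr_of_eventuallyEq ?_)
    filter_upwards [hev] with t ht
    rw [← coe_point, ht]
  · have h1 := h.hasDerivAt i u
    rw [← slope_point, hu] at h1
    have h2 := HasDerivAt.comp_of_eq (h := fun t => S (c t)) s h1 hσ.hasDerivAt hS2.symm
    rw [mul_comm]
    refine h2.congr_of_eventuallyEq ?_
    filter_upwards [hev] with t ht
    simp only [Function.comp_apply, ht]

theorem grad_eq_of_hasDerivAt (h : K.IsWeight 2 μ) {c : ℝ → K.carrier} {s : ℝ}
    {v : EuclideanSpace ℝ (Fin n)} (hv : v ≠ 0)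
    (hc : HasDerivAt (fun t => (c t : EuclideanSpace ℝ (Fin n))) v s) :
    K.grad μ (c s) = (deriv (fun t => μ (c t)) s / ‖v‖ ^ 2) • v := by
  obtain ⟨a, ha, hd⟩ := exists_hasDerivAt_comp h hc
  have ha0 : a ≠ 0 := by
    rintro rfl
    exact hv (by rw [ha, zero_smul])
  rw [hd.deriv, grad_eq, ha, norm_smul, norm_tangent, mul_one, Real.norm_eq_abs, sq_abs, smul_smul]
  congr 1
  field_simp

theorem inner_tangent_sub_proj (h : K.IsWeight 2 μ) {c : ℝ → K.carrier} {s : ℝ}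
    {v : EuclideanSpace ℝ (Fin n)} (hv : v ≠ 0)
    (hc : HasDerivAt (fun t => (c t : EuclideanSpace ℝ (Fin n))) v s)
    (w : EuclideanSpace ℝ (Fin n)) :
    inner ℝ (K.tangent (c s)) (w - (inner ℝ v w / ‖v‖ ^ 2) • v) = 0 := by
  obtain ⟨a, ha, -⟩ := exists_hasDerivAt_comp h hc
  have ha0 : a ≠ 0 := by
    rintro rfl
    exact hv (by rw [ha, zero_smul])
  have h1 : inner ℝ v (w - (inner ℝ v w / ‖v‖ ^ 2) • v) = 0 := by
    rw [inner_sub_right, inner_smul_right, real_inner_self_eq_norm_sq,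
      div_mul_cancel₀ _ (pow_ne_zero 2 (norm_ne_zero_iff.2 hv)), sub_self]
  have h2 : K.tangent (c s) = a⁻¹ • v := by rw [ha, inv_smul_smul₀ ha0]
  rw [h2, inner_smul_left, h1, mul_zero]

/-- Minimality is a closed inequality between quantities built from the points, the weights and
their first derivatives. Convergence to first order along infinitely many k is all that enters. -/
theorem expMinimal_of_frequently {K : ℕ → ClosedCurves n} {μ : ∀ k, (K k).carrier → ℝ}
    {K₀ : ClosedCurves n} {μ₀ : K₀.carrier → ℝ} (h : ∀ k, (K k).IsWeight 2 (μ k))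
    (h₀ : K₀.IsWeight 2 μ₀) (hc : C2Converges K μ K₀ μ₀) {r : ℝ}
    (hr : ∃ᶠ k in atTop, (K k).ExpMinimal (μ k) r) : K₀.ExpMinimal μ₀ r := by
  obtain ⟨φ, hφ, hconv⟩ := hc
  have hφq : ∀ q : K₀.carrier, Tendsto (fun k => (φ k q : EuclideanSpace ℝ (Fin n))) atTop
      (𝓝 (q : EuclideanSpace ℝ (Fin n))) := by
    intro q
    obtain ⟨i, s, rfl⟩ := K₀.exists_point q
    simpa only [iteratedDeriv_zero, coe_point] using (hconv i 0 (by norm_num)).1.tendsto_at s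
  have hμq : ∀ q : K₀.carrier, Tendsto (fun k => μ k (φ k q)) atTop (𝓝 (μ₀ q)) := by
    intro q
    obtain ⟨i, s, rfl⟩ := K₀.exists_point q
    simpa only [iteratedDeriv_zero] using (hconv i 0 (by norm_num)).2.tendsto_at s
  have hgrad : ∀ q : K₀.carrier, ∃ v : ℕ → EuclideanSpace ℝ (Fin n),
      Tendsto v atTop (𝓝 (K₀.tangent q)) ∧
      Tendsto (fun k => (K k).grad (μ k) (φ k q)) atTop (𝓝 (K₀.grad μ₀ q)) ∧
      ∀ᶠ k in atTop, ∀ w, inner ℝ ((K k).tangent (φ k q))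
        (w - (inner ℝ (v k) w / ‖v k‖ ^ 2) • v k) = 0 := by
    intro q
    obtain ⟨i, s, rfl⟩ := K₀.exists_point q
    have hv := (hconv i 1 (by norm_num)).1.tendsto_at s
    have hm := (hconv i 1 (by norm_num)).2.tendsto_at s
    simp only [iteratedDeriv_one] at hv hm
    refine ⟨_, by simpa only [tangent_point] using hv, ?_, ?_⟩
    · have hlim := (hm.div (hv.norm.pow 2) (by rw [K₀.unit_speed]; norm_num)).smul hv
      rw [K₀.unit_speed, one_pow, div_one, ← slope_point, ← tangent_point, ← grad_eq] at hlim
      refine hlim.congr' ?_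
      filter_upwards [hφ] with k hk
      exact (grad_eq_of_hasDerivAt (c := fun t => φ k (K₀.point i t)) (h k) ((hk.2 i).2 s)
        (((hk.2 i).1.differentiable (by norm_num) s).hasDerivAt)).symm
    · filter_upwards [hφ] with k hk w
      exact inner_tangent_sub_proj (c := fun t => φ k (K₀.point i t)) (h k) ((hk.2 i).2 s)
        (((hk.2 i).1.differentiable (by norm_num) s).hasDerivAt) w
  constructor
  · intro q
    obtain ⟨v, -, hg, -⟩ := hgrad q
    rw [← norm_grad]
    refine le_of_tendsto_of_frequently (hg.norm.mul_const r) ?_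
    refine hr.mono fun k hk => ?_
    rw [norm_grad]
    exact hk.1 _
  · rintro ⟨q₀, w⟩ ⟨hw, hwr⟩ q
    have hw : inner ℝ (K₀.tangent q₀) w = 0 := hw
    obtain ⟨v, hv, hg, hn⟩ := hgrad q₀
    -- w is projected to the normal space at `φ k q₀`; the projections converge to w, so their
    -- lengths are eventually below r.
    set W : ℕ → EuclideanSpace ℝ (Fin n) := fun k => w - (inner ℝ (v k) w / ‖v k‖ ^ 2) • v k
    have hW : Tendsto W atTop (𝓝 w) := by
      have := (((hv.inner (𝕜 := ℝ) (tendsto_const_nhds (x := w))).div (hv.norm.pow 2)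
        (by rw [norm_tangent]; norm_num)).smul hv).const_sub w
      rwa [hw, zero_div, zero_smul, sub_zero] at this
    have hexp : Tendsto (fun k => (K k).expMap (μ k) (φ k q₀, W k)) atTop
        (𝓝 (K₀.expMap μ₀ (q₀, w))) := by
      unfold expMap
      exact ((hφq q₀).sub (((hμq q₀).mul (hW.norm.pow 2)).smul hg)).add
        (((hμq q₀).mul (((hg.norm.pow 2).mul (hW.norm.pow 2)).const_sub 1).sqrt).smul hW)
    have hlim : ∀ q, Tendsto (fun k => wdist (μ k) ((K k).expMap (μ k) (φ k q₀, W k)) (φ k q))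
        atTop (𝓝 (wdist μ₀ (K₀.expMap μ₀ (q₀, w)) q)) := by
      intro q
      unfold wdist
      exact ((hexp.sub (hφq q)).norm.pow 2).div ((hμq q).pow 2) (pow_ne_zero 2 (h₀.1 q).ne')
    have hWr : ∀ᶠ k in atTop, ‖W k‖ < r := hW.norm.eventually_lt_const hwr
    refine sub_nonneg.1 (ge_of_tendsto_of_frequently ((hlim q).sub (hlim q₀)) ?_)
    refine (hr.and_eventually (hWr.and hn)).mono ?_
    rintro k ⟨hk, h1, h2⟩
    exact sub_nonneg.2 (hk.2 (φ k q₀, W k) ⟨h2 w, h1⟩ (φ k q))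

theorem limsup_AIR_le {K : ℕ → ClosedCurves n} {μ : ∀ k, (K k).carrier → ℝ}
    {K₀ : ClosedCurves n} {μ₀ : K₀.carrier → ℝ} (h : ∀ k, (K k).IsWeight 2 (μ k))
    (h₀ : K₀.IsWeight 2 μ₀) (hc : C2Converges K μ K₀ μ₀) :
    limsup (fun k => (K k).AIR (μ k)) atTop ≤ K₀.AIR μ₀ := by
  refine le_of_forall_lt fun c hclt => ?_
  obtain ⟨r, hcr, hr⟩ := EReal.lt_iff_exists_real_btwn.1 hclt
  refine hcr.trans_le (ExpMinimal.le_AIR h₀ (expMinimal_of_frequently h h₀ hc ?_))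
  exact (frequently_lt_of_lt_limsup (by isBoundedDefault) hr).mono
    fun k hk => expMinimal_of_lt_AIR (h k) hk

end ClosedCurves

end

noncomputable section

/-! ### One-dimensional Sard theorem -/

theorem volume_image_eq_zero_of_hasDerivAt_zero {f : ℝ → ℝ} {A : Set ℝ}
    (hf : ∀ s ∈ A, HasDerivAt f 0 s) : MeasureTheory.volume (f '' A) = 0 := by
  refine MeasureTheory.addHaar_image_eq_zero_of_det_fderivWithin_eq_zero
    (f' := fun _ => (0 : ℝ →L[ℝ] ℝ)) _ (fun s hs => ?_) fun s _ => ?_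
  · have := (hf s hs).hasFDerivAt.hasFDerivWithinAt (s := A)
    simpa using this
  · simp

/-- For almost every `δ`, the zeros of `f + δ g` outside the zeros of `g` are simple. -/
theorem volume_degenerate_eq_zero {f g f' g' : ℝ → ℝ} (hf : ∀ s, HasDerivAt f (f' s) s)
    (hg : ∀ s, HasDerivAt g (g' s) s) :
    MeasureTheory.volume {δ : ℝ | ∃ s, g s ≠ 0 ∧ f s + δ * g s = 0 ∧ f' s + δ * g' s = 0} = 0 := by
  -- Such a δ is a critical value of -f/g, and critical values form a null set.
  refine MeasureTheory.measure_mono_null ?_ (volume_image_eq_zero_of_hasDerivAt_zero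
    (f := fun s => -f s / g s) (A := {s | g s ≠ 0 ∧ f' s * g s = f s * g' s}) ?_)
  · rintro δ ⟨s, h0, h1, h2⟩
    refine ⟨s, ⟨h0, ?_⟩, ?_⟩
    · linear_combination g s * h2 - g' s * h1
    · rw [div_eq_iff h0]
      linarith
  · rintro s ⟨h0, h1⟩
    refine ((hf s).fun_neg.fun_div (hg s) h0).congr_deriv ?_
    rw [div_eq_zero_iff]
    left
    linear_combination -h1

theorem frequently_notMem_of_volume_eq_zero {A : Set ℝ} (hA : MeasureTheory.volume A = 0) (x : ℝ) :
    ∃ᶠ δ in 𝓝 x, δ ∉ A := by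
  intro h
  simp only [not_not] at h
  exact (MeasureTheory.Measure.measure_pos_of_mem_nhds MeasureTheory.volume h).ne' hA

namespace ClosedCurves

variable {n : ℕ} {K : ClosedCurves n} {μ : K.carrier → ℝ}

theorem IsWeight.of_le {k l : ℕ} (h : K.IsWeight l μ) (hk : k ≤ l) : K.IsWeight k μ :=
  ⟨h.1, fun i => (h.2 i).of_le (by exact_mod_cast hk)⟩

/-! ### The `C³` topology on weights -/

theorem tendsto_C3Weight_iff {ι : Type*} {l : Filter ι} {ν : ι → K.C3Weight} {ν₀ : K.C3Weight} :
    Tendsto ν l (𝓝 ν₀) ↔ ∀ (i : Fin K.m) (d : Fin 4),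
      TendstoUniformly (fun a => iteratedDeriv (d : ℕ) fun s => (ν a).1 (K.point i s))
        (iteratedDeriv (d : ℕ) fun s => ν₀.1 (K.point i s)) l := by
  rw [nhds_induced, tendsto_comap_iff, tendsto_pi_nhds]
  refine forall_congr' fun i => ?_
  rw [tendsto_pi_nhds]
  refine forall_congr' fun d => ?_
  rw [UniformFun.tendsto_iff_tendstoUniformly]
  rfl

theorem continuous_iteratedDeriv_C3Weight (i : Fin K.m) {d : ℕ} (hd : d < 4) :
    Continuous fun x : K.C3Weight × ℝ => iteratedDeriv d (fun s => x.1.1 (K.point i s)) x.2 := by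
  rw [continuous_iff_continuousAt]
  rintro ⟨ν, s⟩
  have h1 : TendstoUniformly
      (fun x : K.C3Weight × ℝ => iteratedDeriv d fun s => x.1.1 (K.point i s))
      (iteratedDeriv d fun s => ν.1 (K.point i s)) (𝓝 (ν, s)) :=
    (tendsto_C3Weight_iff.1 (continuous_fst.tendsto (ν, s))) i ⟨d, hd⟩
  refine h1.tendsto_comp ?_ (continuous_snd.tendsto (ν, s))
  exact ((ν.2.2 i).continuous_iteratedDeriv d (by exact_mod_cast Nat.lt_succ_iff.1 hd)).continuousAt

theorem periodic_iteratedDeriv {f : ℝ → ℝ} {c : ℝ} (hf : Function.Periodic f c) (d : ℕ) :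
    Function.Periodic (iteratedDeriv d f) c := by
  induction d with
  | zero => simpa only [iteratedDeriv_zero] using hf
  | succ d ih =>
    rw [iteratedDeriv_succ]
    exact periodic_deriv ih

theorem iteratedDeriv_add_mul {f g : ℝ → ℝ} {d : ℕ} (hf : ContDiff ℝ 3 f) (hg : ContDiff ℝ 3 g)
    (hd : d ≤ 3) (δ s : ℝ) : iteratedDeriv d (fun t => f t + δ * g t) s =
      iteratedDeriv d f s + δ * iteratedDeriv d g s := by
  have hd' : ((d : ℕ) : WithTop ℕ∞) ≤ 3 := by exact_mod_cast hd
  have h1 := iteratedDeriv_add (n := d) (x := s) (hf.of_le hd').contDiffAt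
    ((contDiff_const (c := δ)).mul (hg.of_le hd')).contDiffAt
  refine h1.trans ?_
  rw [iteratedDeriv_const_mul_field]

/-- By periodicity b and its derivatives are bounded, so ν + δb tends to ν in the C³ topology as δ →
0. Density is thereby reduced to a choice of one real parameter. -/
theorem mem_closure_of_frequently_add {ν : K.C3Weight} {b : K.carrier → ℝ}
    (hb : ∀ i, ContDiff ℝ 3 fun s => b (K.point i s)) {A : Set K.C3Weight}
    (hA : ∃ᶠ δ : ℝ in 𝓝 0, ∀ hw : K.IsWeight 3 fun q => ν.1 q + δ * b q,
      (⟨_, hw⟩ : K.C3Weight) ∈ A) : ν ∈ closure A := by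
  classical
  have hbc : Continuous b := K.continuous_of_point fun i => (hb i).continuous
  have hw : ∀ᶠ δ : ℝ in 𝓝 0, K.IsWeight 3 fun q => ν.1 q + δ * b q := by
    have hνc : Continuous ν.1 := ν.2.continuous
    have : ∀ᶠ δ : ℝ in 𝓝 0, ∀ q ∈ (Set.univ : Set K.carrier), 0 < ν.1 q + δ * b q := by
      refine isCompact_univ.eventually_forall_of_forall_eventually fun q _ => ?_
      have hc : Continuous fun x : ℝ × K.carrier => ν.1 x.2 + x.1 * b x.2 := by fun_prop
      refine hc.continuousAt.eventually_const_lt ?_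
      simpa using ν.2.1 q
    filter_upwards [this] with δ hδ
    exact ⟨fun q => hδ q (Set.mem_univ q), fun i => (ν.2.2 i).add (contDiff_const.mul (hb i))⟩
  -- The default ν is taken only for δ where positivity fails, and none of these are close to 0.
  set Ψ : ℝ → K.C3Weight := fun δ =>
    if hδ : K.IsWeight 3 fun q => ν.1 q + δ * b q then ⟨_, hδ⟩ else ν
  have hΨw : ∀ δ, ∀ hδ : K.IsWeight 3 fun q => ν.1 q + δ * b q, Ψ δ = ⟨_, hδ⟩ :=
    fun δ hδ => dif_pos hδ
  have hval : ∀ᶠ δ in 𝓝 0, (Ψ δ).1 = fun q => ν.1 q + δ * b q := by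
    filter_upwards [hw] with δ hδ
    rw [hΨw δ hδ]
  refine mem_closure_of_frequently_of_tendsto (f := Ψ) (b := 𝓝 0) ?_ ?_
  · refine (hA.and_eventually hw).mono ?_
    rintro δ ⟨h1, h2⟩
    rw [hΨw δ h2]
    exact h1 h2
  · rw [tendsto_C3Weight_iff]
    intro i d
    have hd : (d : ℕ) ≤ 3 := Nat.lt_succ_iff.1 d.2
    have hcont : Continuous (iteratedDeriv (d : ℕ) fun s => b (K.point i s)) :=
      (hb i).continuous_iteratedDeriv d (by exact_mod_cast hd)
    obtain ⟨B, hB⟩ := bddAbove_image_of_periodic (K.len_pos i) hcont.abs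
      ((periodic_iteratedDeriv (K.periodic_weight b i) d).comp fun x => |x|) Set.univ
    have hB' : ∀ s, |iteratedDeriv (d : ℕ) (fun s => b (K.point i s)) s| ≤ B :=
      fun s => hB ⟨s, Set.mem_univ s, rfl⟩
    rw [Metric.tendstoUniformly_iff]
    intro ε hε
    have hsmall : ∀ᶠ δ : ℝ in 𝓝 0, |δ| * B < ε := by
      have hc : Continuous fun δ : ℝ => |δ| * B := by fun_prop
      refine hc.continuousAt.eventually_lt_const ?_
      simpa using hε
    filter_upwards [hval, hsmall] with δ h1 h2 s
    rw [h1, iteratedDeriv_add_mul (ν.2.2 i) (hb i) hd, dist_self_add_right, Real.norm_eq_abs,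
      abs_mul]
    exact (mul_le_mul_of_nonneg_left (hB' s) (abs_nonneg δ)).trans_lt h2

/-! ### Generic weights -/

/-- The derivative of `focalSign` with respect to arclength. -/
def focalSlope (K : ClosedCurves n) (μ : K.carrier → ℝ) (i : Fin K.m) (s : ℝ) : ℝ :=
  iteratedDeriv 3 (fun t => μ (K.point i t)) s
    + 1 / 4 * (deriv (fun t => K.curvature i t ^ 2) s * μ (K.point i s)
      + K.curvature i s ^ 2 * iteratedDeriv 1 (fun t => μ (K.point i t)) s)

theorem contDiff_curvature_sq (i : Fin K.m) : ContDiff ℝ 1 fun t => K.curvature i t ^ 2 := by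
  simp only [curvature_eq, curvVec_point]
  exact (K.contDiff_deriv₂_γ i).norm_sq ℝ

theorem hasDerivAt_focalSign {i : Fin K.m} (h : ContDiff ℝ 3 fun s => μ (K.point i s)) (s : ℝ) :
    HasDerivAt (K.focalSign μ i) (K.focalSlope μ i s) s := by
  have h0 := (h.differentiable (by norm_num) s).hasDerivAt
  have h2 := (h.differentiable_iteratedDeriv 2 (by norm_num) s).hasDerivAt
  rw [← iteratedDeriv_succ] at h2
  have hk := ((contDiff_curvature_sq (K := K) i).differentiable (by norm_num) s).hasDerivAt
  refine (h2.add ((hk.const_mul (1 / 4)).mul h0)).congr_deriv ?_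
  rw [focalSlope, iteratedDeriv_one]
  ring

theorem focalSign_add_mul {b : K.carrier → ℝ} {i : Fin K.m}
    (h : ContDiff ℝ 3 fun s => μ (K.point i s)) (hb : ContDiff ℝ 3 fun s => b (K.point i s))
    (δ s : ℝ) : K.focalSign (fun q => μ q + δ * b q) i s =
      K.focalSign μ i s + δ * K.focalSign b i s := by
  simp only [focalSign, iteratedDeriv_add_mul h hb (show 2 ≤ 3 by norm_num)]
  ring

theorem focalSlope_add_mul {b : K.carrier → ℝ} {i : Fin K.m}
    (h : ContDiff ℝ 3 fun s => μ (K.point i s)) (hb : ContDiff ℝ 3 fun s => b (K.point i s))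
    (δ s : ℝ) : K.focalSlope (fun q => μ q + δ * b q) i s =
      K.focalSlope μ i s + δ * K.focalSlope b i s := by
  simp only [focalSlope, iteratedDeriv_add_mul h hb (show 3 ≤ 3 by norm_num),
    iteratedDeriv_add_mul h hb (show 1 ≤ 3 by norm_num)]
  ring

theorem focalSign_of_curvature_eq_zero {i : Fin K.m} {s : ℝ} (hs : K.curvature i s = 0) :
    K.focalSign μ i s = iteratedDeriv 2 (fun t => μ (K.point i t)) s := by
  simp [focalSign, hs]

/-- κ² has a minimum where κ vanishes, so its derivative drops out as well. -/
theorem focalSlope_of_curvature_eq_zero {i : Fin K.m} {s : ℝ} (hs : K.curvature i s = 0) :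
    K.focalSlope μ i s = iteratedDeriv 3 (fun t => μ (K.point i t)) s := by
  have hmin : IsLocalMin (fun t => K.curvature i t ^ 2) s :=
    Eventually.of_forall fun t => by
      simp only [hs, ne_eq, OfNat.ofNat_ne_zero, not_false_eq_true, zero_pow]
      positivity
  simp [focalSlope, hs, hmin.deriv_eq_zero]

/-- The weights for which `focalSign` has only simple zeros. -/
def genericWeights (K : ClosedCurves n) : Set K.C3Weight :=
  {ν | ∀ i s, K.focalSign ν.1 i s ≠ 0 ∨ K.focalSlope ν.1 i s ≠ 0}

theorem mem_genericWeights {ν : K.C3Weight} : ν ∈ K.genericWeights ↔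
    ∀ i s, K.focalSign ν.1 i s ≠ 0 ∨ K.focalSlope ν.1 i s ≠ 0 := Iff.rfl

/-- Sign and slope are jointly continuous in the weight and the parameter, and one period is
compact. -/
theorem isOpen_genericWeights : IsOpen K.genericWeights := by
  rw [isOpen_iff_eventually]
  intro ν hν
  rw [mem_genericWeights] at hν
  have hcurv : ∀ i, Continuous fun t => K.curvature i t ^ 2 :=
    fun i => (contDiff_curvature_sq i).continuous
  have hcurv' : ∀ i, Continuous (deriv fun t => K.curvature i t ^ 2) :=
    fun i => (contDiff_curvature_sq i).continuous_deriv le_rfl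
  have hc0 := fun i : Fin K.m => continuous_iteratedDeriv_C3Weight i (show 0 < 4 by norm_num)
  have hc1 := fun i : Fin K.m => continuous_iteratedDeriv_C3Weight i (show 1 < 4 by norm_num)
  have hc2 := fun i : Fin K.m => continuous_iteratedDeriv_C3Weight i (show 2 < 4 by norm_num)
  have hc3 := fun i : Fin K.m => continuous_iteratedDeriv_C3Weight i (show 3 < 4 by norm_num)
  simp only [iteratedDeriv_zero] at hc0
  have hsign : ∀ i, Continuous fun x : K.C3Weight × ℝ => K.focalSign x.1.1 i x.2 := fun i =>
    (hc2 i).add ((((hcurv i).comp continuous_snd).const_mul (1 / 4)).mul (hc0 i))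
  have hslope : ∀ i, Continuous fun x : K.C3Weight × ℝ => K.focalSlope x.1.1 i x.2 := fun i =>
    (hc3 i).add (((((hcurv' i).comp continuous_snd).mul (hc0 i)).add
      (((hcurv i).comp continuous_snd).mul (hc1 i))).const_mul (1 / 4))
  have key : ∀ᶠ ν' in 𝓝 ν, ∀ i, ∀ s ∈ Set.Icc 0 (K.len i),
      K.focalSign ν'.1 i s ≠ 0 ∨ K.focalSlope ν'.1 i s ≠ 0 := by
    rw [eventually_all]
    intro i
    refine isCompact_Icc.eventually_forall_of_forall_eventually fun s _ => ?_
    rcases hν i s with h | h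
    · have hs : ContinuousAt (fun x : K.C3Weight × ℝ => K.focalSign x.1.1 i x.2) (ν, s) :=
        (hsign i).continuousAt
      filter_upwards [hs.eventually_ne h] with x hx
      exact Or.inl hx
    · have hs : ContinuousAt (fun x : K.C3Weight × ℝ => K.focalSlope x.1.1 i x.2) (ν, s) :=
        (hslope i).continuousAt
      filter_upwards [hs.eventually_ne h] with x hx
      exact Or.inr hx
  filter_upwards [key] with ν' h'
  rw [mem_genericWeights]
  intro i s
  obtain ⟨k, hk, -⟩ := existsUnique_add_zsmul_mem_Ico (K.len_pos i) s 0
  have hper : Function.Periodic (K.focalSign ν'.1 i) (K.len i) := by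
    intro t
    simp only [focalSign_eq, K.point_periodic i t]
  have hper' : Function.Periodic (K.focalSlope ν'.1 i) (K.len i) := by
    intro t
    have h1 : HasDerivAt (fun u => K.focalSign ν'.1 i (u + K.len i))
        (K.focalSlope ν'.1 i (t + K.len i)) t :=
      (hasDerivAt_focalSign (ν'.2.2 i) (t + K.len i)).comp_add_const t (K.len i)
    rw [funext hper] at h1
    exact h1.unique (hasDerivAt_focalSign (ν'.2.2 i) t)
  rw [zero_add] at hk
  have := h' i _ ⟨hk.1, hk.2.le⟩
  rwa [hper.zsmul k s, hper'.zsmul k s] at this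

theorem LR_eq_UR_of_mem_genericWeights {ν : K.C3Weight} (hν : ν ∈ K.genericWeights) :
    K.LR ν.1 = K.UR ν.1 := by
  have h : K.IsWeight 2 ν.1 := ν.2.of_le (by norm_num)
  suffices ∀ i, K.focRadZeroComponent ν.1 i = K.focRadMinusComponent ν.1 i by
    simp only [LR, UR, focRadZero, focRadMinus, this]
  intro i
  unfold focRadZeroComponent focRadMinusComponent
  congr 1
  set M := sSup (Set.range fun s => |deriv (fun t => ν.1 (K.point i t)) s| ^ 2)
  have hM : 0 ≤ M := Real.sSup_nonneg (by rintro _ ⟨s, rfl⟩; positivity)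
  refine le_antisymm (max_le (Real.sSup_le ?_ (le_max_of_le_right hM)) (le_max_right _ _))
    (max_le (Real.sSup_le ?_ (le_max_of_le_right hM)) (le_max_right _ _))
  · rintro _ ⟨s, hs, rfl⟩
    -- If no positive values accumulated at s, then s would be a local maximum with value 0, hence a
    -- zero that is not simple. On the closure, the continuous function Λ keeps its bound.
    have hcl : s ∈ closure {t | 0 < K.focalSign ν.1 i t} := by
      rw [mem_closure_iff_frequently]
      intro hev
      have hmax : ∀ᶠ t in 𝓝 s, K.focalSign ν.1 i t ≤ 0 :=
        hev.mono fun t ht => not_lt.1 ht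
      have h0 : K.focalSign ν.1 i s = 0 := le_antisymm hmax.self_of_nhds hs
      have hloc : IsLocalMax (K.focalSign ν.1 i) s := by
        filter_upwards [hmax] with t ht
        rwa [h0]
      rcases hν i s with h1 | h1
      · exact h1 h0
      · exact h1 (hloc.hasDerivAt_eq_zero (hasDerivAt_focalSign (ν.2.2 i) s))
    have hsub : closure {t | 0 < K.focalSign ν.1 i t} ⊆ {t | K.focalValue ν.1 i t ≤
        max (sSup (K.focalValue ν.1 i '' {t | 0 < K.focalSign ν.1 i t})) M} := by
      refine closure_minimal ?_ (isClosed_le (continuous_focalValue h i) continuous_const)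
      intro t ht
      exact le_max_of_le_left (le_csSup (bddAbove_focalValue h i _) ⟨t, ht, rfl⟩)
    exact hsub hcl
  · rintro _ ⟨s, hs, rfl⟩
    exact le_max_of_le_left (le_csSup (bddAbove_focalValue h i _)
      ⟨s, focalSign_pos_subset hs, rfl⟩)

/-- The weights for which `focalSign` has only simple zeros where the curvature vanishes. -/
def flatGenericWeights (K : ClosedCurves n) : Set K.C3Weight :=
  {ν | ∀ i s, K.curvature i s = 0 → K.focalSign ν.1 i s ≠ 0 ∨ K.focalSlope ν.1 i s ≠ 0}

/-- Adding a constant δ to the weight changes the sign function by δκ²/4. For almost every δ all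
zeros with κ ≠ 0 become simple, while at points with κ = 0 neither value nor slope changes. -/
theorem flatGenericWeights_subset_closure : K.flatGenericWeights ⊆ closure K.genericWeights := by
  intro ν hν
  have hb : ∀ i, ContDiff ℝ 3 fun s => (fun _ : K.carrier => (1 : ℝ)) (K.point i s) :=
    fun i => contDiff_const
  refine mem_closure_of_frequently_add (b := fun _ => 1) hb ?_
  have hnull : MeasureTheory.volume (⋃ i, {δ : ℝ | ∃ s, K.focalSign (fun _ => 1) i s ≠ 0 ∧
      K.focalSign ν.1 i s + δ * K.focalSign (fun _ => 1) i s = 0 ∧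
      K.focalSlope ν.1 i s + δ * K.focalSlope (fun _ => 1) i s = 0}) = 0 :=
    MeasureTheory.measure_iUnion_null fun i => volume_degenerate_eq_zero
      (hasDerivAt_focalSign (ν.2.2 i)) (hasDerivAt_focalSign (hb i))
  refine (frequently_notMem_of_volume_eq_zero hnull 0).mono fun δ hδ hw => ?_
  refine mem_genericWeights.2 fun i s => ?_
  change K.focalSign (fun q => ν.1 q + δ * 1) i s ≠ 0 ∨
    K.focalSlope (fun q => ν.1 q + δ * 1) i s ≠ 0
  rw [focalSign_add_mul (b := fun _ => 1) (ν.2.2 i) (hb i),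
    focalSlope_add_mul (b := fun _ => 1) (ν.2.2 i) (hb i)]
  by_contra! hcon
  have h1 : K.focalSign (fun _ => 1) i s = 1 / 4 * K.curvature i s ^ 2 := by
    rw [focalSign, iteratedDeriv_const]
    simp
  by_cases hκ : K.curvature i s = 0
  · have h2 : K.focalSlope (fun _ => 1) i s = 0 := by
      rw [focalSlope_of_curvature_eq_zero hκ, iteratedDeriv_const]
      simp
    rw [h1, h2, hκ] at hcon
    rcases hν i s hκ with h | h
    · exact h (by simpa using hcon.1)
    · exact h (by simpa using hcon.2)
  · exact hδ (Set.mem_iUnion.2 ⟨i, s, by rw [h1]; positivity, hcon⟩)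

/-- Constants have no effect where κ = 0, so μ is perturbed by a sine with the period of each
component. Sard handles the points where the sine is nonzero. At its zeros the cosine is nonzero,
and each zero excludes a single δ. -/
theorem dense_flatGenericWeights : Dense K.flatGenericWeights := by
  intro ν
  set c : Fin K.m → ℝ := fun i => 2 * Real.pi / K.len i with hc
  have hc0 : ∀ i, c i ≠ 0 := fun i => (div_pos Real.two_pi_pos (K.len_pos i)).ne'
  have hper : ∀ i, Function.Periodic (fun s => Real.sin (c i * s)) (K.len i) := by
    intro i s
    have : c i * (s + K.len i) = c i * s + 2 * Real.pi := by
      rw [mul_add, hc, div_mul_cancel₀ _ (K.len_pos i).ne']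
    simp only [this, Real.sin_add_two_pi]
  set b : K.carrier → ℝ := K.lift fun i s => Real.sin (c i * s) with hbdef
  have hbp : ∀ i, (fun s => b (K.point i s)) = fun s => Real.sin (c i * s) :=
    fun i => funext (K.lift_point hper i)
  have hb : ∀ i, ContDiff ℝ 3 fun s => b (K.point i s) := by
    intro i
    rw [hbp]
    fun_prop
  have hsin : ∀ i s, HasDerivAt (fun s => Real.sin (c i * s)) (c i * Real.cos (c i * s)) s :=
    fun i s => by simpa [mul_comm] using ((hasDerivAt_id s).const_mul (c i)).sin
  have hcos : ∀ i s, HasDerivAt (fun s => Real.cos (c i * s)) (-(c i * Real.sin (c i * s))) s :=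
    fun i s => by simpa [mul_comm] using ((hasDerivAt_id s).const_mul (c i)).cos
  have hb2 : ∀ i, iteratedDeriv 2 (fun s => b (K.point i s)) =
      fun s => -(c i ^ 2 * Real.sin (c i * s)) := by
    intro i
    rw [hbp, iteratedDeriv_succ, iteratedDeriv_one, funext fun s => (hsin i s).deriv]
    funext s
    rw [((hcos i s).const_mul (c i)).deriv]
    ring
  have hb3 : ∀ i, iteratedDeriv 3 (fun s => b (K.point i s)) =
      fun s => -(c i ^ 3 * Real.cos (c i * s)) := by
    intro i
    rw [iteratedDeriv_succ, hb2]
    funext s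
    rw [((hsin i s).const_mul (c i ^ 2)).fun_neg.deriv]
    ring
  refine mem_closure_of_frequently_add hb ?_
  have hD : ∀ {f : ℝ → ℝ}, ContDiff ℝ 3 f → ∀ s,
      HasDerivAt (iteratedDeriv 2 f) (iteratedDeriv 3 f s) s := by
    intro f hf s
    rw [iteratedDeriv_succ (n := 2)]
    exact (hf.differentiable_iteratedDeriv 2 (by norm_num) s).hasDerivAt
  have hnull₁ : MeasureTheory.volume (⋃ i, {δ : ℝ | ∃ s,
      iteratedDeriv 2 (fun s => b (K.point i s)) s ≠ 0 ∧
      iteratedDeriv 2 (fun s => ν.1 (K.point i s)) s +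
        δ * iteratedDeriv 2 (fun s => b (K.point i s)) s = 0 ∧
      iteratedDeriv 3 (fun s => ν.1 (K.point i s)) s +
        δ * iteratedDeriv 3 (fun s => b (K.point i s)) s = 0}) = 0 :=
    MeasureTheory.measure_iUnion_null fun i => volume_degenerate_eq_zero
      (hD (ν.2.2 i)) (hD (hb i))
  -- The zeros of the sine are the countably many points kπ/c, with one bad δ for each.
  have hnull₂ : MeasureTheory.volume (Set.range fun x : Fin K.m × ℤ =>
      -iteratedDeriv 3 (fun s => ν.1 (K.point x.1 s)) (x.2 * Real.pi / c x.1) /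
        iteratedDeriv 3 (fun s => b (K.point x.1 s)) (x.2 * Real.pi / c x.1)) = 0 :=
    (Set.countable_range _).measure_zero _
  refine (frequently_notMem_of_volume_eq_zero
    (MeasureTheory.measure_union_null hnull₁ hnull₂) 0).mono fun δ hδ hw => ?_
  simp only [flatGenericWeights]
  intro i s hκ
  rw [focalSign_of_curvature_eq_zero hκ, focalSlope_of_curvature_eq_zero hκ,
    iteratedDeriv_add_mul (ν.2.2 i) (hb i) (by norm_num),
    iteratedDeriv_add_mul (ν.2.2 i) (hb i) le_rfl]
  by_contra! hcon
  by_cases h0 : iteratedDeriv 2 (fun s => b (K.point i s)) s = 0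
  · have hs0 : Real.sin (c i * s) = 0 := by
      rw [hb2] at h0
      simpa [hc0 i] using h0
    have h3 : iteratedDeriv 3 (fun s => b (K.point i s)) s ≠ 0 := by
      have hcs : Real.cos (c i * s) ≠ 0 := by
        intro h
        have := Real.sin_sq_add_cos_sq (c i * s)
        rw [hs0, h] at this
        norm_num at this
      rw [hb3]
      exact neg_ne_zero.2 (mul_ne_zero (pow_ne_zero 3 (hc0 i)) hcs)
    obtain ⟨k, hk⟩ := Real.sin_eq_zero_iff.1 hs0
    have hsk : (k : ℝ) * Real.pi / c i = s := by
      rw [hk, mul_div_cancel_left₀ _ (hc0 i)]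
    refine hδ (Or.inr ⟨(i, k), ?_⟩)
    simp only [hsk]
    rw [div_eq_iff h3]
    linarith [hcon.2]
  · exact hδ (Or.inl (Set.mem_iUnion.2 ⟨i, s, h0, hcon⟩))

theorem dense_genericWeights : Dense K.genericWeights := by
  intro ν
  exact closure_minimal flatGenericWeights_subset_closure isClosed_closure
    (dense_flatGenericWeights ν)

end ClosedCurves

end

theorem theorem1 (n : ℕ) :
    (∀ (K : ClosedCurves n) (μ : K.carrier → ℝ), K.IsWeight 2 μ →
      K.LR μ = K.DIR μ ∧ K.DIR μ ≤ K.TIR μ ∧ K.TIR μ ≤ K.AIR μ ∧ K.AIR μ = K.UR μ) ∧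
    (∀ K : ClosedCurves n, ∃ S : Set K.C3Weight,
      IsOpen S ∧ Dense S ∧ ∀ μ ∈ S, K.LR μ.1 = K.UR μ.1) ∧
    (∀ (K : ℕ → ClosedCurves n) (μ : ∀ k, (K k).carrier → ℝ)
      (K₀ : ClosedCurves n) (μ₀ : K₀.carrier → ℝ),
      (∀ k, (K k).IsWeight 2 (μ k)) → K₀.IsWeight 2 μ₀ →
      ClosedCurves.C2Converges K μ K₀ μ₀ →
      limsup (fun k => (K k).AIR (μ k)) atTop ≤ K₀.AIR μ₀) := by
  refine ⟨fun K μ h => ⟨?_, ?_, ?_, ?_⟩, ?_, ?_⟩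
  · exact (ClosedCurves.LR_le_DIR h).antisymm (ClosedCurves.DIR_le_LR h)
  · exact ClosedCurves.DIR_le_TIR h
  · exact ClosedCurves.TIR_le_AIR h
  · exact (ClosedCurves.AIR_le_UR h).antisymm (ClosedCurves.UR_le_AIR h)
  · exact fun K => ⟨K.genericWeights, ClosedCurves.isOpen_genericWeights,
      ClosedCurves.dense_genericWeights,
      fun _ => ClosedCurves.LR_eq_UR_of_mem_genericWeights⟩
  · exact fun K μ K₀ μ₀ h h₀ hc => ClosedCurves.limsup_AIR_le h h₀ hc
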